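/- **Setting.** Let $d\ge 1$ and let $f:\mathbb R^d\to\mathbb R$ be twice differentiable with $\|\nabla f(x)-\nabla f(y)\|\le L_1\|x-y\|$ and $\|\nabla^2 f(x)-\nabla^2 f(y)\|_2\le L_2\|x-y\|$ for all $x,y$, where $L_1,L_2>0$. Let $x_0\in\mathbb R^d$ and $\Delta>0$ with $f(x_0)-f(x)\le\Delta$ for all $x$. Let $0<\epsilon_1$, $0<\epsilon_2\le\min(1,L_1/3)$ and $0<\delta<1$. A gradient evaluation costs $T_g\ge 0$ and a Hessian-vector product costs $T_h\ge T_g$ (a gradient of $f$ plus an explicit function of the distance to a known point also costs $T_g$). **Algorithms.** Put $\operatorname{sgn}(t)=-1$ for $t<0$ and $\operatorname{sgn}(t)=1$ for $t\ge 0$. *NCG$(x,\varepsilon,\delta)$*: run $1+\lceil\sqrt{L_1/\varepsilon}\,\log(4d/\delta)\rceil$ steps (fewer, if it breaks down) of the Lanczos method for the largest eigenvalue of $L_1I-\nabla^2f(x)$, from a fresh random vector uniformly distributed on the unit sphere; let $v$ be the resulting unit Ritz vector and $c=v^\top\nabla^2f(x)v$. If $c<0$ and $\frac{2|c|^3}{3L_2^2}>\frac{\|\nabla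 f(x)\|^2}{2L_1}$, set $x^+=x-\frac{2|c|}{L_2}\operatorname{sgn}(v^\top\nabla f(x))\,v$; otherwise set $x^+=x-\frac1{L_1}\nabla f(x)$. Return $(x^+,v)$. *NCG-A1$(x_0,\epsilon_1,\epsilon_2,\delta)$*: put $x_1=x_0$ and $\delta'=\delta/(1+\max(\frac{12L_2^2}{\epsilon_2^3},\frac{2L_1}{\epsilon_1^2})\Delta)$. For $j=1,2,\dots$: $(x_{j+1},v_j)=\mathrm{NCG}(x_j,\max(\epsilon_2,\|\nabla f(x_j)\|)/2,\delta')$; if $v_j^\top\nabla^2f(x_j)v_j>-\epsilon_2/2$ and $\|\nabla f(x_j)\|\le\epsilon_1$, return $x_j$. *AGD$(g,y_1,\epsilon,L,\sigma)$*: put $\kappa=L/\sigma$, $z_1=y_1$. For $j=1,2,\dots$: if $\|\nabla g(y_j)\|\le\epsilon$, return $y_j$; otherwise (one *gradient step*) $y_{j+1}=z_j-\frac1L\nabla g(z_j)$ and $z_{j+1}=\bigl(1+\frac{\sqrt\kappa-1}{\sqrt\kappa+1}\bigr)y_{j+1}-\frac{\sqrt\kappa-1}{\sqrt\kappa+1}y_j$.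 *Almost-Convex-AGD$(g,z_1,\epsilon,\gamma,L)$*: for $j=1,2,\dots$: if $\|\nabla g(z_j)\|\le\epsilon$, return $z_j$; otherwise $z_{j+1}=\mathrm{AGD}\bigl(g+\gamma\|\cdot-z_j\|^2,\,z_j,\,\epsilon\sqrt{\gamma/(50(L+2\gamma))},\,L,\,\gamma\bigr)$. *NCG-B1$(x_0,\epsilon_1,\epsilon_2,\delta)$*: start at $x_1=x_0$ and put $K=\bigl\lceil1+\Delta\bigl(\frac{\max(12L_2^2,2L_1)}{\epsilon_2^3}+\frac{2\sqrt{10}L_2}{\epsilon_1\epsilon_2}\bigr)\bigr\rceil$, $\delta'=\delta/K$. For $k=1,2,\dots$: $\hat x_k=\text{NCG-A1}(x_k,\epsilon_2^{3/2},\epsilon_2,\delta')$; if $\|\nabla f(\hat x_k)\|\le\epsilon_1$, return $\hat x_k$; otherwise $x_{k+1}=\text{Almost-Convex-AGD}(f_k,\hat x_k,\epsilon_1/2,3\epsilon_2,5L_1)$, where $f_k(x)=f(x)+L_1\bigl([\|x-\hat x_k\|-\epsilon_2/L_2]_+\bigr)^2$. **Theorem.** There are an absolute constant $C_0$ and a constant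 $C$ that depends only on $L_1,L_2,\Delta$ such that, with $\tau=1+\frac1{\epsilon_1}+\frac1{\epsilon_2}+\frac1\delta+d+L_1+L_2+\Delta$ and with $\delta'=\delta/K$ as in NCG-B1, the following holds with probability at least $1-\delta$. NCG-B1 terminates and returns a point $\hat x$ with $\|\nabla f(\hat x)\|\le\epsilon_1$ and $\lambda_{\min}(\nabla^2f(\hat x))\ge-\epsilon_2$. It uses at most $C\bigl(\frac1{\epsilon_2^3}+\frac1{\epsilon_1\epsilon_2}\bigr)$ NCG steps and at most $C\bigl(\frac1{\epsilon_2^{7/2}}+\frac1{\epsilon_1\epsilon_2^{3/2}}+\frac{\epsilon_2^{1/2}}{\epsilon_1^2}\bigr)\log\tau$ gradient steps in Almost-Convex-AGD. Each NCG step (iteration of NCG-A1), at a point $x_j$, takes time at most $$C\,T_h\frac{\sqrt{L_1}}{\max(\epsilon_2,\|\nabla f(x_j)\|)^{1/2}}\log\frac d{\delta'}\quad\text{and at most}\quad C_0\,T_h\Bigl(1+\frac{\sqrt{L_1}}{\max(\epsilon_2,\|\nabla f(x_j)\|)^{1/2}}\log\frac d{\delta'}\Bigr).$$ The total time is at most $$C\Bigl(\Bigl(\frac1{\epsilon_1\epsilon_2^{3/2}}+\frac1{\epsilon_2^{7/2}}\Bigr)T_h+\frac{\epsilon_2^{1/2}}{\epsilon_1^2}T_g\Bigr)\log\tau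 .$$ -/

import Mathlib

open MeasureTheory ProbabilityTheory

noncomputable section

namespace NCG

/-- The Euclidean space `ℝ^d`. -/
abbrev E (d : ℕ) : Type := EuclideanSpace ℝ (Fin d)

/-- The Hessian `∇² f(x)` as a linear operator, i.e. the derivative of the gradient field. -/
def hessian {d : ℕ} (f : E d → ℝ) (x : E d) : E d →L[ℝ] E d :=
  fderiv ℝ (gradient f) x

/-- The smallest eigenvalue of an operator. -/
def lambdaMin {d : ℕ} (A : E d →L[ℝ] E d) : ℝ :=
  sInf {r : ℝ | Module.End.HasEigenvalue (A : E d →ₗ[ℝ] E d) r}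

/-- `f` is twice differentiable, its gradient is `L₁`-Lipschitz, and its Hessian is
`L₂`-Lipschitz in the spectral norm. -/
structure SmoothObjective {d : ℕ} (f : E d → ℝ) (L₁ L₂ : ℝ) : Prop where
  differentiable : Differentiable ℝ f
  differentiable_gradient : Differentiable ℝ (gradient f)
  gradient_lipschitz : ∀ x y, ‖gradient f x - gradient f y‖ ≤ L₁ * ‖x - y‖
  hessian_lipschitz : ∀ x y, ‖hessian f x - hessian f y‖ ≤ L₂ * ‖x - y‖

/-- The uniform probability distribution on the unit sphere of `ℝ^d`. -/
def uniformSphere (d : ℕ) : Measure (E d) :=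
  (((volume : Measure (E d)).toSphere Set.univ)⁻¹ • (volume : Measure (E d)).toSphere).map
    Subtype.val

/-! ### Computations with a log of the work done -/

/-- Record of one iteration of NCG-A1 (one NCG step): the iterate at which it was performed, and
the numbers of gradient evaluations and of Hessian-vector products that it used. -/
structure StepRecord (d : ℕ) where
  point : E d
  grads : ℕ
  hvps : ℕ

/-- What has been done so far: the NCG steps (in order), the number of gradient steps of the
accelerated gradient method, and the total numbers of gradient evaluations and of Hessian-vector
products. -/
structure Log (d : ℕ) where
  ncgSteps : List (StepRecord d)
  agdSteps : ℕ
  grads : ℕ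
  hvps : ℕ

/-- The log at the start of a run. -/
def Log.empty (d : ℕ) : Log d := ⟨[], 0, 0, 0⟩

/-- Running time, if one gradient evaluation takes time `Tg` and one Hessian-vector product
takes time `Th`. -/
def Log.time {d : ℕ} (l : Log d) (Tg Th : ℝ) : ℝ := Tg * l.grads + Th * l.hvps

/-- Running time of one recorded NCG step. -/
def StepRecord.time {d : ℕ} (s : StepRecord d) (Tg Th : ℝ) : ℝ := Tg * s.grads + Th * s.hvps

/-- A computation that updates the log and that may fail to terminate. -/
abbrev Alg (d : ℕ) (α : Type) : Type := StateT (Log d) Part α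

/-- One pass through the body of a loop, on pairs of a loop state and a log. -/
def loopStep {d : ℕ} {σ α : Type} (body : σ → Alg d (α ⊕ σ)) :
    σ × Log d →. (α × Log d) ⊕ (σ × Log d) := fun p =>
  (body p.1 p.2).map fun r =>
    match r with
    | (Sum.inl a, l') => Sum.inl (a, l')
    | (Sum.inr s', l') => Sum.inr (s', l')

/-- `for j = 1, 2, …`: repeat `body` until it returns a value `Sum.inl a`. If it never does, the
computation does not terminate. -/
def loop {d : ℕ} {σ α : Type} (body : σ → Alg d (α ⊕ σ)) (s : σ) : Alg d α := fun l =>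
  (loopStep body).fix (s, l)

/-- One gradient evaluation. It is applied to the objective `f`, or to `f` plus explicit
functions of the distance to a known point, whose gradients are available in closed form. -/
def evalGrad {d : ℕ} (f : E d → ℝ) (x : E d) : Alg d (E d) := do
  modify fun l => { l with grads := l.grads + 1 }
  pure (gradient f x)

/-- One Hessian-vector product. -/
def evalHvp {d : ℕ} (f : E d → ℝ) (x v : E d) : Alg d (E d) := do
  modify fun l => { l with hvps := l.hvps + 1 }
  pure (hessian f x v)

/-! ### The Lanczos method -/

/-- The Lanczos three-term recurrence for the matrix `A = L₁ I - ∇² f(x)`, at most `m` steps from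
the current vector `q`, where `p` is the preceding vector and `β` the last off-diagonal entry. It
returns the list of the triples `(q_j, α_j, β_j)`, where the `q_j` are the Lanczos vectors, the
`α_j = q_jᵀ A q_j` are the diagonal entries and `β_j` is the off-diagonal entry that couples
`q_{j-1}` and `q_j`. It stops early when the residual is zero (the Krylov space is invariant). -/
def lanczosRun {d : ℕ} (f : E d → ℝ) (L₁ : ℝ) (x : E d) :
    ℕ → E d → E d → ℝ → Alg d (List (E d × ℝ × ℝ))
  | 0, _, _, _ => pure []
  | m + 1, p, q, β =>
    open Classical in
    if q = 0 then pure []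
    else do
      let h ← evalHvp f x q
      let Aq : E d := L₁ • q - h
      let a : ℝ := inner ℝ q Aq
      let w : E d := Aq - a • q - β • p
      let rest ← lanczosRun f L₁ x m q (‖w‖⁻¹ • w) ‖w‖
      pure ((q, a, β) :: rest)

/-- The symmetric tridiagonal `n × n` matrix with diagonal `a 0, …, a (n-1)` and off-diagonal
entries `β 1, …, β (n-1)`. -/
def tridiag (n : ℕ) (a β : ℕ → ℝ) : Matrix (Fin n) (Fin n) ℝ := Matrix.of fun i j =>
  if i = j then a i
  else if (i : ℕ) + 1 = j then β j
  else if (j : ℕ) + 1 = i then β i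
  else 0

/-- The largest eigenvalue of a matrix. -/
def lambdaMax {n : ℕ} (T : Matrix (Fin n) (Fin n) ℝ) : ℝ :=
  sSup {r : ℝ | Module.End.HasEigenvalue (Matrix.toLin' T) r}

/-- The entries of the eigenvector with first entry `1` of an unreduced tridiagonal matrix for the
eigenvalue `θ`, obtained by solving `T s = θ s` row by row. -/
def eigCoeff (a β : ℕ → ℝ) (θ : ℝ) : ℕ → ℝ
  | 0 => 1
  | 1 => (θ - a 0) / β 1
  | j + 2 => ((θ - a (j + 1)) * eigCoeff a β θ (j + 1) - β (j + 1) * eigCoeff a β θ j) / β (j + 2)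

/-- The normalized Ritz vector for the largest Ritz value, from the output of the recurrence. -/
def ritzVector {d : ℕ} (l : List (E d × ℝ × ℝ)) : E d :=
  let q : ℕ → E d := fun i => (l.getD i 0).1
  let a : ℕ → ℝ := fun i => (l.getD i 0).2.1
  let β : ℕ → ℝ := fun i => (l.getD i 0).2.2
  let θ : ℝ := lambdaMax (tridiag l.length a β)
  let y : E d := ∑ i ∈ Finset.range l.length, eigCoeff a β θ i • q i
  ‖y‖⁻¹ • y

/-- At most `m` steps of the Lanczos method, started at the unit vector `b`, for the largest
eigenvalue of `L₁ I - ∇² f(x)`. -/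
def lanczos {d : ℕ} (f : E d → ℝ) (L₁ : ℝ) (x b : E d) (m : ℕ) : Alg d (E d) := do
  let l ← lanczosRun f L₁ x m 0 b 0
  pure (ritzVector l)

/-- Number of Lanczos steps for the noise level `ε` and the failure probability `δ`. -/
def lanczosSteps (d : ℕ) (L₁ ε δ : ℝ) : ℕ :=
  1 + ⌈Real.sqrt L₁ / Real.sqrt ε * Real.log (4 * d / δ)⌉₊

/-! ### The algorithms -/

/-- The sign, with value `1` at `0`, so that a negative curvature step always moves. -/
def sgn (t : ℝ) : ℝ := if t < 0 then -1 else 1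

/-- The NCG step. The `i`-th NCG step of a run starts the Lanczos method at `ω i`. The negative
curvature direction is taken only if the curvature along `v` is negative. -/
def ncg {d : ℕ} (f : E d → ℝ) (L₁ L₂ : ℝ) (ω : ℕ → E d) (x : E d) (ε δ : ℝ) :
    Alg d (E d × E d) := do
  let l ← get
  let v ← lanczos f L₁ x (ω l.ncgSteps.length) (lanczosSteps d L₁ ε δ)
  let Hv ← evalHvp f x v
  let c : ℝ := inner ℝ v Hv
  let g ← evalGrad f x
  if c < 0 ∧ 2 * |c| ^ 3 / (3 * L₂ ^ 2) > ‖g‖ ^ 2 / (2 * L₁) then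
    pure (x - (2 * |c| / L₂ * sgn (inner ℝ v g)) • v, v)
  else
    pure (x - (1 / L₁) • g, v)

/-- NCG-A1 from `x₀` with tolerances `ε₁`, `ε₂` and failure probability `δ`. -/
def ncgA1 {d : ℕ} (f : E d → ℝ) (L₁ L₂ Δ : ℝ) (ω : ℕ → E d) (x₀ : E d) (ε₁ ε₂ δ : ℝ) :
    Alg d (E d) :=
  let δ' : ℝ := δ / (1 + max (12 * L₂ ^ 2 / ε₂ ^ 3) (2 * L₁ / ε₁ ^ 2) * Δ)
  loop (fun x => do
    let l₀ ← get
    let g ← evalGrad f x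
    let (xnext, v) ← ncg f L₁ L₂ ω x (max ε₂ ‖g‖ / 2) δ'
    let Hv ← evalHvp f x v
    modify fun l =>
      { l with ncgSteps := l.ncgSteps ++ [⟨x, l.grads - l₀.grads, l.hvps - l₀.hvps⟩] }
    if inner ℝ v Hv > -ε₂ / 2 ∧ ‖g‖ ≤ ε₁ then pure (Sum.inl x)
    else pure (Sum.inr xnext)) x₀

/-- Accelerated-Gradient-Descent`(f, y₁, ε, L, σ)`. -/
def agd {d : ℕ} (f : E d → ℝ) (y₁ : E d) (ε L σ : ℝ) : Alg d (E d) :=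
  let κ : ℝ := L / σ
  let c : ℝ := (Real.sqrt κ - 1) / (Real.sqrt κ + 1)
  loop (fun (p : E d × E d) => do
    let gy ← evalGrad f p.1
    if ‖gy‖ ≤ ε then pure (Sum.inl p.1)
    else do
      let gz ← evalGrad f p.2
      modify fun l => { l with agdSteps := l.agdSteps + 1 }
      let ynext : E d := p.2 - (1 / L) • gz
      let znext : E d := (1 + c) • ynext - c • p.1
      pure (Sum.inr (ynext, znext))) (y₁, y₁)

/-- Almost-Convex-AGD`(f, z₁, ε, γ, L)`. -/
def almostConvexAGD {d : ℕ} (f : E d → ℝ) (z₁ : E d) (ε γ L : ℝ) : Alg d (E d) :=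
  loop (fun z => do
    let g ← evalGrad f z
    if ‖g‖ ≤ ε then pure (Sum.inl z)
    else do
      let znext ← agd (fun u => f u + γ * ‖u - z‖ ^ 2) z
        (ε * Real.sqrt (γ / (50 * (L + 2 * γ)))) L γ
      pure (Sum.inr znext)) z₁

/-- The bound `K` on the number of outer iterations that NCG-B1 uses to split its failure
probability. -/
def outerBound (L₁ L₂ Δ ε₁ ε₂ : ℝ) : ℕ :=
  ⌈1 + Δ * (max (12 * L₂ ^ 2) (2 * L₁) / ε₂ ^ 3 + 2 * Real.sqrt 10 * L₂ / (ε₁ * ε₂))⌉₊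

/-- `f(x) + L₁ ([‖x - x̂‖ - ε₂ / L₂]₊)²`. -/
def regularized {d : ℕ} (f : E d → ℝ) (L₁ L₂ ε₂ : ℝ) (xhat : E d) (x : E d) : ℝ :=
  f x + L₁ * (max (‖x - xhat‖ - ε₂ / L₂) 0) ^ 2

/-- NCG-B1 from `x₀` with tolerances `ε₁`, `ε₂` and failure probability `δ`, when the Lanczos
starting vectors are `ω 0, ω 1, …`. -/
def ncgB1 {d : ℕ} (f : E d → ℝ) (L₁ L₂ Δ : ℝ) (ω : ℕ → E d) (x₀ : E d) (ε₁ ε₂ δ : ℝ) :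
    Alg d (E d) :=
  let δ' : ℝ := δ / outerBound L₁ L₂ Δ ε₁ ε₂
  loop (fun x => do
    let xhat ← ncgA1 f L₁ L₂ Δ ω x (ε₂ ^ (3 / 2 : ℝ)) ε₂ δ'
    let g ← evalGrad f xhat
    if ‖g‖ ≤ ε₁ then pure (Sum.inl xhat)
    else do
      let xnext ← almostConvexAGD (regularized f L₁ L₂ ε₂ xhat) xhat (ε₁ / 2) (3 * ε₂) (5 * L₁)
      pure (Sum.inr xnext)) x₀

end NCG

end

/-!
The value of `f` is the potential that pays for every step, and randomness enters only through the
Lanczos starting vectors.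

*NCG steps.* The Lanczos vector `v` maximizes the Rayleigh quotient of `L₁ I - ∇²f(x)` over a Krylov
space (`ritzVector_spec`). Comparing it with suitable Chebyshev polynomials (`gapPoly`) shows that
`v` can miss the smallest curvature by more than the prescribed accuracy only if the starting vector
is almost orthogonal to one fixed eigenvector (`exists_lanczos_good_or_inner_le`), which is unlikely
on the sphere (`uniformSphere_abs_inner_le`). A step from a point that is not accepted decreases `f`
by at least `η = ε₂³ / max (12 L₂²) (2 L₁)`, whether Lanczos succeeds or not (`ncgNext_le`). If it
succeeds at an accepted point, then the Hessian there is bounded below by `-ε₂`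
(`Accepts.hessian_ge`).

*Gradient steps.* At an accepted point `x̂` the function `f` plus the penalty for leaving the ball
of radius `ε₂ / L₂` around `x̂` is `3 ε₂`-almost convex (`SmoothObjective.regGrad_almost_monotone`).
Hence adding `3 ε₂ ‖· - z‖²` makes it strongly convex, and accelerated gradient descent solves such
a problem in `O(ε₂ ^ (-1/2) log τ)` steps, by a potential argument (`agdPotential_step_le`). Each
pass of Almost-Convex-AGD that is not the last one moves by a fixed amount and pays for its length
with a decrease of `f` (`prox_step`). So either the result stays in the ball, where the penalty
vanishes and the gradient of `f` itself is small, or `f` has decreased substantially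
(`almostConvexAGD_progress`). In both cases the number of passes is controlled by the decrease of
`f`, so that the total decrease `Δ` bounds both the number of outer iterations, by `K`, and the
total number of passes (`ncgB1_terminates`).

*Probability.* On the event that Lanczos succeeds in the first `N` steps, the points visited follow
`stepPoint`, a recursion in which all inner loops are cut off after sufficiently many passes. It is
therefore defined and measurable for all starting vectors, and the point of the `i`-th step depends
on the first `i` of them only, hence is independent of the `i`-th starting vector (indices start at
`0`). A union bound over these `N` steps gives the failure probability
(`measure_exists_not_goodStart_le`), and the counts are turned into the stated bounds at the end.
-/

namespace NCG
open scoped RealInnerProductSpace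

/-! ### Taylor estimates -/

section Taylor

/-- If `φ' ≤ a + b t + c t²` on `[0, 1]`, then `φ 1 - φ 0` is at most the integral of the bound. -/
lemma le_of_deriv_le_quadratic {φ φ' : ℝ → ℝ} {a b c : ℝ}
    (h : ∀ t, HasDerivAt φ (φ' t) t)
    (hb : ∀ t, 0 ≤ t → t ≤ 1 → φ' t ≤ a + b * t + c * t ^ 2) :
    φ 1 ≤ φ 0 + a + b / 2 + c / 3 := by
  have hB : ∀ t, HasDerivAt (fun t : ℝ => φ 0 + a * t + b / 2 * t ^ 2 + c / 3 * t ^ 3)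
      (a + b * t + c * t ^ 2) t := by
    intro t
    have h1 := (hasDerivAt_id t).const_mul a
    have h2 := ((hasDerivAt_id t).pow 2).const_mul (b / 2)
    have h3 := ((hasDerivAt_id t).pow 3).const_mul (c / 3)
    refine (((h1.const_add (φ 0)).add h2).add h3).congr_deriv ?_
    simp; ring
  have := image_le_of_deriv_right_le_deriv_boundary (a := (0 : ℝ)) (b := 1)
    (f := φ) (f' := φ') (B := fun t : ℝ => φ 0 + a * t + b / 2 * t ^ 2 + c / 3 * t ^ 3)
    (B' := fun t => a + b * t + c * t ^ 2)
    (fun t _ => (h t).continuousAt.continuousWithinAt) (fun t _ => (h t).hasDerivWithinAt)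
    (by simp) (fun t _ => (hB t).continuousAt.continuousWithinAt)
    (fun t _ => (hB t).hasDerivWithinAt) (fun t ht => hb t ht.1 ht.2.le)
    (Set.right_mem_Icc.2 zero_le_one)
  simpa using this

variable {F : Type*} [NormedAddCommGroup F] [InnerProductSpace ℝ F]

lemma hasDerivAt_line (x v : F) (t : ℝ) : HasDerivAt (fun s : ℝ => x + s • v) v t := by
  simpa using ((hasDerivAt_id t).smul_const v).const_add x

variable [CompleteSpace F]

lemma hasDerivAt_comp_line {g : F → ℝ} {G : F → F} (hg : ∀ x, HasGradientAt g (G x) x)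
    (x v : F) (t : ℝ) :
    HasDerivAt (fun s : ℝ => g (x + s • v)) ⟪G (x + t • v), v⟫ t := by
  have h := (hg (x + t • v)).hasFDerivAt.comp_hasDerivAt t (hasDerivAt_line x v t)
  simpa [Function.comp_def] using h

/-- The descent lemma. -/
lemma le_of_gradient_lipschitz {g : F → ℝ} {G : F → F} {L : ℝ}
    (hg : ∀ x, HasGradientAt g (G x) x) (hL : ∀ x y, ‖G x - G y‖ ≤ L * ‖x - y‖) (x v : F) :
    g (x + v) ≤ g x + ⟪G x, v⟫ + L / 2 * ‖v‖ ^ 2 := by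
  have := le_of_deriv_le_quadratic (a := ⟪G x, v⟫) (b := L * ‖v‖ ^ 2) (c := 0)
    (hasDerivAt_comp_line hg x v) (fun t ht _ => by
      have h1 : ⟪G (x + t • v) - G x, v⟫ ≤ ‖G (x + t • v) - G x‖ * ‖v‖ := real_inner_le_norm _ _
      have h2 := hL (x + t • v) x
      rw [add_sub_cancel_left, norm_smul, Real.norm_of_nonneg ht] at h2
      rw [inner_sub_left] at h1
      nlinarith [mul_le_mul_of_nonneg_right h2 (norm_nonneg v)])
  simp only [one_smul, zero_smul, add_zero] at this
  linarith

/-- A gradient step decreases the function by at least `‖∇g‖² / (2L)`. -/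
lemma gradient_step_le {g : F → ℝ} {G : F → F} {L : ℝ} (hL0 : 0 < L)
    (hg : ∀ x, HasGradientAt g (G x) x) (hL : ∀ x y, ‖G x - G y‖ ≤ L * ‖x - y‖) (x : F) :
    g (x - (1 / L) • G x) ≤ g x - ‖G x‖ ^ 2 / (2 * L) := by
  have h := le_of_gradient_lipschitz hg hL x (-((1 / L) • G x))
  rw [← sub_eq_add_neg, inner_neg_right, inner_smul_right, real_inner_self_eq_norm_sq, norm_neg,
    norm_smul, mul_pow, Real.norm_of_nonneg (by positivity)] at h
  refine h.trans (le_of_eq ?_)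
  field_simp
  ring

lemma norm_gradient_sq_le {g : F → ℝ} {G : F → F} {L m : ℝ} (hL0 : 0 < L)
    (hg : ∀ x, HasGradientAt g (G x) x) (hL : ∀ x y, ‖G x - G y‖ ≤ L * ‖x - y‖)
    (hm : ∀ x, m ≤ g x) (x : F) : ‖G x‖ ^ 2 ≤ 2 * L * (g x - m) := by
  have h := (hm _).trans (gradient_step_le hL0 hg hL x)
  have : ‖G x‖ ^ 2 / (2 * L) ≤ g x - m := by linarith
  rw [div_le_iff₀ (by positivity)] at this
  linarith

/-- A function with strongly monotone gradient lies above its quadratic lower models. -/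
lemma ge_of_gradient_strongly_monotone {g : F → ℝ} {G : F → F} {σ : ℝ}
    (hg : ∀ x, HasGradientAt g (G x) x) (hσ : ∀ x y, σ * ‖x - y‖ ^ 2 ≤ ⟪G x - G y, x - y⟫)
    (x v : F) : g x + ⟪G x, v⟫ + σ / 2 * ‖v‖ ^ 2 ≤ g (x + v) := by
  have := le_of_deriv_le_quadratic (φ := fun s => - g (x + s • v))
    (a := -⟪G x, v⟫) (b := -(σ * ‖v‖ ^ 2)) (c := 0)
    (fun t => (hasDerivAt_comp_line hg x v t).neg) (fun t ht _ => by
      rcases ht.eq_or_lt with rfl | ht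
      · simp
      have h1 := hσ (x + t • v) x
      rw [add_sub_cancel_left, norm_smul, Real.norm_of_nonneg ht.le, inner_smul_right,
        inner_sub_left] at h1
      have h2 : t * (σ * ‖v‖ ^ 2 * t) ≤ t * (⟪G (x + t • v), v⟫ - ⟪G x, v⟫) := by
        linarith [show t * (σ * ‖v‖ ^ 2 * t) = σ * (t * ‖v‖) ^ 2 by ring]
      have h3 := le_of_mul_le_mul_left h2 ht
      linarith)
  simp only [one_smul, zero_smul, add_zero] at this
  linarith

end Taylor

section Smooth

variable {d : ℕ} {f : E d → ℝ} {L₁ L₂ : ℝ}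

lemma SmoothObjective.hasGradientAt (hf : SmoothObjective f L₁ L₂) (x : E d) :
    HasGradientAt f (gradient f x) x := (hf.differentiable x).hasGradientAt

lemma SmoothObjective.hasFDerivAt_gradient (hf : SmoothObjective f L₁ L₂) (x : E d) :
    HasFDerivAt (gradient f) (hessian f x) x := (hf.differentiable_gradient x).hasFDerivAt

lemma SmoothObjective.continuous_gradient (hf : SmoothObjective f L₁ L₂) :
    Continuous (gradient f) := hf.differentiable_gradient.continuous

lemma SmoothObjective.continuous_hessian (hf : SmoothObjective f L₁ L₂) :
    Continuous (hessian f) := by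
  refine (LipschitzWith.of_dist_le_mul (K := L₂.toNNReal) fun x y => ?_).continuous
  rw [dist_eq_norm, dist_eq_norm]
  exact (hf.hessian_lipschitz x y).trans
    (mul_le_mul_of_nonneg_right (Real.le_coe_toNNReal _) (norm_nonneg _))

lemma SmoothObjective.hessian_symm (hf : SmoothObjective f L₁ L₂) (x u v : E d) :
    ⟪hessian f x u, v⟫ = ⟪u, hessian f x v⟫ := by
  have h1 : ∀ y, HasFDerivAt f (InnerProductSpace.toDual ℝ (E d) (gradient f y)) y :=
    fun y => (hf.hasGradientAt y).hasFDerivAt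
  have h2 : HasFDerivAt (fun y => InnerProductSpace.toDual ℝ (E d) (gradient f y))
      (((InnerProductSpace.toDual ℝ (E d)).toContinuousLinearEquiv.toContinuousLinearMap).comp
        (hessian f x)) x :=
    (InnerProductSpace.toDual ℝ (E d)).toContinuousLinearEquiv.hasFDerivAt.comp x
      (hf.hasFDerivAt_gradient x)
  have h3 := second_derivative_symmetric h1 h2 u v
  simp only [ContinuousLinearMap.coe_comp, Function.comp_apply] at h3
  have h4 : ⟪hessian f x u, v⟫ = ⟪hessian f x v, u⟫ := h3
  rw [h4, real_inner_comm]

lemma SmoothObjective.norm_hessian_le (hf : SmoothObjective f L₁ L₂) (hL : 0 ≤ L₁) (x : E d) :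
    ‖hessian f x‖ ≤ L₁ := by
  have : LipschitzWith L₁.toNNReal (gradient f) := LipschitzWith.of_dist_le_mul fun x y => by
    rw [dist_eq_norm, dist_eq_norm, Real.coe_toNNReal _ hL]
    exact hf.gradient_lipschitz x y
  have h := norm_fderiv_le_of_lipschitz ℝ this (x₀ := x)
  rwa [Real.coe_toNNReal _ hL] at h

lemma SmoothObjective.inner_hessian_sub_le (hf : SmoothObjective f L₁ L₂) (x y v : E d) :
    |⟪hessian f x v, v⟫ - ⟪hessian f y v, v⟫| ≤ L₂ * ‖x - y‖ * ‖v‖ ^ 2 := by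
  rw [← inner_sub_left, ← _root_.sub_apply]
  refine (abs_real_inner_le_norm _ _).trans ?_
  have h1 := (hessian f x - hessian f y).le_opNorm v
  have h2 := mul_le_mul_of_nonneg_right (hf.hessian_lipschitz x y) (norm_nonneg v)
  nlinarith [mul_le_mul_of_nonneg_right (h1.trans h2) (norm_nonneg v)]

lemma SmoothObjective.hasDerivAt_inner_gradient (hf : SmoothObjective f L₁ L₂) (x v : E d)
    (t : ℝ) : HasDerivAt (fun s : ℝ => ⟪gradient f (x + s • v), v⟫)
      ⟪hessian f (x + t • v) v, v⟫ t := by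
  have h := (hf.hasFDerivAt_gradient (x + t • v)).comp_hasDerivAt t (hasDerivAt_line x v t)
  simpa using h.inner ℝ (hasDerivAt_const t v)

/-- The second order Taylor estimate for a function with Lipschitz Hessian. -/
lemma SmoothObjective.le_cubic (hf : SmoothObjective f L₁ L₂) (x v : E d) :
    f (x + v) ≤ f x + ⟪gradient f x, v⟫ + ⟪hessian f x v, v⟫ / 2 + L₂ / 6 * ‖v‖ ^ 3 := by
  have key : ∀ t : ℝ, 0 ≤ t → ⟪gradient f (x + t • v), v⟫ ≤
      ⟪gradient f x, v⟫ + ⟪hessian f x v, v⟫ * t + L₂ / 2 * ‖v‖ ^ 3 * t ^ 2 := by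
    intro t ht
    have h := le_of_deriv_le_quadratic (φ := fun s => ⟪gradient f (x + (t * s) • v), v⟫)
      (a := ⟪hessian f x v, v⟫ * t) (b := L₂ * ‖v‖ ^ 3 * t ^ 2) (c := 0)
      (fun s => by
        have h1 := (hf.hasDerivAt_inner_gradient x v (t * s)).scomp s
          ((hasDerivAt_id s).const_mul t)
        exact h1)
      (fun s hs _ => by
        have h1 := le_of_abs_le (hf.inner_hessian_sub_le (x + (t * s) • v) x v)
        rw [add_sub_cancel_left, norm_smul, Real.norm_of_nonneg (by positivity)] at h1
        simp only [mul_one, smul_eq_mul]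
        nlinarith [mul_le_mul_of_nonneg_left h1 ht])
    simp only [mul_one, mul_zero, zero_smul, add_zero] at h
    linarith
  have := le_of_deriv_le_quadratic (hasDerivAt_comp_line hf.hasGradientAt x v)
    (fun t ht _ => key t ht)
  simp only [one_smul, zero_smul, add_zero] at this
  linarith

lemma abs_sgn (t : ℝ) : |sgn t| = 1 := by
  unfold sgn; split_ifs <;> simp

lemma sgn_mul_self (t : ℝ) : sgn t * t = |t| := by
  unfold sgn
  split_ifs with h
  · rw [abs_of_neg h]; ring
  · rw [abs_of_nonneg (not_lt.1 h)]; ring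

/-- The decrease achieved by a step of length `2|c|/L₂` along a unit direction of negative
curvature `c`. -/
lemma SmoothObjective.curvature_step_le (hf : SmoothObjective f L₁ L₂) (hL₂ : 0 < L₂)
    {x v : E d} (hv : ‖v‖ = 1) (hc : ⟪v, hessian f x v⟫ < 0) :
    f (x - (2 * |⟪v, hessian f x v⟫| / L₂ * sgn ⟪v, gradient f x⟫) • v) ≤
      f x - 2 * |⟪v, hessian f x v⟫| ^ 3 / (3 * L₂ ^ 2) := by
  set c := ⟪v, hessian f x v⟫ with hcdef
  set s := sgn ⟪v, gradient f x⟫ with hs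
  have hs2 : s ^ 2 = 1 := by rw [← sq_abs, abs_sgn, one_pow]
  have h := hf.le_cubic x (-((2 * |c| / L₂ * s) • v))
  rw [← sub_eq_add_neg] at h
  refine h.trans ?_
  have h1 : ⟪gradient f x, -((2 * |c| / L₂ * s) • v)⟫ ≤ 0 := by
    rw [inner_neg_right, inner_smul_right, real_inner_comm, mul_assoc, hs, sgn_mul_self]
    have : 0 ≤ 2 * |c| / L₂ * |⟪v, gradient f x⟫| := by positivity
    linarith
  have h2 : ⟪hessian f x (-((2 * |c| / L₂ * s) • v)), -((2 * |c| / L₂ * s) • v)⟫ =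
      (2 * |c| / L₂) ^ 2 * c := by
    rw [map_neg, inner_neg_neg, map_smul, inner_smul_left, inner_smul_right, real_inner_comm,
      ← hcdef]
    simp only [conj_trivial]
    linear_combination ((2 * |c| / L₂) ^ 2 * c) * hs2
  have h3 : ‖-((2 * |c| / L₂ * s) • v)‖ = 2 * |c| / L₂ := by
    rw [norm_neg, norm_smul, hv, mul_one, Real.norm_eq_abs, abs_mul, abs_sgn, mul_one,
      abs_of_nonneg (by positivity)]
  rw [h2, h3]
  have h4 : c = -|c| := by rw [abs_of_neg hc]; ring
  have h5 : (2 * |c| / L₂) ^ 2 * c = - (4 * |c| ^ 3 / L₂ ^ 2) := by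
    conv_lhs => rw [h4]
    simp only [abs_neg, abs_abs]
    field_simp
    ring
  have h6 : L₂ / 6 * (2 * |c| / L₂) ^ 3 = 4 / 3 * (|c| ^ 3 / L₂ ^ 2) := by
    field_simp
    ring
  have h7 : 2 * |c| ^ 3 / (3 * L₂ ^ 2) = 2 / 3 * (|c| ^ 3 / L₂ ^ 2) := by
    field_simp
  rw [h5, h6, h7]
  have h8 : 4 * |c| ^ 3 / L₂ ^ 2 = 4 * (|c| ^ 3 / L₂ ^ 2) := by ring
  rw [h8]
  linarith

end Smooth


/-! ### Extremal eigenvalues of symmetric operators -/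

section Spectral

variable {V : Type*} [NormedAddCommGroup V] [InnerProductSpace ℝ V]

lemma exists_max_eigenvalue [FiniteDimensional ℝ V] [Nontrivial V] {T : V →ₗ[ℝ] V}
    (hT : T.IsSymmetric) :
    ∃ θ, Module.End.HasEigenvalue T θ ∧ ∀ x, ⟪x, T x⟫ ≤ θ * ‖x‖ ^ 2 := by
  have hpos : 0 < Module.finrank ℝ V := Module.finrank_pos
  have : Nonempty (Fin (Module.finrank ℝ V)) := ⟨⟨0, hpos⟩⟩
  obtain ⟨i, hi⟩ := Finite.exists_max (hT.eigenvalues rfl)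
  refine ⟨hT.eigenvalues rfl i, by simpa using hT.hasEigenvalue_eigenvalues rfl i, fun x => ?_⟩
  set u := hT.eigenvectorBasis rfl with hu
  have h1 : ∀ j, ⟪u j, T x⟫ = hT.eigenvalues rfl j * ⟪u j, x⟫ := by
    intro j
    rw [← hT, hu, hT.apply_eigenvectorBasis, inner_smul_left]
    simp
  rw [← u.sum_inner_mul_inner x (T x), ← real_inner_self_eq_norm_sq, ← u.sum_inner_mul_inner x x,
    Finset.mul_sum]
  refine Finset.sum_le_sum fun j _ => ?_
  rw [h1, real_inner_comm]
  have := mul_le_mul_of_nonneg_right (hi j) (mul_self_nonneg ⟪x, u j⟫)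
  rw [real_inner_comm (u j) x] at *
  nlinarith

end Spectral

lemma isSymmetric_of_forall {d : ℕ} {A : E d →L[ℝ] E d} (hA : ∀ u v, ⟪A u, v⟫ = ⟪u, A v⟫) :
    (A : E d →ₗ[ℝ] E d).IsSymmetric := hA

/-- A symmetric operator whose quadratic form is at least `r` has `λ_min ≥ r`. -/
lemma le_lambdaMin {d : ℕ} (hd : 1 ≤ d) {A : E d →L[ℝ] E d} (hA : ∀ u v, ⟪A u, v⟫ = ⟪u, A v⟫)
    {r : ℝ} (hr : ∀ u, r * ‖u‖ ^ 2 ≤ ⟪u, A u⟫) : r ≤ lambdaMin A := by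
  have : Nonempty (Fin d) := ⟨⟨0, hd⟩⟩
  obtain ⟨θ, hθ, -⟩ := exists_max_eigenvalue (isSymmetric_of_forall hA)
  refine le_csInf ⟨θ, hθ⟩ fun s hs => ?_
  obtain ⟨x, hx⟩ := Module.End.HasEigenvalue.exists_hasEigenvector hs
  have h := hr x
  have hx1 : A x = s • x := hx.apply_eq_smul
  rw [hx1, inner_smul_right, real_inner_self_eq_norm_sq] at h
  exact le_of_mul_le_mul_right h (by have := norm_pos_iff.2 hx.2; positivity)

/-- For a symmetric matrix, `lambdaMax` is attained and dominates the quadratic form. -/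
lemma lambdaMax_spec {n : ℕ} (hn : 0 < n) {T : Matrix (Fin n) (Fin n) ℝ} (hT : T.IsSymm) :
    (∃ s : Fin n → ℝ, s ≠ 0 ∧ T.mulVec s = lambdaMax T • s) ∧
      ∀ s : Fin n → ℝ, s ⬝ᵥ T.mulVec s ≤ lambdaMax T * (s ⬝ᵥ s) := by
  have : Nonempty (Fin n) := ⟨⟨0, hn⟩⟩
  have hsym : (Matrix.toEuclideanLin T).IsSymmetric := by
    rw [Matrix.isSymmetric_toEuclideanLin_iff, Matrix.IsHermitian,
      Matrix.conjTranspose_eq_transpose_of_trivial]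
    exact hT
  obtain ⟨θ, hθ, hmax⟩ := exists_max_eigenvalue hsym
  have hdot : ∀ s t : Fin n → ℝ, ⟪WithLp.toLp 2 s, WithLp.toLp 2 t⟫ = s ⬝ᵥ t := by
    intro s t
    rw [EuclideanSpace.inner_toLp_toLp, dotProduct_comm]
    simp
  have hmax' : ∀ s : Fin n → ℝ, s ⬝ᵥ T.mulVec s ≤ θ * (s ⬝ᵥ s) := by
    intro s
    have := hmax (WithLp.toLp 2 s)
    rw [← real_inner_self_eq_norm_sq, Matrix.toLpLin_toLp, hdot, hdot] at this
    exact this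
  obtain ⟨x, hx⟩ := hθ.exists_hasEigenvector
  have hs : T.mulVec x.ofLp = θ • x.ofLp := by
    have := congrArg WithLp.ofLp hx.apply_eq_smul
    simpa using this
  have hx0 : x.ofLp ≠ 0 := fun h => hx.2 (by ext i; simpa using congrFun h i)
  have hgr : IsGreatest {r : ℝ | Module.End.HasEigenvalue (Matrix.toLin' T) r} θ := by
    constructor
    · refine Module.End.hasEigenvalue_of_hasEigenvector (x := x.ofLp) ⟨?_, hx0⟩
      rw [Module.End.mem_eigenspace_iff, Matrix.toLin'_apply, hs]
    · intro r hr
      obtain ⟨y, hy⟩ := Module.End.HasEigenvalue.exists_hasEigenvector hr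
      have h1 : T.mulVec y = r • y := by simpa using hy.apply_eq_smul
      have h2 := hmax' y
      rw [h1, dotProduct_smul, smul_eq_mul] at h2
      have h3 : 0 < y ⬝ᵥ y := by
        rw [← hdot, real_inner_self_eq_norm_sq]
        have : 0 < ‖WithLp.toLp 2 y‖ := norm_pos_iff.2 fun h => hy.2 (by
          have := congrArg WithLp.ofLp h; simpa using this)
        positivity
      exact le_of_mul_le_mul_right h2 h3
  have : lambdaMax T = θ := hgr.csSup_eq
  rw [this]
  exact ⟨⟨_, hx0, hs⟩, hmax'⟩

/-! ### The Lanczos method computes the best Rayleigh quotient over a Krylov space -/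

section Lanczos

variable {d : ℕ}

/-- The state `(q_{j-1}, q_j, β_j)` of the Lanczos recurrence is mapped to the next one. -/
noncomputable def lanczosNext (A : E d →L[ℝ] E d) (s : E d × E d × ℝ) : E d × E d × ℝ :=
  let w := A s.2.1 - ⟪s.2.1, A s.2.1⟫ • s.2.1 - s.2.2 • s.1
  (s.2.1, ‖w‖⁻¹ • w, ‖w‖)

/-- The triple `(q_j, α_j, β_j)` that the Lanczos recurrence records in a given state. -/
noncomputable def lanczosTriple (A : E d →L[ℝ] E d) (s : E d × E d × ℝ) : E d × ℝ × ℝ :=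
  (s.2.1, ⟪s.2.1, A s.2.1⟫, s.2.2)

open Classical in
/-- The number of steps, at most `m`, that the Lanczos recurrence makes before it breaks down. -/
noncomputable def lanczosLen (A : E d →L[ℝ] E d) : ℕ → E d × E d × ℝ → ℕ
  | 0, _ => 0
  | m + 1, s => if s.2.1 = 0 then 0 else lanczosLen A m (lanczosNext A s) + 1

/-- The output of the Lanczos recurrence. -/
noncomputable def lanczosList (A : E d →L[ℝ] E d) (m : ℕ) (s : E d × E d × ℝ) :
    List (E d × ℝ × ℝ) :=
  (List.range (lanczosLen A m s)).map fun i => lanczosTriple A ((lanczosNext A)^[i] s)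

lemma lanczosLen_le (A : E d →L[ℝ] E d) (m : ℕ) (s : E d × E d × ℝ) : lanczosLen A m s ≤ m := by
  induction m generalizing s with
  | zero => simp [lanczosLen]
  | succ m ih =>
    rw [lanczosLen]
    split_ifs
    · simp
    · exact Nat.succ_le_succ (ih _)

lemma lanczosLen_spec (A : E d →L[ℝ] E d) (m : ℕ) (s : E d × E d × ℝ) :
    (∀ i < lanczosLen A m s, ((lanczosNext A)^[i] s).2.1 ≠ 0) ∧
      (lanczosLen A m s = m ∨ ((lanczosNext A)^[lanczosLen A m s] s).2.1 = 0) := by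
  induction m generalizing s with
  | zero => simp [lanczosLen]
  | succ m ih =>
    rw [lanczosLen]
    split_ifs with h
    · simp [h]
    · obtain ⟨h1, h2⟩ := ih (lanczosNext A s)
      constructor
      · rintro (_ | i) hi
        · exact h
        · rw [Function.iterate_succ_apply]
          exact h1 i (by omega)
      · rcases h2 with h2 | h2
        · left; rw [h2]
        · right; rwa [Function.iterate_succ_apply]

lemma lanczosList_succ (A : E d →L[ℝ] E d) (m : ℕ) {s : E d × E d × ℝ} (h : s.2.1 ≠ 0) :
    lanczosList A (m + 1) s = lanczosTriple A s :: lanczosList A m (lanczosNext A s) := by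
  unfold lanczosList
  rw [lanczosLen, if_neg h, List.range_succ_eq_map]
  simp [Function.comp_def]

/-- The sequence of states of the Lanczos recurrence started at `b`. -/
noncomputable def lanczosSeq (A : E d →L[ℝ] E d) (b : E d) (i : ℕ) : E d × E d × ℝ :=
  (lanczosNext A)^[i] (0, b, 0)

variable {A : E d →L[ℝ] E d} {b : E d}

lemma lanczosSeq_zero : lanczosSeq A b 0 = (0, b, 0) := rfl

lemma lanczosSeq_succ (i : ℕ) : lanczosSeq A b (i + 1) = lanczosNext A (lanczosSeq A b i) :=
  Function.iterate_succ_apply' _ _ _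

lemma lanczosSeq_succ_fst (i : ℕ) : (lanczosSeq A b (i + 1)).1 = (lanczosSeq A b i).2.1 := by
  rw [lanczosSeq_succ]; rfl

lemma lanczosSeq_beta_eq_zero {i : ℕ} (h : (lanczosSeq A b i).2.1 = 0) :
    (lanczosSeq A b i).2.2 = 0 := by
  cases i with
  | zero => rfl
  | succ i =>
    rw [lanczosSeq_succ] at h ⊢
    simp only [lanczosNext, smul_eq_zero, inv_eq_zero, norm_eq_zero, or_self] at h ⊢
    exact h

lemma lanczosSeq_eq_zero_succ {i : ℕ} (h : (lanczosSeq A b i).2.1 = 0) :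
    (lanczosSeq A b (i + 1)).2.1 = 0 := by
  rw [lanczosSeq_succ, lanczosNext, h, lanczosSeq_beta_eq_zero h]
  simp

lemma lanczosSeq_eq_zero_of_le {i j : ℕ} (hij : i ≤ j) (h : (lanczosSeq A b i).2.1 = 0) :
    (lanczosSeq A b j).2.1 = 0 := by
  induction j, hij using Nat.le_induction with
  | base => exact h
  | succ j _ ih => exact lanczosSeq_eq_zero_succ ih

lemma lanczosSeq_norm (hb : ‖b‖ = 1) {i : ℕ} (h : (lanczosSeq A b i).2.1 ≠ 0) :
    ‖(lanczosSeq A b i).2.1‖ = 1 := by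
  cases i with
  | zero => exact hb
  | succ i =>
    rw [lanczosSeq_succ] at h ⊢
    simp only [lanczosNext] at h ⊢
    rw [norm_smul, norm_inv, norm_norm]
    refine inv_mul_cancel₀ fun h0 => h ?_
    rw [h0]; simp

/-- The three-term recurrence. -/
lemma lanczosSeq_rec (i : ℕ) :
    A (lanczosSeq A b i).2.1 =
      (lanczosSeq A b (i + 1)).2.2 • (lanczosSeq A b (i + 1)).2.1 +
      ⟪(lanczosSeq A b i).2.1, A (lanczosSeq A b i).2.1⟫ • (lanczosSeq A b i).2.1 +
      (lanczosSeq A b i).2.2 • (lanczosSeq A b i).1 := by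
  rw [lanczosSeq_succ]
  simp only [lanczosNext]
  set w := A (lanczosSeq A b i).2.1 -
    ⟪(lanczosSeq A b i).2.1, A (lanczosSeq A b i).2.1⟫ • (lanczosSeq A b i).2.1 -
    (lanczosSeq A b i).2.2 • (lanczosSeq A b i).1 with hw
  have : ‖w‖ • ‖w‖⁻¹ • w = w := by
    rcases eq_or_ne w 0 with h | h
    · simp [h]
    · rw [smul_smul, mul_inv_cancel₀ (norm_ne_zero_iff.2 h), one_smul]
  rw [this, hw]
  abel

/-- The Lanczos vectors are pairwise orthogonal. -/
lemma lanczosSeq_orthogonal (hA : ∀ u v, ⟪A u, v⟫ = ⟪u, A v⟫) (hb : ‖b‖ = 1) (j : ℕ) :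
    ∀ i < j, ⟪(lanczosSeq A b i).2.1, (lanczosSeq A b j).2.1⟫ = 0 := by
  induction j using Nat.strong_induction_on with
  | _ j ih =>
  intro i hij
  obtain ⟨j, rfl⟩ : ∃ k, j = k + 1 := ⟨j - 1, by omega⟩
  -- it suffices that `q_i` is orthogonal to the unnormalized residual
  rw [lanczosSeq_succ j]
  simp only [lanczosNext]
  rw [inner_smul_right]
  refine mul_eq_zero_of_right _ ?_
  rw [inner_sub_right, inner_sub_right, inner_smul_right, inner_smul_right]
  have hself : ∀ k, (lanczosSeq A b k).2.1 = 0 ∨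
      ⟪(lanczosSeq A b k).2.1, (lanczosSeq A b k).2.1⟫ = 1 := fun k => by
    by_cases h : (lanczosSeq A b k).2.1 = 0
    · exact Or.inl h
    · right; rw [real_inner_self_eq_norm_sq, lanczosSeq_norm hb h]; norm_num
  have hsym : ∀ k l, k ≠ l → k ≤ j → l ≤ j →
      ⟪(lanczosSeq A b k).2.1, (lanczosSeq A b l).2.1⟫ = 0 := by
    intro k l hkl hk hl
    rcases lt_or_gt_of_ne hkl with h | h
    · exact ih l (by omega) k h
    · rw [real_inner_comm]; exact ih k (by omega) l h
  rcases Nat.lt_succ_iff_lt_or_eq.1 hij with hlt | rfl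
  · rw [hsym i j (by omega) (by omega) le_rfl, mul_zero, sub_zero]
    obtain ⟨j, rfl⟩ : ∃ k, j = k + 1 := ⟨j - 1, by omega⟩
    rw [lanczosSeq_succ_fst j, ← hA, lanczosSeq_rec i, inner_add_left, inner_add_left,
      inner_smul_left, inner_smul_left, inner_smul_left,
      hsym i (j + 1) (by omega) (by omega) le_rfl]
    simp only [conj_trivial, mul_zero, add_zero]
    have hp : (lanczosSeq A b i).2.2 *
        ⟪(lanczosSeq A b i).1, (lanczosSeq A b (j + 1)).2.1⟫ = 0 := by
      cases i with
      | zero => simp [lanczosSeq_zero]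
      | succ i =>
        rw [lanczosSeq_succ_fst i, hsym i (j + 1) (by omega) (by omega) le_rfl, mul_zero]
    rw [hp, add_zero]
    rcases Nat.lt_succ_iff_lt_or_eq.1 hlt with hlt' | rfl
    · rw [hsym (i + 1) (j + 1) (by omega) (by omega) le_rfl,
        hsym i j (by omega) (by omega) (by omega)]
      simp
    · rcases hself (i + 1) with h | h
      · rw [lanczosSeq_beta_eq_zero h]; simp
      · have : ⟪(lanczosSeq A b i).2.1, (lanczosSeq A b i).2.1⟫ = 1 := by
          refine (hself i).resolve_left fun h0 => ?_
          rw [lanczosSeq_eq_zero_succ h0] at h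
          simp at h
        rw [h, this]; simp
  · have hp : (lanczosSeq A b i).2.2 *
        ⟪(lanczosSeq A b i).2.1, (lanczosSeq A b i).1⟫ = 0 := by
      cases i with
      | zero => simp [lanczosSeq_zero]
      | succ i =>
        rw [lanczosSeq_succ_fst i, hsym (i + 1) i (by omega) le_rfl (by omega), mul_zero]
    rw [hp]
    rcases hself i with h | h
    · rw [h]; simp
    · rw [h]; simp

lemma pow_apply_mem_span (k : ℕ) :
    (A ^ k) b ∈ Submodule.span ℝ ((fun i => (lanczosSeq A b i).2.1) '' Set.Iic k) := by
  induction k with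
  | zero =>
    refine Submodule.subset_span ⟨0, by simp, ?_⟩
    simp [lanczosSeq_zero]
  | succ k ih =>
    rw [pow_succ', mul_apply_eq_comp]
    have : Submodule.span ℝ ((fun i => (lanczosSeq A b i).2.1) '' Set.Iic k) ≤
        (Submodule.span ℝ ((fun i => (lanczosSeq A b i).2.1) '' Set.Iic (k + 1))).comap
          (A : E d →ₗ[ℝ] E d) := by
      rw [Submodule.span_le]
      rintro _ ⟨i, hi, rfl⟩
      have hi : i ≤ k := hi
      change A (lanczosSeq A b i).2.1 ∈ Submodule.span ℝ _
      rw [lanczosSeq_rec i]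
      have hmem : ∀ l ≤ k + 1, (lanczosSeq A b l).2.1 ∈
          Submodule.span ℝ ((fun i => (lanczosSeq A b i).2.1) '' Set.Iic (k + 1)) :=
        fun l hl => Submodule.subset_span ⟨l, hl, rfl⟩
      refine add_mem (add_mem (Submodule.smul_mem _ _ (hmem _ (by omega)))
        (Submodule.smul_mem _ _ (hmem _ (by omega)))) (Submodule.smul_mem _ _ ?_)
      cases i with
      | zero => simp [lanczosSeq_zero]
      | succ i => rw [lanczosSeq_succ_fst]; exact hmem _ (by omega)
    exact this ih

/-- If an unreduced tridiagonal matrix has an eigenvalue `θ`, then the vector with entries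
`eigCoeff` is an eigenvector: by the first rows, every eigenvector is a multiple of it. -/
lemma tridiag_mulVec_eigCoeff {n : ℕ} (hn : 0 < n) {a β : ℕ → ℝ} {θ : ℝ}
    (hβ : ∀ i, 0 < i → i < n → β i ≠ 0) {s : Fin n → ℝ} (hs0 : s ≠ 0)
    (hs : (tridiag n a β).mulVec s = θ • s) :
    (tridiag n a β).mulVec (fun i : Fin n => eigCoeff a β θ i) =
      θ • (fun i : Fin n => eigCoeff a β θ i) := by
  have row : ∀ (i : ℕ) (hi : i < n) , ∑ j : Fin n, tridiag n a β ⟨i, hi⟩ j * s j =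
      θ * s ⟨i, hi⟩ := fun i hi => congrFun hs ⟨i, hi⟩
  have key : ∀ (i : ℕ) (hi : i < n), s ⟨i, hi⟩ = eigCoeff a β θ i * s ⟨0, hn⟩ := by
    intro i
    induction i using Nat.strong_induction_on with
    | _ i ih =>
    intro hi
    match i with
    | 0 => simp [eigCoeff]
    | 1 =>
      have h := row 0 hn
      have h01 : (⟨0, hn⟩ : Fin n) ≠ ⟨1, hi⟩ := by simp
      rw [Fintype.sum_eq_add ⟨0, hn⟩ ⟨1, hi⟩ h01] at h
      · simp [tridiag] at h
        rw [eigCoeff]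
        have := hβ 1 one_pos hi
        field_simp
        linarith
      · rintro ⟨j, hj⟩ ⟨h1, h2⟩
        simp only [ne_eq, Fin.mk.injEq] at h1 h2
        simp [tridiag, Ne.symm h1, Ne.symm h2]
    | i + 2 =>
      have hi1 : i + 1 < n := by omega
      have hi0 : i < n := by omega
      have h := row (i + 1) hi1
      rw [← Finset.sum_subset (Finset.subset_univ
        ({⟨i, hi0⟩, ⟨i + 1, hi1⟩, ⟨i + 2, hi⟩} : Finset (Fin n)))] at h
      · rw [Finset.sum_insert (by simp), Finset.sum_insert (by simp), Finset.sum_singleton] at h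
        have h1 : ¬ (i + 1 + 1 = i) := by omega
        simp [tridiag, h1] at h
        rw [ih i (by omega) hi0, ih (i + 1) (by omega) hi1] at h
        rw [eigCoeff]
        have := hβ (i + 2) (by omega) hi
        field_simp
        linarith
      · rintro ⟨j, hj⟩ _ h1
        simp only [Finset.mem_insert, Fin.mk.injEq, Finset.mem_singleton, not_or] at h1
        have h2 : ¬ (i + 1 = j) := fun h => h1.2.1 h.symm
        have h3 : ¬ (i + 1 + 1 = j) := fun h => h1.2.2 h.symm
        simp [tridiag, h2, h3, h1.1]
  have h0 : s ⟨0, hn⟩ ≠ 0 := by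
    intro h
    refine hs0 (funext fun i => ?_)
    have := key i i.2
    rw [h, mul_zero] at this
    exact this
  have hs' : (fun i : Fin n => eigCoeff a β θ i) = (s ⟨0, hn⟩)⁻¹ • s := by
    funext i
    have := key i i.2
    simp only [Fin.eta] at this
    rw [Pi.smul_apply, this, smul_eq_mul]
    field_simp
  rw [hs', Matrix.mulVec_smul, hs, smul_comm]

lemma tridiag_isSymm (n : ℕ) (a β : ℕ → ℝ) : (tridiag n a β).IsSymm := by
  ext i j
  simp only [tridiag, Matrix.transpose_apply, Matrix.of_apply]
  by_cases h : i = j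
  · simp [h]
  · have h' : ¬ j = i := fun e => h e.symm
    simp only [h, h', if_false]
    split_ifs with h1 h2
    · omega
    · rfl
    · rfl
    · rfl

/-- The largest Ritz value after `n` steps and the unnormalized Ritz vector, in terms of the
sequence of Lanczos states. -/
noncomputable def ritzSum (A : E d →L[ℝ] E d) (b : E d) (n : ℕ) : E d :=
  let a : ℕ → ℝ := fun i => ⟪(lanczosSeq A b i).2.1, A (lanczosSeq A b i).2.1⟫
  let β : ℕ → ℝ := fun i => (lanczosSeq A b i).2.2
  ∑ i ∈ Finset.range n, eigCoeff a β (lambdaMax (tridiag n a β)) i • (lanczosSeq A b i).2.1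

lemma eigCoeff_congr {a a' β β' : ℕ → ℝ} {θ : ℝ} {n : ℕ} (ha : ∀ i < n, a i = a' i)
    (hβ : ∀ i < n, β i = β' i) : ∀ i < n, eigCoeff a β θ i = eigCoeff a' β' θ i := by
  intro i
  induction i using Nat.strong_induction_on with
  | _ i ih =>
  intro hi
  match i with
  | 0 => rfl
  | 1 => rw [eigCoeff, eigCoeff, ha 0 (by omega), hβ 1 hi]
  | i + 2 =>
    rw [eigCoeff, eigCoeff, ha (i + 1) (by omega), hβ (i + 1) (by omega), hβ (i + 2) hi,
      ih (i + 1) (by omega) (by omega), ih i (by omega) (by omega)]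

lemma ritzVector_lanczosList (m : ℕ) :
    ritzVector (lanczosList A m (0, b, 0)) =
      ‖ritzSum A b (lanczosLen A m (0, b, 0))‖⁻¹ • ritzSum A b (lanczosLen A m (0, b, 0)) := by
  set n := lanczosLen A m (0, b, 0) with hn
  have hlen : (lanczosList A m (0, b, 0)).length = n := by simp [lanczosList, hn]
  have hget : ∀ i < n, (lanczosList A m (0, b, 0)).getD i 0 =
      lanczosTriple A (lanczosSeq A b i) := by
    intro i hi
    rw [List.getD_eq_getElem _ _ (by omega)]
    simp [lanczosList, lanczosSeq]
  have ha : ∀ i < n, ((lanczosList A m (0, b, 0)).getD i 0).2.1 =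
      ⟪(lanczosSeq A b i).2.1, A (lanczosSeq A b i).2.1⟫ := fun i hi => by rw [hget i hi]; rfl
  have hβ : ∀ i < n, ((lanczosList A m (0, b, 0)).getD i 0).2.2 =
      (lanczosSeq A b i).2.2 := fun i hi => by rw [hget i hi]; rfl
  unfold ritzVector
  simp only [hlen]
  have hT : tridiag n (fun i => ((lanczosList A m (0, b, 0)).getD i 0).2.1)
      (fun i => ((lanczosList A m (0, b, 0)).getD i 0).2.2) =
      tridiag n (fun i => ⟪(lanczosSeq A b i).2.1, A (lanczosSeq A b i).2.1⟫)
        (fun i => (lanczosSeq A b i).2.2) := by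
    ext i j
    simp only [tridiag, Matrix.of_apply]
    rw [ha i i.2, hβ i i.2, hβ j j.2]
  have hy : ∀ θ, (∑ i ∈ Finset.range n,
      eigCoeff (fun i => ((lanczosList A m (0, b, 0)).getD i 0).2.1)
        (fun i => ((lanczosList A m (0, b, 0)).getD i 0).2.2) θ i •
        ((lanczosList A m (0, b, 0)).getD i 0).1) =
      ∑ i ∈ Finset.range n, eigCoeff
        (fun i => ⟪(lanczosSeq A b i).2.1, A (lanczosSeq A b i).2.1⟫)
        (fun i => (lanczosSeq A b i).2.2) θ i • (lanczosSeq A b i).2.1 := by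
    intro θ
    refine Finset.sum_congr rfl fun i hi => ?_
    have hi := Finset.mem_range.1 hi
    rw [eigCoeff_congr (fun i hi => ha i hi) (fun i hi => hβ i hi) i hi, hget i hi]
    rfl
  have hθ : ∀ N, N = n → lambdaMax (tridiag N
      (fun i => ((lanczosList A m (0, b, 0)).getD i 0).2.1)
      (fun i => ((lanczosList A m (0, b, 0)).getD i 0).2.2)) =
      lambdaMax (tridiag n (fun i => ⟪(lanczosSeq A b i).2.1, A (lanczosSeq A b i).2.1⟫)
        (fun i => (lanczosSeq A b i).2.2)) := by
    rintro _ rfl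
    rw [hT]
  rw [hθ _ hlen, hy]
  rfl

/-- The Lanczos method maximizes the Rayleigh quotient over the Krylov space: the vector that it
returns has a Rayleigh quotient at least as large as that of `p(A) b`, for all polynomials `p` of
degree less than the number of steps. -/
theorem ritzVector_spec (hA : ∀ u v, ⟪A u, v⟫ = ⟪u, A v⟫) (hb : ‖b‖ = 1) {m : ℕ} (hm : 0 < m)
    {v : E d} (hv : v = ritzVector (lanczosList A m (0, b, 0))) :
    ‖v‖ = 1 ∧ ∀ p : Polynomial ℝ, p.natDegree < m →
      ⟪Polynomial.aeval A p b, A (Polynomial.aeval A p b)⟫ ≤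
        ⟪v, A v⟫ * ‖Polynomial.aeval A p b‖ ^ 2 := by
  rw [ritzVector_lanczosList] at hv
  obtain ⟨hne, hend⟩ := lanczosLen_spec A m (0, b, 0)
  set n := lanczosLen A m (0, b, 0) with hndef
  change ∀ i < n, (lanczosSeq A b i).2.1 ≠ 0 at hne
  change n = m ∨ (lanczosSeq A b n).2.1 = 0 at hend
  have hb0 : b ≠ 0 := fun h => by simp [h] at hb
  have hn : 0 < n := by
    rcases Nat.eq_zero_or_pos n with h | h
    · rw [h] at hend
      rcases hend with h' | h'
      · omega
      · exact absurd h' hb0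
    · exact h
  set a : ℕ → ℝ := fun i => ⟪(lanczosSeq A b i).2.1, A (lanczosSeq A b i).2.1⟫ with ha
  set β : ℕ → ℝ := fun i => (lanczosSeq A b i).2.2 with hβ
  set T := tridiag n a β with hT
  -- the Lanczos vectors are orthonormal and `T` is the compression of `A` to their span
  have horth : ∀ i j, i < n → j < n → ⟪(lanczosSeq A b i).2.1, (lanczosSeq A b j).2.1⟫ =
      if i = j then 1 else 0 := by
    intro i j hi hj
    split_ifs with h
    · subst h
      rw [real_inner_self_eq_norm_sq, lanczosSeq_norm hb (hne i hi), one_pow]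
    · rcases lt_or_gt_of_ne h with h | h
      · exact lanczosSeq_orthogonal hA hb j i h
      · rw [real_inner_comm]; exact lanczosSeq_orthogonal hA hb i j h
  have hcomp : ∀ i j : Fin n, ⟪(lanczosSeq A b i).2.1, A (lanczosSeq A b j).2.1⟫ = T i j := by
    have hle : ∀ i j : Fin n, (i : ℕ) ≤ j →
        ⟪(lanczosSeq A b i).2.1, A (lanczosSeq A b j).2.1⟫ = T i j := by
      intro i j hij
      rcases hij.eq_or_lt with h | h
      · have : i = j := Fin.ext h
        subst this
        simp [hT, tridiag, ha]
      · have hij' : i ≠ j := fun e => by simp [e] at h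
        rw [lanczosSeq_rec, inner_add_right, inner_add_right, inner_smul_right, inner_smul_right,
          inner_smul_right, lanczosSeq_orthogonal hA hb (j + 1) i (by omega),
          horth i j i.2 j.2, if_neg h.ne]
        simp only [mul_zero, zero_add, hT, tridiag, Matrix.of_apply, hij', if_false]
        obtain ⟨k, hk⟩ : ∃ k, (j : ℕ) = k + 1 := ⟨j - 1, by omega⟩
        rw [hk, lanczosSeq_succ_fst, horth i k i.2 (by omega)]
        by_cases h1 : (i : ℕ) = k
        · simp [h1, hβ]
        · have h2 : ¬ (k + 1 + 1 = (i : ℕ)) := by omega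
          simp [h1, h2]
    intro i j
    rcases le_total (i : ℕ) j with h | h
    · exact hle i j h
    · rw [← hA, real_inner_comm, hle j i h]
      exact (tridiag_isSymm n a β).apply i j
  set Y : (Fin n → ℝ) → E d := fun s => ∑ i : Fin n, s i • (lanczosSeq A b i).2.1 with hY
  have hYn : ∀ s, ‖Y s‖ ^ 2 = s ⬝ᵥ s := by
    intro s
    rw [← real_inner_self_eq_norm_sq, hY]
    simp only [sum_inner, inner_sum, inner_smul_left, inner_smul_right, conj_trivial, dotProduct]
    refine Finset.sum_congr rfl fun i _ => ?_
    rw [Finset.sum_eq_single i]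
    · rw [horth i i i.2 i.2]; simp
    · intro j _ hji
      rw [horth j i j.2 i.2, if_neg (fun e => hji (Fin.ext e))]; simp
    · simp
  have hYA : ∀ s, ⟪Y s, A (Y s)⟫ = s ⬝ᵥ T.mulVec s := by
    intro s
    rw [hY]
    simp only [map_sum, map_smul, sum_inner, inner_sum, inner_smul_left, inner_smul_right,
      conj_trivial, dotProduct, Matrix.mulVec, Finset.mul_sum]
    rw [Finset.sum_comm]
    refine Finset.sum_congr rfl fun i _ => Finset.sum_congr rfl fun j _ => ?_
    rw [hcomp]; ring
  obtain ⟨⟨s, hs0, hs⟩, hmax⟩ := lambdaMax_spec hn (tridiag_isSymm n a β)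
  have hβ0 : ∀ i, 0 < i → i < n → β i ≠ 0 := by
    intro i hi hin h0
    obtain ⟨i, rfl⟩ : ∃ k, i = k + 1 := ⟨i - 1, by omega⟩
    refine hne (i + 1) hin ?_
    rw [hβ] at h0
    simp only [lanczosSeq_succ, lanczosNext] at h0 ⊢
    rw [h0]; simp
  have heig := tridiag_mulVec_eigCoeff hn hβ0 hs0 hs
  set θ := lambdaMax T with hθ
  set c : Fin n → ℝ := fun i => eigCoeff a β θ i with hc
  have hsum : ritzSum A b n = Y c := by
    rw [hY, hc]
    simp only [ritzSum]
    rw [Finset.sum_range]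
  rw [hsum] at hv
  have hcpos : 0 < c ⬝ᵥ c := by
    have h1 : c ⟨0, hn⟩ * c ⟨0, hn⟩ ≤ c ⬝ᵥ c :=
      Finset.single_le_sum (f := fun i => c i * c i) (fun i _ => mul_self_nonneg _)
        (Finset.mem_univ _)
    have h2 : c ⟨0, hn⟩ = 1 := by simp [hc, eigCoeff]
    rw [h2] at h1
    linarith
  have hYpos : 0 < ‖Y c‖ := by
    have := hYn c
    rcases (norm_nonneg (Y c)).eq_or_lt with h | h
    · rw [← h] at this; norm_num at this; linarith
    · exact h
  have hvA : ⟪v, A v⟫ = θ := by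
    rw [hv, map_smul, inner_smul_left, inner_smul_right, hYA, heig, dotProduct_smul, ← hYn]
    simp only [conj_trivial, smul_eq_mul]
    field_simp
  refine ⟨?_, fun p hp => ?_⟩
  · rw [hv, norm_smul, norm_inv, norm_norm, inv_mul_cancel₀ hYpos.ne']
  · have hmem : Polynomial.aeval A p b ∈
        Submodule.span ℝ (Set.range fun i : Fin n => (lanczosSeq A b i).2.1) := by
      rw [Polynomial.aeval_eq_sum_range, _root_.sum_apply]
      refine Submodule.sum_mem _ fun k hk => ?_
      rw [_root_.smul_apply]
      refine Submodule.smul_mem _ _ ?_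
      refine (Submodule.span_le.2 ?_) (pow_apply_mem_span k)
      rintro _ ⟨i, hi, rfl⟩
      have hi : i ≤ k := hi
      have hk := Finset.mem_range.1 hk
      by_cases hin : i < n
      · exact Submodule.subset_span ⟨⟨i, hin⟩, rfl⟩
      · have h0 : (lanczosSeq A b i).2.1 = 0 := by
          refine lanczosSeq_eq_zero_of_le (not_lt.1 hin) (hend.resolve_left ?_)
          omega
        simp [h0]
    obtain ⟨t, ht⟩ := (Submodule.mem_span_range_iff_exists_fun ℝ).1 hmem
    have ht' : Polynomial.aeval A p b = Y t := ht.symm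
    rw [ht', hYA, hYn, hvA]
    exact hmax t

end Lanczos


/-! ### The Kuczyński–Woźniakowski bound for a random starting vector -/

section KrylovGap

open Polynomial

/-- The polynomials with `√(μ - x) * P_k(x) = √μ * T_{2k+1}(√(1 - x / μ))`, where `T` are the
Chebyshev polynomials of the first kind. -/
noncomputable def gapPoly (μ : ℝ) : ℕ → ℝ[X]
  | 0 => 1
  | 1 => 1 - C (4 / μ) * X
  | k + 2 => 2 * (1 - C (2 / μ) * X) * gapPoly μ (k + 1) - gapPoly μ k

lemma natDegree_gapPoly_le (μ : ℝ) (k : ℕ) : (gapPoly μ k).natDegree ≤ k := by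
  have hlin : ∀ c : ℝ, (1 - C c * X : ℝ[X]).natDegree ≤ 1 := fun c => by compute_degree
  induction k using Nat.strong_induction_on with
  | _ k ih =>
  match k with
  | 0 => simp [gapPoly]
  | 1 => exact hlin _
  | k + 2 =>
    rw [gapPoly]
    refine (natDegree_sub_le _ _).trans (max_le ?_ ((ih k (by omega)).trans (by omega)))
    have h2 : (2 * (1 - C (2 / μ) * X) : ℝ[X]).natDegree ≤ 1 := by
      refine natDegree_mul_le.trans ?_
      have : (2 : ℝ[X]).natDegree = 0 := natDegree_ofNat 2
      rw [this, zero_add]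
      exact hlin _
    refine natDegree_mul_le.trans ?_
    have := ih (k + 1) (by omega)
    omega

lemma gapPoly_eval_cos {μ : ℝ} (hμ : 0 < μ) (α : ℝ) (k : ℕ) :
    (gapPoly μ k).eval (μ * Real.sin α ^ 2) * Real.cos α = Real.cos ((2 * k + 1) * α) := by
  induction k using Nat.strong_induction_on with
  | _ k ih =>
  match k with
  | 0 => simp [gapPoly]
  | 1 =>
    have h3 : ((2 * (1 : ℕ) + 1) * α : ℝ) = 3 * α := by push_cast; ring
    rw [h3, Real.cos_three_mul]
    simp only [gapPoly, eval_sub, eval_one, eval_mul, eval_C, eval_X]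
    have : 4 / μ * (μ * Real.sin α ^ 2) = 4 * Real.sin α ^ 2 := by field_simp
    rw [this, Real.sin_sq]; ring
  | k + 2 =>
    have h0 := ih k (by omega)
    have h1 := ih (k + 1) (by omega)
    simp only [gapPoly, eval_sub, eval_one, eval_mul, eval_C, eval_X, eval_ofNat]
    have hx : 2 / μ * (μ * Real.sin α ^ 2) = 2 * Real.sin α ^ 2 := by field_simp
    have e2 : ((2 * ((k + 2 : ℕ) : ℝ) + 1) * α : ℝ) =
      (2 * ((k + 1 : ℕ) : ℝ) + 1) * α + 2 * α := by push_cast; ring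
    have e0 : ((2 * (k : ℝ) + 1) * α : ℝ) =
      (2 * ((k + 1 : ℕ) : ℝ) + 1) * α - 2 * α := by push_cast; ring
    rw [e0, Real.cos_sub] at h0
    rw [e2, Real.cos_add, hx]
    have hc : Real.cos (2 * α) = 1 - 2 * Real.sin α ^ 2 := by
      rw [Real.cos_two_mul, Real.sin_sq]; ring
    rw [hc] at h0 ⊢
    linear_combination (2 * (1 - 2 * Real.sin α ^ 2)) * h1 - h0

lemma gapPoly_eval_cosh {μ : ℝ} (hμ : 0 < μ) (η : ℝ) (k : ℕ) :
    (gapPoly μ k).eval (μ * Real.cosh η ^ 2) * Real.sinh η =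
      (-1) ^ k * Real.sinh ((2 * k + 1) * η) := by
  induction k using Nat.strong_induction_on with
  | _ k ih =>
  match k with
  | 0 => simp [gapPoly]
  | 1 =>
    have h3 : ((2 * (1 : ℕ) + 1) * η : ℝ) = 3 * η := by push_cast; ring
    rw [h3, Real.sinh_three_mul]
    simp only [gapPoly, eval_sub, eval_one, eval_mul, eval_C, eval_X]
    have : 4 / μ * (μ * Real.cosh η ^ 2) = 4 * Real.cosh η ^ 2 := by field_simp
    rw [this, Real.cosh_sq]; ring
  | k + 2 =>
    have h0 := ih k (by omega)
    have h1 := ih (k + 1) (by omega)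
    simp only [gapPoly, eval_sub, eval_one, eval_mul, eval_C, eval_X, eval_ofNat]
    have hx : 2 / μ * (μ * Real.cosh η ^ 2) = 2 * Real.cosh η ^ 2 := by field_simp
    have e2 : ((2 * ((k + 2 : ℕ) : ℝ) + 1) * η : ℝ) =
      (2 * ((k + 1 : ℕ) : ℝ) + 1) * η + 2 * η := by push_cast; ring
    have e0 : ((2 * (k : ℝ) + 1) * η : ℝ) =
      (2 * ((k + 1 : ℕ) : ℝ) + 1) * η - 2 * η := by push_cast; ring
    rw [e0, Real.sinh_sub] at h0
    rw [e2, Real.sinh_add, hx]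
    have hc : Real.cosh (2 * η) = 2 * Real.cosh η ^ 2 - 1 := by
      rw [Real.cosh_two_mul, Real.sinh_sq]; ring
    rw [hc] at h0 ⊢
    have p1 : (-1 : ℝ) ^ (k + 1) = -(-1) ^ k := by rw [pow_succ]; ring
    have p2 : (-1 : ℝ) ^ (k + 2) = (-1) ^ k := by rw [pow_succ, pow_succ]; ring
    rw [p1] at h1
    rw [p2]
    linear_combination (2 * (1 - 2 * Real.cosh η ^ 2)) * h1 - h0

lemma gapPoly_sq_le {μ : ℝ} (hμ : 0 < μ) (k : ℕ) {x : ℝ} (hx0 : 0 ≤ x) (hx : x ≤ μ) :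
    (μ - x) * (gapPoly μ k).eval x ^ 2 ≤ μ := by
  set α := Real.arcsin (Real.sqrt (x / μ)) with hα
  have hs : Real.sin α ^ 2 = x / μ := by
    rw [hα, Real.sin_arcsin (by linarith [Real.sqrt_nonneg (x / μ)])
      (Real.sqrt_le_one.2 ((div_le_one hμ).2 hx)), Real.sq_sqrt (by positivity)]
  have hxα : x = μ * Real.sin α ^ 2 := by rw [hs]; field_simp
  have h := gapPoly_eval_cos hμ α k
  rw [← hxα] at h
  have h1 : μ - x = μ * Real.cos α ^ 2 := by rw [Real.cos_sq', hs]; field_simp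
  have h2 : (μ - x) * (gapPoly μ k).eval x ^ 2 =
      μ * ((gapPoly μ k).eval x * Real.cos α) ^ 2 := by rw [h1]; ring
  rw [h2, h]
  have := Real.cos_sq_le_one ((2 * k + 1) * α)
  nlinarith

variable {d : ℕ}

/-- If no element of the Krylov space spanned by the `p(A) b` with `deg p < k + 1` has a Rayleigh
quotient above `λ₁ - ε`, where `λ₁` is the largest eigenvalue of `A`, then `b` is almost
orthogonal to a fixed top eigenvector. -/
lemma exists_inner_mul_cosh_le (hd : 1 ≤ d) {A : E d →L[ℝ] E d}
    (hA : ∀ u v, ⟪A u, v⟫ = ⟪u, A v⟫) (hA0 : ∀ u, 0 ≤ ⟪u, A u⟫) :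
    ∃ (u : E d) (r : ℝ), ‖u‖ = 1 ∧ ⟪u, A u⟫ = r ∧ (∀ x, ⟪x, A x⟫ ≤ r * ‖x‖ ^ 2) ∧
      ∀ (b : E d) (μ η : ℝ) (k : ℕ), ‖b‖ = 1 → 0 < μ → 0 < η → μ * Real.cosh η ^ 2 = r →
        (⟪aeval A (gapPoly μ k) b, A (aeval A (gapPoly μ k) b)⟫ ≤
          μ * ‖aeval A (gapPoly μ k) b‖ ^ 2) →
        |⟪u, b⟫| * Real.cosh ((2 * k + 1) * η) ≤ 1 := by
  have hT := isSymmetric_of_forall hA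
  have hdim : 0 < Module.finrank ℝ (E d) := by simp; omega
  have : Nonempty (Fin (Module.finrank ℝ (E d))) := ⟨⟨0, hdim⟩⟩
  obtain ⟨i₀, hi₀⟩ := Finite.exists_max (hT.eigenvalues rfl)
  set u := hT.eigenvectorBasis rfl with hu
  set ev := hT.eigenvalues rfl with hev
  have happ : ∀ j, A (u j) = ev j • u j := fun j => hT.apply_eigenvectorBasis rfl j
  have hin : ∀ j x, ⟪u j, A x⟫ = ev j * ⟪u j, x⟫ := fun j x => by
    rw [← hA, happ, inner_smul_left]; simp
  have hev0 : ∀ j, 0 ≤ ev j := fun j => by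
    have := hA0 (u j)
    rw [hin, real_inner_self_eq_norm_sq, u.norm_eq_one] at this
    simpa using this
  have hpow : ∀ (n : ℕ) j x, ⟪u j, (A ^ n) x⟫ = ev j ^ n * ⟪u j, x⟫ := by
    intro n j
    induction n with
    | zero => intro x; simp
    | succ n ih =>
      intro x
      rw [pow_succ, mul_apply_eq_comp, ih, hin]
      ring
  have hpoly : ∀ (p : ℝ[X]) j x, ⟪u j, aeval A p x⟫ = p.eval (ev j) * ⟪u j, x⟫ := by
    intro p j x
    rw [aeval_eq_sum_range, _root_.sum_apply, inner_sum, eval_eq_sum_range, Finset.sum_mul]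
    refine Finset.sum_congr rfl fun n _ => ?_
    rw [_root_.smul_apply, inner_smul_right, hpow, mul_assoc]
  have hquad : ∀ x, ⟪x, A x⟫ = ∑ j, ev j * ⟪u j, x⟫ ^ 2 := by
    intro x
    rw [← u.sum_inner_mul_inner x (A x)]
    refine Finset.sum_congr rfl fun j _ => ?_
    rw [hin, real_inner_comm]; ring
  have hnorm : ∀ x, ‖x‖ ^ 2 = ∑ j, ⟪u j, x⟫ ^ 2 := by
    intro x
    rw [← real_inner_self_eq_norm_sq, ← u.sum_inner_mul_inner x x]
    refine Finset.sum_congr rfl fun j _ => ?_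
    rw [real_inner_comm]; ring
  refine ⟨u i₀, ev i₀, u.norm_eq_one i₀, ?_, ?_, ?_⟩
  · rw [hin, real_inner_self_eq_norm_sq, u.norm_eq_one]; ring
  · intro x
    rw [hquad, hnorm, Finset.mul_sum]
    exact Finset.sum_le_sum fun j _ => mul_le_mul_of_nonneg_right (hi₀ j) (sq_nonneg _)
  · intro b μ η k hb hμ hη hr hle
    rw [hquad, hnorm, Finset.mul_sum, ← sub_nonneg, ← Finset.sum_sub_distrib] at hle
    simp only [hpoly] at hle
    set P := fun j => (gapPoly μ k).eval (ev j) with hP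
    have hterm : ∀ j, (μ - ev j) * P j ^ 2 * ⟪u j, b⟫ ^ 2 ≤ μ * ⟪u j, b⟫ ^ 2 := by
      intro j
      refine mul_le_mul_of_nonneg_right ?_ (sq_nonneg _)
      rcases le_total (ev j) μ with h | h
      · exact gapPoly_sq_le hμ k (hev0 j) h
      · nlinarith [sq_nonneg (P j)]
    have hi0 : (μ - ev i₀) * P i₀ ^ 2 = -(μ * Real.sinh ((2 * k + 1) * η) ^ 2) := by
      have h1 := gapPoly_eval_cosh hμ η k
      rw [hr] at h1
      have h2 : μ - ev i₀ = - (μ * Real.sinh η ^ 2) := by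
        rw [← hr, Real.cosh_sq]; ring
      have h3 : (μ - ev i₀) * P i₀ ^ 2 = -(μ * (P i₀ * Real.sinh η) ^ 2) := by rw [h2]; ring
      rw [h3, hP]
      simp only
      rw [h1, mul_pow, ← pow_mul, mul_comm k 2, pow_mul]
      norm_num
    have hsplit := Finset.sum_le_sum (s := Finset.univ.erase i₀) fun j _ => hterm j
    have hb1 : ∑ j, ⟪u j, b⟫ ^ 2 = 1 := by rw [← hnorm, hb, one_pow]
    rw [← Finset.add_sum_erase _ _ (Finset.mem_univ i₀)] at hb1 hle
    rw [← Finset.mul_sum] at hsplit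
    have hle' : 0 ≤ (μ - ev i₀) * P i₀ ^ 2 * ⟪u i₀, b⟫ ^ 2 +
        ∑ j ∈ Finset.univ.erase i₀, (μ - ev j) * P j ^ 2 * ⟪u j, b⟫ ^ 2 := by
      refine hle.trans (le_of_eq ?_)
      congr 1
      · simp only [hP]; ring
      · refine Finset.sum_congr rfl fun j _ => ?_
        simp only [hP]; ring
    rw [hi0] at hle'
    set S := ∑ j ∈ Finset.univ.erase i₀, ⟪u j, b⟫ ^ 2
    have h1 : μ * (⟪u i₀, b⟫ ^ 2 * Real.cosh ((2 * k + 1) * η) ^ 2) ≤ μ * 1 := by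
      rw [Real.cosh_sq]
      nlinarith
    have h2 := le_of_mul_le_mul_left h1 hμ
    rw [← mul_pow] at h2
    have h3 := (sq_le_one_iff_abs_le_one _).1 h2
    rwa [abs_mul, abs_of_pos (Real.cosh_pos _)] at h3

lemma sinh_le_mul_cosh {η : ℝ} (hη : 0 ≤ η) : Real.sinh η ≤ η * Real.cosh η := by
  have hmono : MonotoneOn (fun x : ℝ => x * Real.cosh x - Real.sinh x) (Set.Ici 0) := by
    refine monotoneOn_of_deriv_nonneg (convex_Ici 0) (by fun_prop) (by fun_prop) fun x hx => ?_
    rw [interior_Ici] at hx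
    have hx : 0 < x := hx
    have h : HasDerivAt (fun x : ℝ => x * Real.cosh x - Real.sinh x)
        (1 * Real.cosh x + x * Real.sinh x - Real.cosh x) x :=
      ((hasDerivAt_id x).mul (Real.hasDerivAt_cosh x)).sub (Real.hasDerivAt_sinh x)
    rw [h.deriv]
    have := Real.sinh_pos_iff.2 hx
    nlinarith
  have := hmono (Set.mem_Ici.2 le_rfl) (Set.mem_Ici.2 hη) hη
  simp at this
  linarith

/-- Either the Lanczos vector is an `ε`-approximate top eigenvector, or the starting vector `b`
is almost orthogonal to a fixed top eigenvector. -/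
theorem exists_lanczos_good_or_inner_le (hd : 1 ≤ d) {A : E d →L[ℝ] E d}
    (hA : ∀ u v, ⟪A u, v⟫ = ⟪u, A v⟫) (hA0 : ∀ u, 0 ≤ ⟪u, A u⟫) {Λ : ℝ}
    (hAΛ : ∀ u, ⟪u, A u⟫ ≤ Λ * ‖u‖ ^ 2) {ε : ℝ} (hε : 0 < ε) {m : ℕ} (hm : 0 < m) :
    ∃ u : E d, ‖u‖ = 1 ∧ ∀ b v : E d, ‖b‖ = 1 → v = ritzVector (lanczosList A m (0, b, 0)) →
      (∀ x, ⟪x, A x⟫ ≤ (⟪v, A v⟫ + ε) * ‖x‖ ^ 2) ∨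
        |⟪u, b⟫| ≤ 2 * Real.exp (-((2 * m - 1) * Real.sqrt (ε / Λ))) := by
  obtain ⟨u, r, hu, hur, hmax, h⟩ := exists_inner_mul_cosh_le hd hA hA0
  refine ⟨u, hu, fun b v hb hv => or_iff_not_imp_left.2 fun hbad => ?_⟩
  obtain ⟨hv1, hbest⟩ := ritzVector_spec hA hb hm hv
  have hvr : ⟪v, A v⟫ + ε < r := by
    by_contra hcon
    exact hbad fun x => (hmax x).trans
      (mul_le_mul_of_nonneg_right (not_lt.1 hcon) (sq_nonneg _))
  have hv0 := hA0 v
  set μ := r - ε with hμdef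
  have hμ : 0 < μ := by linarith
  have hr : 0 < r := by linarith
  have hrΛ : r ≤ Λ := by have := hAΛ u; rw [hur, hu] at this; simpa using this
  -- `η` is chosen such that `μ cosh² η = r`
  set η := Real.arsinh (Real.sqrt (ε / μ)) with hη
  have hη0 : 0 < η := Real.arsinh_pos_iff.2 (Real.sqrt_pos.2 (by positivity))
  have hsinh : Real.sinh η ^ 2 = ε / μ := by
    rw [hη, Real.sinh_arsinh, Real.sq_sqrt (by positivity)]
  have hcosh : μ * Real.cosh η ^ 2 = r := by
    rw [Real.cosh_sq, hsinh, hμdef]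
    have : r - ε ≠ 0 := hμ.ne'
    field_simp
    ring
  obtain ⟨k, rfl⟩ : ∃ k, m = k + 1 := ⟨m - 1, by omega⟩
  have hk := h b μ η k hb hμ hη0 hcosh
    ((hbest _ (Nat.lt_succ_of_le (natDegree_gapPoly_le μ k))).trans
      (mul_le_mul_of_nonneg_right (by linarith) (sq_nonneg _)))
  -- `η ≥ tanh η = √(ε / r)`
  have hη1 : Real.sqrt (ε / Λ) ≤ η := by
    refine Real.sqrt_le_iff.2 ⟨hη0.le, ?_⟩
    have h1 := sinh_le_mul_cosh hη0.le
    have h2 : Real.sinh η ^ 2 ≤ η ^ 2 * Real.cosh η ^ 2 := by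
      rw [← mul_pow]
      exact pow_le_pow_left₀ (Real.sinh_nonneg_iff.2 hη0.le) h1 2
    have h3 : μ * Real.sinh η ^ 2 = ε := by rw [hsinh]; field_simp
    have h4 : ε ≤ η ^ 2 * r := by
      rw [← h3, ← hcosh]
      nlinarith
    rw [div_le_iff₀ (hr.trans_le hrΛ)]
    exact h4.trans (mul_le_mul_of_nonneg_left hrΛ (sq_nonneg _))
  have h5 : Real.exp ((2 * k + 1) * Real.sqrt (ε / Λ)) / 2 ≤ Real.cosh ((2 * k + 1) * η) := by
    rw [Real.cosh_eq]
    have := Real.exp_le_exp.2 (mul_le_mul_of_nonneg_left hη1 (by positivity : (0 : ℝ) ≤ 2 * k + 1))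
    have := Real.exp_pos (-((2 * k + 1) * η))
    linarith
  have h6 : |⟪u, b⟫| * (Real.exp ((2 * k + 1) * Real.sqrt (ε / Λ)) / 2) ≤ 1 :=
    (mul_le_mul_of_nonneg_left h5 (abs_nonneg _)).trans hk
  have h7 : (2 * ((k + 1 : ℕ) : ℝ) - 1) = 2 * k + 1 := by push_cast; ring
  rw [h7, Real.exp_neg]
  have h8 := Real.exp_pos ((2 * k + 1) * Real.sqrt (ε / Λ))
  rw [← div_eq_mul_inv, le_div_iff₀ h8]
  linarith

end KrylovGap

section Sphere

open scoped Pointwise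

variable {d : ℕ}

lemma sum_Icc_one_sub_mul_abs (c : ℝ) (J : ℕ) :
    ∑ j ∈ Finset.Icc (-(J : ℤ)) J, (1 - c * |(j : ℝ)|) = 2 * J + 1 - c * (J * (J + 1)) := by
  induction J with
  | zero => simp
  | succ J ih =>
    have : Finset.Icc (-((J + 1 : ℕ) : ℤ)) ((J + 1 : ℕ) : ℤ) =
        insert (-((J : ℤ) + 1)) (insert ((J : ℤ) + 1) (Finset.Icc (-(J : ℤ)) J)) := by
      ext j
      simp only [Finset.mem_Icc, Finset.mem_insert]
      push_cast
      omega
    rw [this, Finset.sum_insert, Finset.sum_insert, ih]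
    · push_cast
      have h1 : |((J : ℝ) + 1)| = J + 1 := abs_of_nonneg (by positivity)
      rw [abs_neg, h1]
      ring
    · simp
    · simp only [Finset.mem_insert, Finset.mem_Icc, not_or]
      omega

/-- The slab of half-width `t` in the unit ball has relative volume at most `2dt`: the shrunken
translates `(1 - |s|) S + s u` of the slab, for `s = 2tj` with integers `|j| ≤ 1 / (2td)`, are
disjoint and contained in the ball. -/
lemma volume_slab_le (hd : 1 ≤ d) {u : E d} (hu : ‖u‖ = 1) {t : ℝ} (ht : 0 < t) :
    (volume {x : E d | ‖x‖ < 1 ∧ |⟪u, x⟫| ≤ t}).toReal ≤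
      2 * d * t * (volume (Metric.ball (0 : E d) 1)).toReal := by
  set S := {x : E d | ‖x‖ < 1 ∧ |⟪u, x⟫| ≤ t} with hS
  set J := ⌊1 / (2 * t * d)⌋₊ with hJ
  have hd0 : (1 : ℝ) ≤ d := by exact_mod_cast hd
  have htd : 0 < 2 * t * d := by positivity
  have : Nonempty (Fin d) := ⟨⟨0, hd⟩⟩
  have hJle : (J : ℝ) ≤ 1 / (2 * t * d) := Nat.floor_le (by positivity)
  have hJlt : 1 / (2 * t * d) < J + 1 := Nat.lt_floor_add_one _
  have hSm : MeasurableSet S := by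
    have h1 : IsOpen {x : E d | ‖x‖ < 1} := isOpen_lt continuous_norm continuous_const
    have h2 : IsClosed {x : E d | |⟪u, x⟫| ≤ t} := isClosed_le (by fun_prop) continuous_const
    exact h1.measurableSet.inter h2.measurableSet
  set s : ℤ → ℝ := fun j => 2 * t * j with hs
  set Φ : ℤ → E d → E d := fun j x => AffineMap.homothety (0 : E d) (1 - |s j|) x + s j • u with hΦ
  have hsabs : ∀ j, |s j| = 2 * t * |(j : ℝ)| := fun j => by
    rw [hs]; simp only; rw [abs_mul, abs_of_pos (by positivity : 0 < 2 * t)]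
  have hs1 : ∀ j ∈ Finset.Icc (-(J : ℤ)) J, |s j| ≤ 1 / d := by
    intro j hj
    rw [Finset.mem_Icc] at hj
    have : |(j : ℝ)| ≤ J := abs_le.2 ⟨by exact_mod_cast hj.1, by exact_mod_cast hj.2⟩
    rw [hsabs]
    calc 2 * t * |(j : ℝ)| ≤ 2 * t * (1 / (2 * t * d)) := by gcongr; exact this.trans hJle
      _ = 1 / d := by field_simp
  have hs2 : ∀ j ∈ Finset.Icc (-(J : ℤ)) J, |s j| ≤ 1 := fun j hj =>
    (hs1 j hj).trans ((div_le_one (by positivity)).2 hd0)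
  have hvol : ∀ j ∈ Finset.Icc (-(J : ℤ)) J, volume (Φ j '' S) =
      ENNReal.ofReal ((1 - |s j|) ^ d) * volume S := by
    intro j hj
    have : Φ j '' S =
        (fun x => x + s j • u) '' (AffineMap.homothety (0 : E d) (1 - |s j|) '' S) := by
      rw [Set.image_image]
    rw [this, Set.image_add_right, measure_preimage_add_right, Measure.addHaar_image_homothety,
      abs_of_nonneg (pow_nonneg (by have := hs2 j hj; linarith) _)]
    simp
  have hΦapp : ∀ j x, Φ j x = (1 - |s j|) • x + s j • u := fun j x => by
    simp [hΦ, AffineMap.homothety_apply]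
  have hsub : ∀ j ∈ Finset.Icc (-(J : ℤ)) J, Φ j '' S ⊆ Metric.closedBall 0 1 := by
    rintro j hj _ ⟨x, hx, rfl⟩
    rw [mem_closedBall_zero_iff, hΦapp]
    have h1 := hs2 j hj
    calc ‖(1 - |s j|) • x + s j • u‖ ≤ ‖(1 - |s j|) • x‖ + ‖s j • u‖ := norm_add_le _ _
      _ = (1 - |s j|) * ‖x‖ + |s j| := by
        rw [norm_smul, norm_smul, hu, Real.norm_eq_abs, Real.norm_eq_abs, mul_one,
          abs_of_nonneg (by linarith : 0 ≤ 1 - |s j|)]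
      _ ≤ 1 := by nlinarith [hx.1]
  have hrange : ∀ j x, x ∈ S → |s j| ≤ 1 → |⟪u, Φ j x⟫ - s j| ≤ (1 - |s j|) * t := by
    intro j x hx hj
    rw [hΦapp, inner_add_right, inner_smul_right, inner_smul_right, real_inner_self_eq_norm_sq, hu]
    have : (1 - |s j|) * ⟪u, x⟫ + s j * 1 ^ 2 - s j = (1 - |s j|) * ⟪u, x⟫ := by ring
    rw [this, abs_mul, abs_of_nonneg (by linarith)]
    exact mul_le_mul_of_nonneg_left hx.2 (by linarith)
  have hlt : ∀ i ∈ Finset.Icc (-(J : ℤ)) J, ∀ j ∈ Finset.Icc (-(J : ℤ)) J, i < j →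
      Disjoint (Φ i '' S) (Φ j '' S) := by
    intro i hi j hj hij
    rw [Set.disjoint_left]
    rintro _ ⟨x, hx, rfl⟩ ⟨y, hy, hxy⟩
    have h1 := abs_le.1 (hrange i x hx (hs2 i hi))
    have h2 := abs_le.1 (hrange j y hy (hs2 j hj))
    rw [hxy] at h2
    have h3 : s j - s i ≥ 2 * t := by
      have : (i : ℝ) + 1 ≤ j := by exact_mod_cast hij
      simp only [hs]; nlinarith
    have h4 : 0 < |s i| + |s j| := by
      rcases (abs_nonneg (s i)).eq_or_lt with h | h
      · have : s i = 0 := abs_eq_zero.1 h.symm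
        have h5 : 0 < s j := by linarith
        have := abs_pos.2 h5.ne'
        linarith [abs_nonneg (s i)]
      · linarith [abs_nonneg (s j)]
    nlinarith
  have hdisj : Set.PairwiseDisjoint (↑(Finset.Icc (-(J : ℤ)) J)) fun j => Φ j '' S := by
    intro i hi j hj hij
    rcases lt_or_gt_of_ne hij with h | h
    · exact hlt i hi j hj h
    · exact (hlt j hj i hi h).symm
  have hΦm : ∀ j ∈ Finset.Icc (-(J : ℤ)) J, NullMeasurableSet (Φ j '' S) volume := by
    intro j hj
    rcases (hs2 j hj).eq_or_lt with h | h
    · -- a homothety of ratio zero collapses the slab to a null set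
      refine NullMeasurableSet.of_null ?_
      rw [hvol j hj, h, sub_self, zero_pow (by omega)]
      simp
    · have hc : 1 - |s j| ≠ 0 := by linarith
      have : Φ j '' S = (fun y => (1 - |s j|)⁻¹ • (y - s j • u)) ⁻¹' S := by
        ext y
        constructor
        · rintro ⟨x, hx, rfl⟩
          rw [Set.mem_preimage, hΦapp, add_sub_cancel_right, smul_smul, inv_mul_cancel₀ hc,
            one_smul]
          exact hx
        · intro hy
          refine ⟨_, hy, ?_⟩
          rw [hΦapp, smul_smul, mul_inv_cancel₀ hc, one_smul, sub_add_cancel]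
      rw [this]
      exact (hSm.preimage (by fun_prop)).nullMeasurableSet
  have hSfin : volume S ≠ ⊤ := by
    refine ne_top_of_le_ne_top (measure_ball_lt_top (μ := volume) (x := (0 : E d)) (r := 1)).ne
      (measure_mono fun x hx => ?_)
    rw [mem_ball_zero_iff]; exact hx.1
  have hsum : ∑ j ∈ Finset.Icc (-(J : ℤ)) J, volume (Φ j '' S) ≤
      volume (Metric.ball (0 : E d) 1) := by
    rw [← measure_biUnion_finset₀ (fun i hi j hj hij => (hdisj hi hj hij).aedisjoint) hΦm,
      ← Measure.addHaar_closedBall_eq_addHaar_ball]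
    exact measure_mono (Set.iUnion₂_subset hsub)
  have hsum' := ENNReal.toReal_mono (measure_ball_lt_top (μ := volume)).ne hsum
  rw [Finset.sum_congr rfl hvol, ENNReal.toReal_sum (fun j _ => ENNReal.mul_ne_top
    ENNReal.ofReal_ne_top hSfin)] at hsum'
  set VS := (volume S).toReal with hVS
  set VB := (volume (Metric.ball (0 : E d) 1)).toReal
  have hVS0 : 0 ≤ VS := ENNReal.toReal_nonneg
  have hterm : ∀ j ∈ Finset.Icc (-(J : ℤ)) J, (1 - 2 * t * d * |(j : ℝ)|) * VS ≤
      (ENNReal.ofReal ((1 - |s j|) ^ d) * volume S).toReal := by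
    intro j hj
    have h1 := hs2 j hj
    rw [ENNReal.toReal_mul, ENNReal.toReal_ofReal (pow_nonneg (by linarith) _)]
    refine mul_le_mul_of_nonneg_right ?_ hVS0
    have h2 := one_add_mul_le_pow (a := -|s j|) (by linarith) d
    rw [hsabs] at h2
    rw [hsabs]
    calc 1 - 2 * t * d * |(j : ℝ)| = 1 + d * -(2 * t * |(j : ℝ)|) := by ring
      _ ≤ _ := h2
      _ = _ := by ring
  have h3 := (Finset.sum_le_sum hterm).trans hsum'
  rw [← Finset.sum_mul, sum_Icc_one_sub_mul_abs] at h3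
  -- the concave function `2J + 1 - J (J + 1) / a` is at least `a` for `a - 1 ≤ J ≤ a`
  set a := 1 / (2 * t * d) with ha
  have ha0 : 0 < a := by positivity
  have hta : 2 * t * d * a = 1 := by rw [ha]; field_simp
  have h4 : a ≤ 2 * J + 1 - 2 * t * d * (J * (J + 1)) := by
    have h5 : 0 ≤ (a - J) * (J + 1 - a) := mul_nonneg (by linarith) (by linarith)
    have h6 : 0 ≤ 2 * t * d * ((a - J) * (J + 1 - a)) := mul_nonneg htd.le h5
    have h7 : 2 * t * d * ((a - J) * (J + 1 - a)) =
        (2 * t * d * a) * (2 * J + 1) - (2 * t * d * a) * a - 2 * t * d * (J * (J + 1)) := by ring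
    rw [hta] at h7
    linarith
  have h8 : a * VS ≤ VB := (mul_le_mul_of_nonneg_right h4 hVS0).trans h3
  calc VS = 2 * t * d * (a * VS) := by rw [← mul_assoc, hta, one_mul]
    _ ≤ 2 * t * d * VB := by gcongr
    _ = 2 * d * t * VB := by ring

lemma uniformSphere_apply {s : Set (E d)} (hs : MeasurableSet s) :
    uniformSphere d s = ((volume : Measure (E d)).toSphere Set.univ)⁻¹ *
      (volume : Measure (E d)).toSphere (Subtype.val ⁻¹' s) := by
  rw [uniformSphere, Measure.map_apply measurable_subtype_coe hs]
  simp

/-- A uniformly distributed unit vector is rarely almost orthogonal to a given direction. -/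
theorem uniformSphere_abs_inner_le (hd : 1 ≤ d) {u : E d} (hu : ‖u‖ = 1) {t : ℝ} (ht : 0 < t) :
    uniformSphere d {b | |⟪u, b⟫| ≤ t} ≤ ENNReal.ofReal (2 * d * t) := by
  have hclosed : IsClosed {b : E d | |⟪u, b⟫| ≤ t} := isClosed_le (by fun_prop) continuous_const
  rw [uniformSphere_apply hclosed.measurableSet, Measure.toSphere_apply_univ,
    Measure.toSphere_apply' _ (measurable_subtype_coe hclosed.measurableSet)]
  have hfr : Module.finrank ℝ (E d) = d := by simp
  rw [hfr]
  have hB0 : 0 < (volume (Metric.ball (0 : E d) 1)).toReal :=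
    ENNReal.toReal_pos (Metric.measure_ball_pos _ _ one_pos).ne' measure_ball_lt_top.ne
  have hSle : volume {x : E d | ‖x‖ < 1 ∧ |⟪u, x⟫| ≤ t} ≤
      ENNReal.ofReal (2 * d * t) * volume (Metric.ball (0 : E d) 1) := by
    have h := volume_slab_le hd hu ht
    have hfin : volume {x : E d | ‖x‖ < 1 ∧ |⟪u, x⟫| ≤ t} ≠ ⊤ :=
      ne_top_of_le_ne_top (measure_ball_lt_top (μ := volume) (x := (0 : E d)) (r := 1)).ne
        (measure_mono fun x hx => by rw [mem_ball_zero_iff]; exact hx.1)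
    rw [← ENNReal.ofReal_toReal hfin,
      ← ENNReal.ofReal_toReal (measure_ball_lt_top (μ := volume) (x := (0 : E d)) (r := 1)).ne,
      ← ENNReal.ofReal_mul (by positivity)]
    exact ENNReal.ofReal_le_ofReal h
  have hsub : Set.Ioo (0 : ℝ) 1 • (Subtype.val '' (Subtype.val ⁻¹' {b : E d | |⟪u, b⟫| ≤ t} :
      Set (Metric.sphere (0 : E d) 1))) ⊆ {x : E d | ‖x‖ < 1 ∧ |⟪u, x⟫| ≤ t} := by
    rintro _ ⟨r, hr, _, ⟨b, hb, rfl⟩, rfl⟩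
    have hb1 : ‖(b : E d)‖ = 1 := by simp
    have hb2 : |⟪u, (b : E d)⟫| ≤ t := hb
    constructor
    · simp only
      rw [norm_smul, hb1, mul_one, Real.norm_of_nonneg hr.1.le]
      exact hr.2
    · simp only
      rw [inner_smul_right, abs_mul, abs_of_pos hr.1]
      nlinarith [hr.1, hr.2, abs_nonneg ⟪u, (b : E d)⟫]
  set VB := volume (Metric.ball (0 : E d) 1) with hVB
  have hVB0 : VB ≠ 0 := (Metric.measure_ball_pos _ _ one_pos).ne'
  have hVBt : VB ≠ ⊤ := measure_ball_lt_top.ne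
  have hdne : (d : ENNReal) ≠ 0 := by simp; omega
  calc ((d : ENNReal) * VB)⁻¹ * (d * volume (Set.Ioo (0 : ℝ) 1 • (Subtype.val ''
        (Subtype.val ⁻¹' {b : E d | |⟪u, b⟫| ≤ t} : Set (Metric.sphere (0 : E d) 1)))))
      ≤ ((d : ENNReal) * VB)⁻¹ * (d * (ENNReal.ofReal (2 * d * t) * VB)) := by
        gcongr
        exact (measure_mono hsub).trans hSle
    _ = (((d : ENNReal) * VB)⁻¹ * (d * VB)) * ENNReal.ofReal (2 * d * t) := by ring
    _ = ENNReal.ofReal (2 * d * t) := by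
        rw [ENNReal.inv_mul_cancel (mul_ne_zero hdne hVB0)
          (ENNReal.mul_ne_top (ENNReal.natCast_ne_top d) hVBt), one_mul]

lemma uniformSphere_norm_ne_one : uniformSphere d {b | ‖b‖ ≠ 1} = 0 := by
  have h : MeasurableSet {b : E d | ‖b‖ ≠ 1} :=
    ((isClosed_eq continuous_norm continuous_const).measurableSet).compl
  rw [uniformSphere_apply h]
  have : (Subtype.val ⁻¹' {b : E d | ‖b‖ ≠ 1} : Set (Metric.sphere (0 : E d) 1)) = ∅ := by
    ext b
    simp
  rw [this]; simp

end Sphere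


/-! ### Accelerated gradient descent on a strongly convex function -/

section Accelerated

variable {F : Type*} [NormedAddCommGroup F] [InnerProductSpace ℝ F]

/-- The potential of a pair of iterates of accelerated gradient descent, relative to a point `p`;
`s` is the square root of the condition number. -/
noncomputable def agdPotential (g : F → ℝ) (σ s : ℝ) (p : F) (y z : F) : ℝ :=
  g y - g p + σ / 2 * ‖(1 + s) • z - s • y - p‖ ^ 2

variable [CompleteSpace F]

/-- One step of accelerated gradient descent shrinks the potential by the factor `1 - 1/√κ`. -/
lemma agdPotential_step_le {g : F → ℝ} {G : F → F} {L σ s : ℝ} (hσ0 : 0 < σ) (hs : 1 ≤ s)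
    (hLs : L = σ * s ^ 2) (hg : ∀ x, HasGradientAt g (G x) x)
    (hL : ∀ x y, ‖G x - G y‖ ≤ L * ‖x - y‖)
    (hσ : ∀ x y, σ * ‖x - y‖ ^ 2 ≤ ⟪G x - G y, x - y⟫) (p y z : F) :
    agdPotential g σ s p (z - (1 / L) • G z)
      ((1 + (s - 1) / (s + 1)) • (z - (1 / L) • G z) - ((s - 1) / (s + 1)) • y) ≤
      (1 - 1 / s) * agdPotential g σ s p y z := by
  have hL0 : 0 < L := by rw [hLs]; positivity
  have hs0 : 0 < s := by linarith
  set γ := G z with hγ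
  set e := z - p with he
  set h := z - y with hh
  have hvec : (1 + s) • ((1 + (s - 1) / (s + 1)) • (z - (1 / L) • γ) - ((s - 1) / (s + 1)) • y) -
      s • (z - (1 / L) • γ) - p = (e + (s - 1) • h) - (s / L) • γ := by
    have h1 : (1 + s) * (1 + (s - 1) / (s + 1)) = 2 * s := by
      have : s + 1 ≠ 0 := by positivity
      field_simp; ring
    have h2 : (1 + s) * ((s - 1) / (s + 1)) = s - 1 := by
      have : s + 1 ≠ 0 := by positivity
      field_simp; ring
    rw [smul_sub, smul_smul, smul_smul, h1, h2, he, hh]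
    module
  have hvec2 : (1 + s) • z - s • y - p = e + s • h := by rw [he, hh]; module
  have d1 := gradient_step_le hL0 hg hL z
  have d2 := ge_of_gradient_strongly_monotone hg hσ z (-e)
  have d3 := ge_of_gradient_strongly_monotone hg hσ z (-h)
  rw [show z + -e = p by rw [he]; abel, inner_neg_right, norm_neg] at d2
  rw [show z + -h = y by rw [hh]; abel, inner_neg_right, norm_neg] at d3
  rw [agdPotential, agdPotential, hvec, hvec2, norm_sub_sq_real, inner_smul_right, norm_smul,
    mul_pow, Real.norm_of_nonneg (by positivity), norm_add_sq_real e, norm_add_sq_real e,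
    inner_smul_right, inner_smul_right, norm_smul, norm_smul, mul_pow, mul_pow, inner_add_left,
    inner_smul_left, real_inner_comm γ e, real_inner_comm γ h, Real.norm_of_nonneg hs0.le,
    Real.norm_of_nonneg (by linarith : 0 ≤ s - 1)]
  rw [← hγ] at d1 d2 d3
  simp only [conj_trivial]
  set A := ⟪γ, e⟫
  set B := ⟪γ, h⟫
  set D := ⟪e, h⟫
  have hq1 : σ / 2 * ((s / L) ^ 2 * ‖γ‖ ^ 2) = ‖γ‖ ^ 2 / (2 * L) := by
    rw [hLs]; field_simp
  have hq2 : σ / 2 * (2 * (s / L * (A + (s - 1) * B))) = 1 / s * A + (1 - 1 / s) * B := by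
    rw [hLs]; field_simp
  have hq3 : σ / 2 * (‖e‖ ^ 2 + 2 * ((s - 1) * D) + (s - 1) ^ 2 * ‖h‖ ^ 2) ≤
      1 / s * (σ / 2 * ‖e‖ ^ 2) +
        (1 - 1 / s) * (σ / 2 * (‖e‖ ^ 2 + 2 * (s * D) + s ^ 2 * ‖h‖ ^ 2)) := by
    have : 1 / s * (σ / 2 * ‖e‖ ^ 2) +
        (1 - 1 / s) * (σ / 2 * (‖e‖ ^ 2 + 2 * (s * D) + s ^ 2 * ‖h‖ ^ 2)) -
        σ / 2 * (‖e‖ ^ 2 + 2 * ((s - 1) * D) + (s - 1) ^ 2 * ‖h‖ ^ 2) =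
        σ / 2 * ((s - 1) * ‖h‖ ^ 2) := by field_simp; ring
    have h0 : 0 ≤ σ / 2 * ((s - 1) * ‖h‖ ^ 2) :=
      mul_nonneg (by positivity) (mul_nonneg (by linarith) (sq_nonneg _))
    linarith
  have hs1 : 0 ≤ 1 - 1 / s := by
    rw [sub_nonneg, div_le_one hs0]; exact hs
  have e2 := mul_le_mul_of_nonneg_left d2 (by positivity : 0 ≤ 1 / s)
  have e3 := mul_le_mul_of_nonneg_left (show g z + -B ≤ g y by
    nlinarith [mul_nonneg hσ0.le (sq_nonneg ‖h‖)]) hs1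
  have e4 : σ / 2 * (‖e‖ ^ 2 + 2 * ((s - 1) * D) + (s - 1) ^ 2 * ‖h‖ ^ 2 -
      2 * (s / L * (A + (s - 1) * B)) + (s / L) ^ 2 * ‖γ‖ ^ 2) =
      σ / 2 * (‖e‖ ^ 2 + 2 * ((s - 1) * D) + (s - 1) ^ 2 * ‖h‖ ^ 2) -
      σ / 2 * (2 * (s / L * (A + (s - 1) * B))) + σ / 2 * ((s / L) ^ 2 * ‖γ‖ ^ 2) := by ring
  rw [e4, hq1, hq2]
  nlinarith

lemma exists_minimizer [ProperSpace F] {g : F → ℝ} {G : F → F} {σ : ℝ} (hσ0 : 0 < σ)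
    (hg : ∀ x, HasGradientAt g (G x) x)
    (hσ : ∀ x y, σ * ‖x - y‖ ^ 2 ≤ ⟪G x - G y, x - y⟫) : ∃ p, ∀ x, g p ≤ g x := by
  have hc : Continuous g :=
    continuous_iff_continuousAt.2 fun x => (hg x).differentiableAt.continuousAt
  refine hc.exists_forall_le' 0 ?_
  have : (Metric.closedBall (0 : F) (2 * ‖G 0‖ / σ))ᶜ ∈ Filter.cocompact F :=
    (isCompact_closedBall _ _).compl_mem_cocompact
  filter_upwards [this] with x hx
  rw [Set.mem_compl_iff, mem_closedBall_zero_iff, not_le, div_lt_iff₀ hσ0] at hx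
  have h := ge_of_gradient_strongly_monotone hg hσ 0 x
  rw [zero_add] at h
  have h2 := neg_le_of_abs_le (abs_real_inner_le_norm (G 0) x)
  nlinarith [norm_nonneg x]

/-- Strong convexity bounds the suboptimality by the squared norm of the gradient. -/
lemma sub_le_norm_gradient_sq {g : F → ℝ} {G : F → F} {σ : ℝ} (hσ0 : 0 < σ)
    (hg : ∀ x, HasGradientAt g (G x) x)
    (hσ : ∀ x y, σ * ‖x - y‖ ^ 2 ≤ ⟪G x - G y, x - y⟫) (x p : F) :
    g x - g p ≤ ‖G x‖ ^ 2 / (2 * σ) := by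
  have h := ge_of_gradient_strongly_monotone hg hσ x (p - x)
  rw [add_sub_cancel] at h
  have h2 := neg_le_of_abs_le (abs_real_inner_le_norm (G x) (p - x))
  rw [le_div_iff₀ (by positivity)]
  nlinarith [sq_nonneg (‖G x‖ - σ * ‖p - x‖)]

lemma agdPotential_self_le {g : F → ℝ} {G : F → F} {σ s : ℝ} (hσ0 : 0 < σ)
    (hg : ∀ x, HasGradientAt g (G x) x)
    (hσ : ∀ x y, σ * ‖x - y‖ ^ 2 ≤ ⟪G x - G y, x - y⟫) {p : F} (hp : ∀ x, g p ≤ g x) (y : F) :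
    agdPotential g σ s p y y ≤ ‖G y‖ ^ 2 / σ := by
  have hGp : G p = 0 := by
    have h1 : IsLocalMin g p := Filter.Eventually.of_forall hp
    have h2 := h1.hasFDerivAt_eq_zero (hg p).hasFDerivAt
    simpa using h2
  have h1 := ge_of_gradient_strongly_monotone hg hσ p (y - p)
  rw [add_sub_cancel, hGp, inner_zero_left, add_zero] at h1
  have h2 := sub_le_norm_gradient_sq hσ0 hg hσ y p
  have h3 : (1 + s) • y - s • y - p = y - p := by module
  rw [agdPotential, h3]
  have h4 : ‖G y‖ ^ 2 / σ = 2 * (‖G y‖ ^ 2 / (2 * σ)) := by field_simp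
  rw [h4]
  linarith

lemma norm_gradient_sq_le_agdPotential {g : F → ℝ} {G : F → F} {L σ s : ℝ} (hL0 : 0 < L)
    (hσ0 : 0 < σ) (hg : ∀ x, HasGradientAt g (G x) x) (hL : ∀ x y, ‖G x - G y‖ ≤ L * ‖x - y‖)
    {p : F} (hp : ∀ x, g p ≤ g x) (y z : F) :
    ‖G y‖ ^ 2 ≤ 2 * L * agdPotential g σ s p y z := by
  refine (norm_gradient_sq_le hL0 hg hL hp y).trans ?_
  have : 0 ≤ σ / 2 * ‖(1 + s) • z - s • y - p‖ ^ 2 := by positivity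
  rw [agdPotential]
  nlinarith

/-- An approximate minimizer `w` of `h + γ ‖· - z‖²`, as computed in one pass of
Almost-Convex-AGD: it decreases `h`, and it is far from `z` unless its gradient is small. -/
lemma prox_step {h : F → ℝ} {H : F → F} {γ L ε : ℝ} (hγ : 0 < γ) (hL0 : 0 < L) (hε : 0 < ε)
    {z w : F}
    (hg : ∀ x, HasGradientAt (fun u => h u + γ * ‖u - z‖ ^ 2) (H x + (2 * γ) • (x - z)) x)
    (hL : ∀ x y, ‖(H x + (2 * γ) • (x - z)) - (H y + (2 * γ) • (y - z))‖ ≤ L * ‖x - y‖)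
    (hσ : ∀ x y, γ * ‖x - y‖ ^ 2 ≤
      ⟪(H x + (2 * γ) • (x - z)) - (H y + (2 * γ) • (y - z)), x - y⟫)
    (hz : ε < ‖H z‖)
    (hw : ‖H w + (2 * γ) • (w - z)‖ ≤ ε * Real.sqrt (γ / (50 * (L + 2 * γ)))) :
    h w + γ * ‖w - z‖ ^ 2 ≤ h z ∧ (ε < ‖H w‖ → 9 / 10 * ε ≤ 2 * γ * ‖w - z‖) := by
  have hr : 0 ≤ γ / (50 * (L + 2 * γ)) := by positivity
  have hsq := Real.sq_sqrt hr
  have hs0 := Real.sqrt_nonneg (γ / (50 * (L + 2 * γ)))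
  set r := Real.sqrt (γ / (50 * (L + 2 * γ)))
  constructor
  · set p := z - (1 / L) • (H z + (2 * γ) • (z - z)) with hp
    have h1 := gradient_step_le hL0 hg hL z
    have h2 := sub_le_norm_gradient_sq hγ hg hσ w p
    simp only [sub_self, norm_zero, smul_zero, add_zero, ne_eq, OfNat.ofNat_ne_zero,
      not_false_eq_true, zero_pow, mul_zero] at h1 hp
    rw [← hp] at h1
    have h3 : ‖H w + (2 * γ) • (w - z)‖ ^ 2 / (2 * γ) ≤ ‖H z‖ ^ 2 / (2 * L) := by
      have h4 : ‖H w + (2 * γ) • (w - z)‖ ^ 2 ≤ ε ^ 2 * (γ / (50 * (L + 2 * γ))) := by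
        rw [← hsq, ← mul_pow]
        exact pow_le_pow_left₀ (norm_nonneg _) hw 2
      have h5 : ε ^ 2 ≤ ‖H z‖ ^ 2 := pow_le_pow_left₀ hε.le hz.le 2
      calc ‖H w + (2 * γ) • (w - z)‖ ^ 2 / (2 * γ)
          ≤ ε ^ 2 * (γ / (50 * (L + 2 * γ))) / (2 * γ) := by gcongr
        _ = ε ^ 2 / (100 * (L + 2 * γ)) := by field_simp; ring
        _ ≤ ‖H z‖ ^ 2 / (2 * L) := by
          have : L ≤ L + 2 * γ := by linarith
          have : 2 * L ≤ 100 * (L + 2 * γ) := by linarith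
          exact div_le_div₀ (sq_nonneg _) h5 (by positivity) this
    linarith
  · intro hHw
    have hr10 : r ≤ 1 / 10 := by
      refine Real.sqrt_le_iff.2 ⟨by norm_num, ?_⟩
      rw [div_le_iff₀ (by positivity)]
      nlinarith
    have h1 : ‖H w‖ ≤ ‖H w + (2 * γ) • (w - z)‖ + ‖(2 * γ) • (w - z)‖ := by
      have := norm_sub_le (H w + (2 * γ) • (w - z)) ((2 * γ) • (w - z))
      rwa [add_sub_cancel_right] at this
    rw [norm_smul, Real.norm_of_nonneg (by positivity)] at h1
    nlinarith

end Accelerated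

/-! ### The regularized objective is almost convex -/

section Regularized

variable {F : Type*} [NormedAddCommGroup F] [InnerProductSpace ℝ F]

/-- The projection onto the closed ball of radius `ρ` around `0`. -/
noncomputable def ballProj (ρ : ℝ) (u : F) : F := (ρ / max ρ ‖u‖) • u

lemma norm_ballProj_le {ρ : ℝ} (hρ : 0 < ρ) (u : F) : ‖ballProj ρ u‖ ≤ ρ := by
  have hm : 0 < max ρ ‖u‖ := lt_max_of_lt_left hρ
  rw [ballProj, norm_smul, Real.norm_of_nonneg (by positivity), div_mul_eq_mul_div,
    div_le_iff₀ hm]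
  exact mul_le_mul_of_nonneg_left (le_max_right _ _) hρ.le

lemma norm_sub_ballProj {ρ : ℝ} (hρ : 0 < ρ) (u : F) :
    ‖u - ballProj ρ u‖ = max (‖u‖ - ρ) 0 := by
  rcases le_total ‖u‖ ρ with h | h
  · rw [ballProj, max_eq_left h, div_self hρ.ne', one_smul, sub_self, norm_zero,
      max_eq_right (by linarith)]
  · have hu : 0 < ‖u‖ := hρ.trans_le h
    rw [ballProj, max_eq_right h, max_eq_left (by linarith),
      show u - (ρ / ‖u‖) • u = (1 - ρ / ‖u‖) • u by module, norm_smul,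
      Real.norm_of_nonneg (by rw [sub_nonneg, div_le_one hu]; exact h)]
    field_simp

lemma norm_sub_ballProj_le {ρ : ℝ} (hρ : 0 < ρ) (u : F) {w : F} (hw : ‖w‖ ≤ ρ) :
    ‖u - ballProj ρ u‖ ≤ ‖u - w‖ := by
  rw [norm_sub_ballProj hρ]
  refine max_le ?_ (norm_nonneg _)
  have := norm_sub_norm_le u w
  linarith

/-- The variational characterization of the projection. -/
lemma inner_sub_ballProj_nonpos {ρ : ℝ} (hρ : 0 < ρ) (u : F) {w : F} (hw : ‖w‖ ≤ ρ) :
    ⟪u - ballProj ρ u, w - ballProj ρ u⟫ ≤ 0 := by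
  rcases le_total ‖u‖ ρ with h | h
  · rw [ballProj, max_eq_left h, div_self hρ.ne', one_smul, sub_self, inner_zero_left]
  · have hu : 0 < ‖u‖ := hρ.trans_le h
    rw [ballProj, max_eq_right h, show u - (ρ / ‖u‖) • u = (1 - ρ / ‖u‖) • u by module,
      inner_smul_left, inner_sub_right, inner_smul_right, real_inner_self_eq_norm_sq]
    simp only [conj_trivial]
    refine mul_nonpos_of_nonneg_of_nonpos (by rw [sub_nonneg, div_le_one hu]; exact h) ?_
    have h1 := real_inner_le_norm u w
    have h2 : ρ / ‖u‖ * ‖u‖ ^ 2 = ρ * ‖u‖ := by field_simp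
    rw [h2]
    nlinarith

lemma norm_ballProj_sub_sq_le {ρ : ℝ} (hρ : 0 < ρ) (u v : F) :
    0 ≤ ⟪(u - ballProj ρ u) - (v - ballProj ρ v), ballProj ρ u - ballProj ρ v⟫ := by
  have h1 := inner_sub_ballProj_nonpos hρ u (norm_ballProj_le hρ v)
  have h2 := inner_sub_ballProj_nonpos hρ v (norm_ballProj_le hρ u)
  rw [← neg_sub (ballProj ρ u) (ballProj ρ v), inner_neg_right] at h1
  rw [inner_sub_left]
  linarith

lemma norm_ballProj_sub_le {ρ : ℝ} (hρ : 0 < ρ) (u v : F) :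
    ‖ballProj ρ u - ballProj ρ v‖ ≤ ‖u - v‖ := by
  have h := norm_ballProj_sub_sq_le hρ u v
  set a := ballProj ρ u - ballProj ρ v with ha
  set c := (u - ballProj ρ u) - (v - ballProj ρ v) with hc
  have huv : u - v = c + a := by rw [ha, hc]; abel
  refine abs_le_of_sq_le_sq' ?_ (norm_nonneg _) |>.2
  rw [huv, norm_add_sq_real]
  nlinarith [sq_nonneg ‖c‖]

lemma norm_sub_ballProj_sub_sq_le {ρ : ℝ} (hρ : 0 < ρ) (u v : F) :
    ‖(u - ballProj ρ u) - (v - ballProj ρ v)‖ ^ 2 ≤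
      ⟪(u - ballProj ρ u) - (v - ballProj ρ v), u - v⟫ := by
  have h := norm_ballProj_sub_sq_le hρ u v
  have huv : u - v = ((u - ballProj ρ u) - (v - ballProj ρ v)) +
    (ballProj ρ u - ballProj ρ v) := by abel
  conv_rhs => rw [huv]
  rw [inner_add_right, real_inner_self_eq_norm_sq]
  linarith

lemma norm_sub_ballProj_sub_le {ρ : ℝ} (hρ : 0 < ρ) (u v : F) :
    ‖(u - ballProj ρ u) - (v - ballProj ρ v)‖ ≤ ‖u - v‖ := by
  have h := norm_sub_ballProj_sub_sq_le hρ u v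
  have h2 := real_inner_le_norm ((u - ballProj ρ u) - (v - ballProj ρ v)) (u - v)
  nlinarith [norm_nonneg ((u - ballProj ρ u) - (v - ballProj ρ v)), norm_nonneg (u - v)]

/-- Outside the ball of radius `2ρ` the projection onto the ball of radius `ρ` is a contraction
with factor `1/2`. -/
lemma half_norm_sq_le_inner {ρ : ℝ} (hρ : 0 < ρ) {u v : F} (hu : 2 * ρ ≤ ‖u‖)
    (hv : 2 * ρ ≤ ‖v‖) :
    1 / 2 * ‖u - v‖ ^ 2 ≤ ⟪(u - ballProj ρ u) - (v - ballProj ρ v), u - v⟫ := by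
  have hhalf : ∀ x : F, 2 * ρ ≤ ‖x‖ → ballProj ρ x = (1 / 2 : ℝ) • ballProj (2 * ρ) x := by
    intro x hx
    rw [ballProj, ballProj, max_eq_right hx, max_eq_right (by linarith), smul_smul]
    congr 1; ring
  have h1 : ‖ballProj ρ u - ballProj ρ v‖ ≤ 1 / 2 * ‖u - v‖ := by
    rw [hhalf u hu, hhalf v hv, ← smul_sub, norm_smul, Real.norm_of_nonneg (by norm_num)]
    exact mul_le_mul_of_nonneg_left (norm_ballProj_sub_le (by linarith) u v) (by norm_num)
  have h2 := real_inner_le_norm (ballProj ρ u - ballProj ρ v) (u - v)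
  have h3 : (u - ballProj ρ u) - (v - ballProj ρ v) =
    (u - v) - (ballProj ρ u - ballProj ρ v) := by abel
  rw [h3, inner_sub_left, real_inner_self_eq_norm_sq]
  nlinarith [norm_nonneg (u - v)]

lemma continuous_ballProj {ρ : ℝ} (hρ : 0 < ρ) : Continuous (ballProj ρ : F → F) := by
  refine (LipschitzWith.of_dist_le_mul (K := 1) fun x y => ?_).continuous
  rw [dist_eq_norm, dist_eq_norm, NNReal.coe_one, one_mul]
  exact norm_ballProj_sub_le hρ x y

variable [CompleteSpace F]

lemma hasGradientAt_of_abs_le {g : F → ℝ} {x G : F} {c : ℝ}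
    (h : ∀ v, |g (x + v) - g x - ⟪G, v⟫| ≤ c * ‖v‖ ^ 2) : HasGradientAt g G x := by
  rw [hasGradientAt_iff_isLittleO_nhds_zero]
  refine Asymptotics.IsBigO.trans_isLittleO (g := fun v : F => ‖v‖ ^ 2) ?_ ?_
  · refine Asymptotics.IsBigO.of_bound c (Filter.Eventually.of_forall fun v => ?_)
    rw [Real.norm_eq_abs, Real.norm_of_nonneg (sq_nonneg _)]
    exact h v
  · exact Asymptotics.isLittleO_norm_pow_id one_lt_two

/-- The squared distance to a ball. -/
lemma hasGradientAt_sq_dist_ball {ρ : ℝ} (hρ : 0 < ρ) (c x : F) :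
    HasGradientAt (fun y => (max (‖y - c‖ - ρ) 0) ^ 2)
      ((2 : ℝ) • ((x - c) - ballProj ρ (x - c))) x := by
  have hub : ∀ u v : F, ‖v - ballProj ρ v‖ ^ 2 ≤
      ‖u - ballProj ρ u‖ ^ 2 + 2 * ⟪u - ballProj ρ u, v - u⟫ + ‖v - u‖ ^ 2 := by
    intro u v
    rw [← norm_add_sq_real]
    have : u - ballProj ρ u + (v - u) = v - ballProj ρ u := by abel
    rw [this]
    exact pow_le_pow_left₀ (norm_nonneg _) (norm_sub_ballProj_le hρ v (norm_ballProj_le hρ u)) 2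
  refine hasGradientAt_of_abs_le (c := 1) fun v => ?_
  rw [← norm_sub_ballProj hρ, ← norm_sub_ballProj hρ]
  have hxc : x + v - c = (x - c) + v := by abel
  rw [hxc]
  set u := x - c with hu
  have h1 := hub u (u + v)
  have h2 := hub (u + v) u
  have h3 := (sq_nonneg _).trans (norm_sub_ballProj_sub_sq_le hρ (u + v) u)
  rw [add_sub_cancel_left] at h1 h3
  rw [show u - (u + v) = -v by abel, inner_neg_right, norm_neg] at h2
  rw [inner_sub_left] at h3
  rw [inner_smul_left, abs_le]
  simp only [conj_trivial]
  constructor <;> linarith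

lemma hasGradientAt_sq_norm_sub (γ : ℝ) (z x : F) :
    HasGradientAt (fun u => γ * ‖u - z‖ ^ 2) ((2 * γ) • (x - z)) x := by
  refine hasGradientAt_of_abs_le (c := |γ|) fun v => ?_
  have h1 : x + v - z = (x - z) + v := by abel
  rw [h1, norm_add_sq_real, inner_smul_left]
  simp only [conj_trivial]
  have : γ * (‖x - z‖ ^ 2 + 2 * ⟪x - z, v⟫ + ‖v‖ ^ 2) - γ * ‖x - z‖ ^ 2 -
      2 * γ * ⟪x - z, v⟫ = γ * ‖v‖ ^ 2 := by ring
  rw [this, abs_mul, abs_of_nonneg (sq_nonneg ‖v‖)]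

lemma HasGradientAt.add_fun {g h : F → ℝ} {G H x : F} (hg : HasGradientAt g G x)
    (hh : HasGradientAt h H x) : HasGradientAt (fun y => g y + h y) (G + H) x := by
  rw [hasGradientAt_iff_hasFDerivAt, map_add]
  exact hg.hasFDerivAt.add hh.hasFDerivAt

lemma HasGradientAt.const_mul_fun {g : F → ℝ} {G x : F} (hg : HasGradientAt g G x) (c : ℝ) :
    HasGradientAt (fun y => c * g y) (c • G) x := by
  rw [hasGradientAt_iff_hasFDerivAt, map_smul]
  exact hg.hasFDerivAt.const_mul c

variable {d : ℕ} {f : E d → ℝ} {L₁ L₂ : ℝ}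

/-- The gradient of the regularized objective with centre `c` and radius `ρ`. -/
noncomputable def regGrad (f : E d → ℝ) (L₁ ρ : ℝ) (c x : E d) : E d :=
  gradient f x + (2 * L₁) • ((x - c) - ballProj ρ (x - c))

lemma SmoothObjective.hasGradientAt_regularized (hf : SmoothObjective f L₁ L₂) (hL₂ : 0 < L₂)
    {ε₂ : ℝ} (hε₂ : 0 < ε₂) (c x : E d) :
    HasGradientAt (regularized f L₁ L₂ ε₂ c) (regGrad f L₁ (ε₂ / L₂) c x) x := by
  have h := HasGradientAt.add_fun (hf.hasGradientAt x)
    (HasGradientAt.const_mul_fun (hasGradientAt_sq_dist_ball (div_pos hε₂ hL₂) c x) L₁)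
  have e : L₁ • ((2 : ℝ) • ((x - c) - ballProj (ε₂ / L₂) (x - c))) =
      (2 * L₁) • ((x - c) - ballProj (ε₂ / L₂) (x - c)) := by rw [smul_smul, mul_comm]
  rw [e] at h
  exact h

lemma SmoothObjective.regGrad_lipschitz (hf : SmoothObjective f L₁ L₂) (hL₁ : 0 < L₁)
    {ρ : ℝ} (hρ : 0 < ρ) (c x y : E d) :
    ‖regGrad f L₁ ρ c x - regGrad f L₁ ρ c y‖ ≤ 3 * L₁ * ‖x - y‖ := by
  have h1 := hf.gradient_lipschitz x y
  have h2 := norm_sub_ballProj_sub_le hρ (x - c) (y - c)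
  rw [sub_sub_sub_cancel_right] at h2
  have e : regGrad f L₁ ρ c x - regGrad f L₁ ρ c y = (gradient f x - gradient f y) +
      (2 * L₁) • (((x - c) - ballProj ρ (x - c)) - ((y - c) - ballProj ρ (y - c))) := by
    rw [regGrad, regGrad]; module
  rw [e]
  refine (norm_add_le _ _).trans ?_
  rw [norm_smul, Real.norm_of_nonneg (by positivity)]
  nlinarith

/-- If the Hessian at the centre is bounded below by `-ε₂`, then the regularized objective is
`3ε₂`-almost convex, in terms of its gradient: inside the ball of radius `2ε₂ / L₂` this follows
from the Lipschitz condition on the Hessian, outside of it the regularizer is sufficiently convex,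
and a segment that crosses the sphere is split. -/
lemma SmoothObjective.regGrad_almost_monotone (hf : SmoothObjective f L₁ L₂) (hL₁ : 0 < L₁)
    (hL₂ : 0 < L₂) {ε₂ : ℝ} (hε₂ : 0 < ε₂) {c : E d}
    (hc : ∀ u, -ε₂ * ‖u‖ ^ 2 ≤ ⟪u, hessian f c u⟫) (x y : E d) :
    -(3 * ε₂) * ‖x - y‖ ^ 2 ≤
      ⟪regGrad f L₁ (ε₂ / L₂) c x - regGrad f L₁ (ε₂ / L₂) c y, x - y⟫ := by
  set ρ := ε₂ / L₂ with hρdef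
  have hρ : 0 < ρ := div_pos hε₂ hL₂
  have hsplit : ∀ x y, ⟪regGrad f L₁ ρ c x - regGrad f L₁ ρ c y, x - y⟫ =
      ⟪gradient f x - gradient f y, x - y⟫ + 2 * L₁ *
        ⟪((x - c) - ballProj ρ (x - c)) - ((y - c) - ballProj ρ (y - c)), (x - c) - (y - c)⟫ := by
    intro x y
    have e : regGrad f L₁ ρ c x - regGrad f L₁ ρ c y = (gradient f x - gradient f y) +
        (2 * L₁) • (((x - c) - ballProj ρ (x - c)) - ((y - c) - ballProj ρ (y - c))) := by
      rw [regGrad, regGrad]; module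
    rw [e, inner_add_left, inner_smul_left, sub_sub_sub_cancel_right]
    simp
  have hin : ∀ x y, ‖x - c‖ ≤ 2 * ρ → ‖y - c‖ ≤ 2 * ρ → -(3 * ε₂) * ‖x - y‖ ^ 2 ≤
      ⟪regGrad f L₁ ρ c x - regGrad f L₁ ρ c y, x - y⟫ := by
    intro x y hx hy
    rw [hsplit]
    have h1 := (sq_nonneg _).trans (norm_sub_ballProj_sub_sq_le hρ (x - c) (y - c))
    have h2 := le_of_deriv_le_quadratic
      (φ := fun s => -⟪gradient f (y + s • (x - y)), x - y⟫) (a := 3 * ε₂ * ‖x - y‖ ^ 2)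
      (b := 0) (c := 0)
      (fun t => (hf.hasDerivAt_inner_gradient y (x - y) t).neg) (fun t ht0 ht1 => by
        have h3 := hc (x - y)
        rw [real_inner_comm] at h3
        have h4 := neg_le_of_abs_le (hf.inner_hessian_sub_le (y + t • (x - y)) c (x - y))
        have h5 : ‖y + t • (x - y) - c‖ ≤ 2 * ρ := by
          have e : y + t • (x - y) - c = (1 - t) • (y - c) + t • (x - c) := by module
          rw [e]
          refine (norm_add_le _ _).trans ?_
          rw [norm_smul, norm_smul, Real.norm_of_nonneg ht0, Real.norm_of_nonneg (by linarith)]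
          nlinarith
        have h6 : L₂ * ‖y + t • (x - y) - c‖ ≤ 2 * ε₂ := by
          have : L₂ * (2 * ρ) = 2 * ε₂ := by rw [hρdef]; field_simp
          rw [← this]
          exact mul_le_mul_of_nonneg_left h5 hL₂.le
        have h7 := mul_le_mul_of_nonneg_right h6 (sq_nonneg ‖x - y‖)
        linarith)
    simp only [one_smul, zero_smul, add_zero, add_sub_cancel] at h2
    rw [inner_sub_left]
    nlinarith
  have hout : ∀ x y, 2 * ρ ≤ ‖x - c‖ → 2 * ρ ≤ ‖y - c‖ → -(3 * ε₂) * ‖x - y‖ ^ 2 ≤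
      ⟪regGrad f L₁ ρ c x - regGrad f L₁ ρ c y, x - y⟫ := by
    intro x y hx hy
    rw [hsplit]
    have h1 := half_norm_sq_le_inner hρ hx hy
    have h2 := neg_le_of_abs_le (abs_real_inner_le_norm (gradient f x - gradient f y) (x - y))
    have h3 := mul_le_mul_of_nonneg_right (hf.gradient_lipschitz x y) (norm_nonneg (x - y))
    have h4 := mul_le_mul_of_nonneg_left h1 (by positivity : 0 ≤ 2 * L₁)
    rw [sub_sub_sub_cancel_right] at h4 ⊢
    nlinarith [mul_nonneg hε₂.le (sq_nonneg ‖x - y‖)]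
  have hmix : ∀ x y, ‖x - c‖ ≤ 2 * ρ → 2 * ρ ≤ ‖y - c‖ → -(3 * ε₂) * ‖x - y‖ ^ 2 ≤
      ⟪regGrad f L₁ ρ c x - regGrad f L₁ ρ c y, x - y⟫ := by
    intro x y hx hy
    have hcont : ContinuousOn (fun t : ℝ => ‖x + t • (y - x) - c‖) (Set.Icc 0 1) := by fun_prop
    obtain ⟨t, ⟨ht0, ht1⟩, ht⟩ := intermediate_value_Icc zero_le_one hcont
      (show 2 * ρ ∈ Set.Icc _ _ by simpa using ⟨hx, hy⟩)
    simp only at ht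
    set w := x + t • (y - x) with hw
    have exw : x - w = t • (x - y) := by rw [hw]; module
    have ewy : w - y = (1 - t) • (x - y) := by rw [hw]; module
    rcases ht0.eq_or_lt with rfl | ht0
    · have : w = x := by rw [hw]; simp
      exact hout x y (by rw [← this, ht]) hy
    rcases ht1.eq_or_lt with rfl | ht1
    · have : w = y := by rw [hw]; simp
      exact hin x y hx (by rw [← this, ht])
    have h1 := hin x w hx ht.le
    have h2 := hout w y ht.ge hy
    rw [exw, norm_smul, inner_smul_right, Real.norm_of_nonneg ht0.le, mul_pow] at h1
    rw [ewy, norm_smul, inner_smul_right, Real.norm_of_nonneg (by linarith), mul_pow] at h2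
    have h1' : -(3 * ε₂) * t * ‖x - y‖ ^ 2 ≤ ⟪regGrad f L₁ ρ c x - regGrad f L₁ ρ c w, x - y⟫ := by
      refine le_of_mul_le_mul_left (le_of_eq_of_le ?_ h1) ht0
      ring
    have h2' : -(3 * ε₂) * (1 - t) * ‖x - y‖ ^ 2 ≤
        ⟪regGrad f L₁ ρ c w - regGrad f L₁ ρ c y, x - y⟫ := by
      refine le_of_mul_le_mul_left (le_of_eq_of_le ?_ h2) (sub_pos.2 ht1)
      ring
    have e : regGrad f L₁ ρ c x - regGrad f L₁ ρ c y = (regGrad f L₁ ρ c x - regGrad f L₁ ρ c w) +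
      (regGrad f L₁ ρ c w - regGrad f L₁ ρ c y) := by abel
    rw [e, inner_add_left]
    linarith
  rcases le_total ‖x - c‖ (2 * ρ) with hx | hx <;> rcases le_total ‖y - c‖ (2 * ρ) with hy | hy
  · exact hin x y hx hy
  · exact hmix x y hx hy
  · have h := hmix y x hy hx
    rw [norm_sub_rev, ← neg_sub (regGrad f L₁ ρ c x), ← neg_sub x y, inner_neg_neg] at h
    exact h
  · exact hout x y hx hy

/-- The gradient of the strongly convex function that is minimized in one pass of
Almost-Convex-AGD. -/
noncomputable def proxGrad (f : E d → ℝ) (L₁ ρ γ : ℝ) (c z x : E d) : E d :=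
  regGrad f L₁ ρ c x + (2 * γ) • (x - z)

lemma SmoothObjective.hasGradientAt_prox (hf : SmoothObjective f L₁ L₂) (hL₂ : 0 < L₂)
    {ε₂ : ℝ} (hε₂ : 0 < ε₂) (γ : ℝ) (c z x : E d) :
    HasGradientAt (fun u => regularized f L₁ L₂ ε₂ c u + γ * ‖u - z‖ ^ 2)
      (proxGrad f L₁ (ε₂ / L₂) γ c z x) x :=
  HasGradientAt.add_fun (hf.hasGradientAt_regularized hL₂ hε₂ c x)
    (hasGradientAt_sq_norm_sub γ z x)

lemma SmoothObjective.proxGrad_lipschitz (hf : SmoothObjective f L₁ L₂) (hL₁ : 0 < L₁)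
    {ρ γ : ℝ} (hρ : 0 < ρ) (hγ : 0 < γ) (hγL : γ ≤ L₁) (c z x y : E d) :
    ‖proxGrad f L₁ ρ γ c z x - proxGrad f L₁ ρ γ c z y‖ ≤ 5 * L₁ * ‖x - y‖ := by
  have e : proxGrad f L₁ ρ γ c z x - proxGrad f L₁ ρ γ c z y =
      (regGrad f L₁ ρ c x - regGrad f L₁ ρ c y) + (2 * γ) • (x - y) := by
    rw [proxGrad, proxGrad]; module
  rw [e]
  refine (norm_add_le _ _).trans ?_
  have h := hf.regGrad_lipschitz hL₁ hρ c x y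
  rw [norm_smul, Real.norm_of_nonneg (by positivity)]
  nlinarith [norm_nonneg (x - y)]

lemma SmoothObjective.proxGrad_strongly_monotone (hf : SmoothObjective f L₁ L₂) (hL₁ : 0 < L₁)
    (hL₂ : 0 < L₂) {ε₂ : ℝ} (hε₂ : 0 < ε₂) {c : E d}
    (hc : ∀ u, -ε₂ * ‖u‖ ^ 2 ≤ ⟪u, hessian f c u⟫) (z x y : E d) :
    3 * ε₂ * ‖x - y‖ ^ 2 ≤ ⟪proxGrad f L₁ (ε₂ / L₂) (3 * ε₂) c z x -
      proxGrad f L₁ (ε₂ / L₂) (3 * ε₂) c z y, x - y⟫ := by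
  have e : proxGrad f L₁ (ε₂ / L₂) (3 * ε₂) c z x - proxGrad f L₁ (ε₂ / L₂) (3 * ε₂) c z y =
      (regGrad f L₁ (ε₂ / L₂) c x - regGrad f L₁ (ε₂ / L₂) c y) +
        (2 * (3 * ε₂)) • (x - y) := by
    rw [proxGrad, proxGrad]; module
  rw [e, inner_add_left, inner_smul_left, real_inner_self_eq_norm_sq]
  have h := hf.regGrad_almost_monotone hL₁ hL₂ hε₂ hc x y
  simp only [conj_trivial]
  linarith

end Regularized


/-! ### Total correctness of logged computations -/

section Hoare

variable {d : ℕ} {α β σ : Type}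

/-- The computation `c`, started with the log `l`, terminates with a result and a log that satisfy
the postcondition `Q`. -/
def Terminates (c : Alg d α) (l : Log d) (Q : α → Log d → Prop) : Prop :=
  ∃ a l', (a, l') ∈ c l ∧ Q a l'

lemma Terminates.mono {c : Alg d α} {l : Log d} {Q Q' : α → Log d → Prop}
    (h : Terminates c l Q) (hQ : ∀ a l', Q a l' → Q' a l') : Terminates c l Q' := by
  obtain ⟨a, l', h1, h2⟩ := h
  exact ⟨a, l', h1, hQ _ _ h2⟩

@[simp] lemma terminates_pure {a : α} {l : Log d} {Q : α → Log d → Prop} :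
    Terminates (pure a) l Q ↔ Q a l := by
  constructor
  · rintro ⟨a', l', h, hQ⟩
    have h' : (a', l') ∈ Part.some (a, l) := h
    rw [Part.mem_some_iff, Prod.mk.injEq] at h'
    rwa [← h'.1, ← h'.2]
  · exact fun h => ⟨a, l, Part.mem_some _, h⟩

@[simp] lemma terminates_bind {c : Alg d α} {k : α → Alg d β} {l : Log d}
    {Q : β → Log d → Prop} :
    Terminates (c >>= k) l Q ↔ Terminates c l fun a l' => Terminates (k a) l' Q := by
  have hb : (c >>= k) l = (c l).bind fun r => k r.1 r.2 := rfl
  constructor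
  · rintro ⟨b, l', h, hQ⟩
    rw [hb, Part.mem_bind_iff] at h
    obtain ⟨r, hr, h⟩ := h
    exact ⟨r.1, r.2, hr, b, l', h, hQ⟩
  · rintro ⟨a, l', h, b, l'', h', hQ⟩
    refine ⟨b, l'', ?_, hQ⟩
    rw [hb, Part.mem_bind_iff]
    exact ⟨_, h, h'⟩

@[simp] lemma terminates_modify {g : Log d → Log d} {l : Log d} {Q : PUnit → Log d → Prop} :
    Terminates (modify g : Alg d PUnit) l Q ↔ Q ⟨⟩ (g l) :=
  ⟨by
    rintro ⟨a, l', h, hQ⟩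
    have h' : (a, l') ∈ Part.some (PUnit.unit, g l) := h
    rw [Part.mem_some_iff, Prod.mk.injEq] at h'
    rwa [← h'.1, ← h'.2], fun h => ⟨_, _, Part.mem_some _, h⟩⟩

@[simp] lemma terminates_get {l : Log d} {Q : Log d → Log d → Prop} :
    Terminates (get : Alg d (Log d)) l Q ↔ Q l l :=
  ⟨by
    rintro ⟨a, l', h, hQ⟩
    have h' : (a, l') ∈ Part.some (l, l) := h
    rw [Part.mem_some_iff, Prod.mk.injEq] at h'
    rwa [h'.1, h'.2] at hQ, fun h => ⟨_, _, Part.mem_some _, h⟩⟩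

@[simp] lemma terminates_evalGrad {f : E d → ℝ} {x : E d} {l : Log d}
    {Q : E d → Log d → Prop} :
    Terminates (evalGrad f x) l Q ↔ Q (gradient f x) { l with grads := l.grads + 1 } := by
  rw [evalGrad, terminates_bind, terminates_modify, terminates_pure]

@[simp] lemma terminates_evalHvp {f : E d → ℝ} {x v : E d} {l : Log d}
    {Q : E d → Log d → Prop} :
    Terminates (evalHvp f x v) l Q ↔ Q (hessian f x v) { l with hvps := l.hvps + 1 } := by
  rw [evalHvp, terminates_bind, terminates_modify, terminates_pure]

/-- Total correctness of a loop, by means of an invariant that is indexed by a bound on the number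
of remaining passes. -/
lemma terminates_loop {body : σ → Alg d (α ⊕ σ)} {Q : α → Log d → Prop}
    (I : ℕ → σ → Log d → Prop)
    (h : ∀ n s l, I n s l → Terminates (body s) l fun r l' =>
      r.elim (fun a => Q a l') fun s' => ∃ k, n = k + 1 ∧ I k s' l')
    (n : ℕ) (s : σ) (l : Log d) (h0 : I n s l) : Terminates (loop body s) l Q := by
  induction n using Nat.strong_induction_on generalizing s l with
  | _ n ih =>
  obtain ⟨r, l', hr, hQ⟩ := h n s l h0
  cases r with
  | inl a =>
    refine ⟨a, l', ?_, hQ⟩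
    change (a, l') ∈ (loopStep body).fix (s, l)
    rw [PFun.mem_fix_iff]
    left
    exact Part.mem_map_iff _ |>.2 ⟨_, hr, rfl⟩
  | inr s' =>
    obtain ⟨k, hk, hI⟩ := hQ
    obtain ⟨a, l'', h1, h2⟩ := ih k (by omega) s' l' hI
    refine ⟨a, l'', ?_, h2⟩
    change (a, l'') ∈ (loopStep body).fix (s, l)
    rw [PFun.mem_fix_iff]
    right
    exact ⟨(s', l'), Part.mem_map_iff _ |>.2 ⟨_, hr, rfl⟩, h1⟩

lemma terminates_ite {p : Prop} [Decidable p] {c c' : Alg d α} {l : Log d}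
    {Q : α → Log d → Prop} (h : p → Terminates c l Q) (h' : ¬p → Terminates c' l Q) :
    Terminates (if p then c else c') l Q := by
  split_ifs with hp
  · exact h hp
  · exact h' hp

end Hoare

/-! ### Runs of the accelerated gradient method -/

section RunAGD

variable {d : ℕ}

/-- The update of a pair of iterates of accelerated gradient descent for a function with gradient
field `G`, which leaves the pair unchanged once the stopping criterion is met. -/
noncomputable def agdStep (G : E d → E d) (ε L c : ℝ) (p : E d × E d) : E d × E d :=
  if ‖G p.1‖ ≤ ε then p
  else (p.2 - (1 / L) • G p.2, (1 + c) • (p.2 - (1 / L) • G p.2) - c • p.1)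

/-- The momentum coefficient `(√κ - 1) / (√κ + 1)` for the condition number `κ = L / σ`. -/
noncomputable def momentum (L σ : ℝ) : ℝ :=
  (Real.sqrt (L / σ) - 1) / (Real.sqrt (L / σ) + 1)

/-- Accelerated gradient descent stops within `T` steps, if `T` steps suffice to shrink the
potential below the tolerance. -/
lemma agd_terminates {g : E d → ℝ} {G : E d → E d} {L σ ε : ℝ} (hσ0 : 0 < σ) (hσL : σ ≤ L)
    (hε : 0 ≤ ε) (hg : ∀ x, HasGradientAt g (G x) x)
    (hL : ∀ x y, ‖G x - G y‖ ≤ L * ‖x - y‖)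
    (hσ : ∀ x y, σ * ‖x - y‖ ^ 2 ≤ ⟪G x - G y, x - y⟫) (y₁ : E d) {T : ℕ}
    (hT : 2 * L * ((1 - 1 / Real.sqrt (L / σ)) ^ T * (‖G y₁‖ ^ 2 / σ)) ≤ ε ^ 2) (l : Log d) :
    Terminates (agd g y₁ ε L σ) l fun w l' =>
      w = ((agdStep G ε L (momentum L σ))^[T] (y₁, y₁)).1 ∧ ‖G w‖ ≤ ε ∧
        ∃ j ≤ T, l' = { l with agdSteps := l.agdSteps + j, grads := l.grads + (2 * j + 1) } := by
  have hL0 : 0 < L := hσ0.trans_le hσL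
  have hgrad : gradient g = G := gradient_eq hg
  obtain ⟨p, hp⟩ := exists_minimizer hσ0 hg hσ
  set s := Real.sqrt (L / σ) with hs
  have hs1 : 1 ≤ s := Real.one_le_sqrt.2 ((one_le_div hσ0).2 hσL)
  have hLs : L = σ * s ^ 2 := by
    rw [hs, Real.sq_sqrt (by positivity)]; field_simp
  have hq : 0 ≤ 1 - 1 / s := by rw [sub_nonneg, div_le_one (by linarith)]; exact hs1
  set step := agdStep G ε L (momentum L σ) with hstep
  refine terminates_loop (fun n q l' => ∃ j, n + j = T ∧
      agdPotential g σ s p q.1 q.2 ≤ (1 - 1 / s) ^ j * (‖G y₁‖ ^ 2 / σ) ∧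
      step^[n] q = step^[T] (y₁, y₁) ∧
      l' = { l with agdSteps := l.agdSteps + j, grads := l.grads + 2 * j }) ?_ T (y₁, y₁) l
      ⟨0, rfl, by simpa using agdPotential_self_le hσ0 hg hσ hp y₁, rfl, rfl⟩
  rintro n q l' ⟨j, hj, hV, hiter, rfl⟩
  simp only [terminates_bind, terminates_evalGrad, hgrad]
  refine terminates_ite (fun hdone => ?_) fun hdone => ?_
  · rw [terminates_pure]
    have hfix : Function.IsFixedPt step q := by
      rw [Function.IsFixedPt, hstep, agdStep, if_pos hdone]
    refine ⟨?_, hdone, j, by omega, ?_⟩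
    · rw [← hiter, hfix.iterate n]
    · simp; ring
  · simp only [terminates_bind, terminates_evalGrad, terminates_modify, terminates_pure,
      Sum.elim_inr, hgrad]
    have hnext : step q = (q.2 - (1 / L) • G q.2,
        (1 + momentum L σ) • (q.2 - (1 / L) • G q.2) - momentum L σ • q.1) := by
      rw [hstep, agdStep, if_neg hdone]
    have hn : n ≠ 0 := by
      rintro rfl
      rw [zero_add] at hj
      subst hj
      have h1 := norm_gradient_sq_le_agdPotential (s := s) hL0 hσ0 hg hL hp q.1 q.2
      have h2 : ‖G q.1‖ ^ 2 ≤ ε ^ 2 :=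
        h1.trans ((mul_le_mul_of_nonneg_left hV (by positivity)).trans hT)
      exact hdone (abs_le_of_sq_le_sq' h2 hε).2
    obtain ⟨k, rfl⟩ := Nat.exists_eq_succ_of_ne_zero hn
    refine ⟨k, rfl, j + 1, by omega, ?_, ?_, ?_⟩
    · have h1 := agdPotential_step_le hσ0 hs1 hLs hg hL hσ p q.1 q.2
      rw [pow_succ', mul_assoc]
      exact h1.trans (mul_le_mul_of_nonneg_left hV hq)
    · rw [← hiter, Function.iterate_succ_apply, hnext]
      rfl
    · simp only [Log.mk.injEq, true_and, and_true]
      constructor <;> ring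

variable {f : E d → ℝ} {L₁ L₂ : ℝ}

/-- The gradient tolerance for the inner problems of Almost-Convex-AGD, called with the
parameters of NCG-B1. -/
noncomputable def innerTol (L₁ ε₁ ε₂ : ℝ) : ℝ :=
  ε₁ / 2 * Real.sqrt (3 * ε₂ / (50 * (5 * L₁ + 2 * (3 * ε₂))))

/-- One pass of Almost-Convex-AGD, called with the parameters of NCG-B1 and centre `c`, where the
inner iteration is stopped after at most `T` steps. -/
noncomputable def acStep (f : E d → ℝ) (L₁ L₂ ε₁ ε₂ : ℝ) (T : ℕ) (c z : E d) : E d :=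
  if ‖regGrad f L₁ (ε₂ / L₂) c z‖ ≤ ε₁ / 2 then z
  else ((agdStep (proxGrad f L₁ (ε₂ / L₂) (3 * ε₂) c z) (innerTol L₁ ε₁ ε₂) (5 * L₁)
    (momentum (5 * L₁) (3 * ε₂)))^[T] (z, z)).1

lemma le_regularized (hL₁ : 0 < L₁) (ε₂ : ℝ) (c x : E d) : f x ≤ regularized f L₁ L₂ ε₂ c x := by
  rw [regularized]
  have : 0 ≤ L₁ * (max (‖x - c‖ - ε₂ / L₂) 0) ^ 2 := by positivity
  linarith

lemma regularized_self (hL₂ : 0 < L₂) {ε₂ : ℝ} (hε₂ : 0 < ε₂) (c : E d) :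
    regularized f L₁ L₂ ε₂ c c = f c := by
  have : 0 < ε₂ / L₂ := div_pos hε₂ hL₂
  simp [regularized, this.le]

/-- The inductive step in the proof of `(∑ aᵢ)² ≤ n ∑ aᵢ²`. -/
lemma add_sq_le_of_sq_le {n S a r : ℝ} (hn : 0 ≤ n) (hS : 0 ≤ S) (h : r ^ 2 ≤ n * S) :
    (a + r) ^ 2 ≤ (n + 1) * (S + a ^ 2) := by
  have h1 : 2 * (a * r) ≤ S + n * a ^ 2 := by
    have h4 : (a * r) ^ 2 ≤ S * (n * a ^ 2) := by
      rw [mul_pow]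
      have := mul_le_mul_of_nonneg_left h (sq_nonneg a)
      linarith
    have h5 : 0 ≤ n * a ^ 2 := by positivity
    have h6 : (2 * (a * r)) ^ 2 ≤ (S + n * a ^ 2) ^ 2 := by
      have := sq_nonneg (S - n * a ^ 2)
      linarith
    exact (abs_le_of_sq_le_sq' h6 (by positivity)).2
  linarith

/-- Almost-Convex-AGD, called with the parameters of NCG-B1. In the conclusion, `n` is the number
of passes, `S` is the sum of the squared lengths of their displacements, and `η` is a lower bound
for the length of a displacement other than the last one. -/
lemma almostConvexAGD_terminates (hf : SmoothObjective f L₁ L₂) (hL₁ : 0 < L₁) (hL₂ : 0 < L₂)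
    {ε₁ ε₂ : ℝ} (hε₁ : 0 < ε₁) (hε₂ : 0 < ε₂) (hε₂L : ε₂ ≤ L₁ / 3) {Δ m : ℝ}
    (hm : ∀ x, m ≤ f x) {c : E d} (hcm : f c - m ≤ Δ)
    (hc : ∀ u, -ε₂ * ‖u‖ ^ 2 ≤ ⟪u, hessian f c u⟫) {T T' : ℕ}
    (hT : 2 * (5 * L₁) * ((1 - 1 / Real.sqrt (5 * L₁ / (3 * ε₂))) ^ T *
      (10 * L₁ * Δ / (3 * ε₂))) ≤ innerTol L₁ ε₁ ε₂ ^ 2)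
    {η : ℝ} (hη : η = 9 / 10 * (ε₁ / 2) / (2 * (3 * ε₂)))
    (hT' : Δ < 3 * ε₂ * (T' * η ^ 2)) (l : Log d) :
    Terminates (almostConvexAGD (regularized f L₁ L₂ ε₂ c) c (ε₁ / 2) (3 * ε₂) (5 * L₁)) l
      fun w l' => w = (acStep f L₁ L₂ ε₁ ε₂ T c)^[T'] c ∧
        ‖regGrad f L₁ (ε₂ / L₂) c w‖ ≤ ε₁ / 2 ∧
        ∃ (n : ℕ) (S : ℝ), 0 ≤ S ∧ 3 * ε₂ * S ≤ f c - regularized f L₁ L₂ ε₂ c w ∧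
          ‖w - c‖ ^ 2 ≤ n * S ∧ (n - 1) * η ^ 2 ≤ S ∧
          l'.ncgSteps = l.ncgSteps ∧ l'.hvps = l.hvps ∧
          l'.agdSteps ≤ l.agdSteps + n * T ∧ l'.grads ≤ l.grads + n * (2 * T + 2) + 1 := by
  have hρ : 0 < ε₂ / L₂ := div_pos hε₂ hL₂
  have hη0 : 0 < η := by rw [hη]; positivity
  have hgrad : gradient (regularized f L₁ L₂ ε₂ c) = regGrad f L₁ (ε₂ / L₂) c :=
    gradient_eq fun x => hf.hasGradientAt_regularized hL₂ hε₂ c x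
  have htol : 0 ≤ innerTol L₁ ε₁ ε₂ := by rw [innerTol]; positivity
  have hσL : 3 * ε₂ ≤ 5 * L₁ := by linarith
  have hself := regularized_self (f := f) (L₁ := L₁) hL₂ hε₂ c
  have hmreg : ∀ x, m ≤ regularized f L₁ L₂ ε₂ c x := fun x =>
    (hm x).trans (le_regularized hL₁ ε₂ c x)
  set h := regularized f L₁ L₂ ε₂ c with hh
  set step := acStep f L₁ L₂ ε₁ ε₂ T c with hstep
  refine terminates_loop (fun k z l' => ∃ (n : ℕ) (S : ℝ), k + n = T' ∧ 0 ≤ S ∧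
      3 * ε₂ * S ≤ f c - h z ∧ ‖z - c‖ ^ 2 ≤ n * S ∧ (n - 1) * η ^ 2 ≤ S ∧
      (ε₁ / 2 < ‖regGrad f L₁ (ε₂ / L₂) c z‖ → n * η ^ 2 ≤ S) ∧
      step^[k] z = step^[T'] c ∧ l'.ncgSteps = l.ncgSteps ∧ l'.hvps = l.hvps ∧
      l'.agdSteps ≤ l.agdSteps + n * T ∧ l'.grads ≤ l.grads + n * (2 * T + 2))
      ?_ T' c l ⟨0, 0, by simp, le_rfl, by simp [hself], by simp, by simp; positivity, by simp,
        rfl, rfl, rfl, by simp, by simp⟩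
  rintro k z l' ⟨n, S, hkn, hS, hdec, hdist, hlow, hlow', hiter, e1, e2, e3, e4⟩
  simp only [terminates_bind, terminates_evalGrad, hgrad]
  refine terminates_ite (fun hdone => ?_) fun hdone => ?_
  · rw [terminates_pure]
    have hfix : Function.IsFixedPt step z := by
      rw [Function.IsFixedPt, hstep, acStep, if_pos hdone]
    refine ⟨?_, hdone, n, S, hS, hdec, hdist, hlow, e1, e2, e3, ?_⟩
    · rw [← hiter, hfix.iterate k]
    · simp only; omega
  · rw [not_le] at hdone
    have hSn := hlow' hdone
    have hhz : h z - m ≤ Δ := by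
      have : 0 ≤ 3 * ε₂ * S := by positivity
      linarith
    have hk : k ≠ 0 := by
      rintro rfl
      rw [zero_add] at hkn
      subst hkn
      have h1 : 3 * ε₂ * (n * η ^ 2) ≤ 3 * ε₂ * S :=
        mul_le_mul_of_nonneg_left hSn (by positivity)
      linarith [hmreg z]
    obtain ⟨k, rfl⟩ := Nat.exists_eq_succ_of_ne_zero hk
    have hg := hf.hasGradientAt_prox hL₂ hε₂ (3 * ε₂) c z
    have hlip := hf.proxGrad_lipschitz hL₁ hρ (by linarith : 0 < 3 * ε₂) (by linarith) c z
    have hmono := hf.proxGrad_strongly_monotone hL₁ hL₂ hε₂ hc z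
    have hGz : ‖proxGrad f L₁ (ε₂ / L₂) (3 * ε₂) c z z‖ ^ 2 ≤ 10 * L₁ * Δ := by
      have h1 := norm_gradient_sq_le (m := m) (by linarith : 0 < 5 * L₁) hg hlip
        (fun x => by have := hmreg x; have : 0 ≤ 3 * ε₂ * ‖x - z‖ ^ 2 := by positivity
                     linarith) z
      simp only [sub_self, norm_zero, ne_eq, OfNat.ofNat_ne_zero, not_false_eq_true, zero_pow,
        mul_zero, add_zero] at h1
      refine h1.trans ?_
      rw [show 2 * (5 * L₁) * (h z - m) = 10 * L₁ * (h z - m) by ring]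
      exact mul_le_mul_of_nonneg_left hhz (by positivity)
    have hq : 0 ≤ 1 - 1 / Real.sqrt (5 * L₁ / (3 * ε₂)) := by
      have : 1 ≤ Real.sqrt (5 * L₁ / (3 * ε₂)) :=
        Real.one_le_sqrt.2 ((one_le_div (by linarith)).2 hσL)
      rw [sub_nonneg, div_le_one (by linarith)]
      exact this
    have hTz : 2 * (5 * L₁) * ((1 - 1 / Real.sqrt (5 * L₁ / (3 * ε₂))) ^ T *
        (‖proxGrad f L₁ (ε₂ / L₂) (3 * ε₂) c z z‖ ^ 2 / (3 * ε₂))) ≤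
        innerTol L₁ ε₁ ε₂ ^ 2 := by
      refine le_trans ?_ hT
      gcongr
    rw [terminates_bind]
    refine (agd_terminates (by linarith) hσL htol hg hlip hmono z hTz _).mono ?_
    rintro w l'' ⟨hw, hGw, j, hj, rfl⟩
    rw [terminates_pure, Sum.elim_inr]
    obtain ⟨p1, p2⟩ := prox_step (by linarith : 0 < 3 * ε₂) (by linarith : 0 < 5 * L₁)
      (by linarith : 0 < ε₁ / 2) hg hlip hmono hdone hGw
    have hstepz : step z = w := by
      rw [hstep, acStep, if_neg (not_le.2 hdone), hw]
    refine ⟨k, rfl, n + 1, S + ‖w - z‖ ^ 2, by omega, by positivity, by linarith, ?_, ?_, ?_, ?_,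
      e1, e2, ?_, ?_⟩
    · -- Cauchy-Schwarz for the displacements
      have h1 : ‖w - c‖ ≤ ‖w - z‖ + ‖z - c‖ := by
        have := norm_add_le (w - z) (z - c); rwa [sub_add_sub_cancel] at this
      have h2 : ‖w - c‖ ^ 2 ≤ (‖w - z‖ + ‖z - c‖) ^ 2 :=
        pow_le_pow_left₀ (norm_nonneg _) h1 2
      have h3 := h2.trans (add_sq_le_of_sq_le (Nat.cast_nonneg n) hS hdist)
      push_cast
      exact h3
    · push_cast
      have : 0 ≤ ‖w - z‖ ^ 2 := sq_nonneg _
      linarith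
    · intro hw2
      have h1 := p2 hw2
      have h2 : η ≤ ‖w - z‖ := by
        rw [hη, div_le_iff₀ (by positivity)]
        linarith
      have h3 : η ^ 2 ≤ ‖w - z‖ ^ 2 := pow_le_pow_left₀ hη0.le h2 2
      push_cast
      linarith
    · rw [← hiter, Function.iterate_succ_apply, hstepz]
    · simp only
      have : (n + 1) * T = n * T + T := by ring
      omega
    · simp only
      have : (n + 1) * (2 * T + 2) = n * (2 * T + 2) + (2 * T + 2) := by ring
      omega

/-- Almost-Convex-AGD does not increase the objective, makes few passes unless the objective
decreases much, and either finds a point with small gradient of `f` itself, or makes progress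
because it leaves the ball in which the regularizer vanishes. -/
lemma almostConvexAGD_progress (hf : SmoothObjective f L₁ L₂) (hL₁ : 0 < L₁) (hL₂ : 0 < L₂)
    {ε₁ ε₂ : ℝ} (hε₁ : 0 < ε₁) (hε₂ : 0 < ε₂) (hε₂L : ε₂ ≤ L₁ / 3) {Δ m : ℝ}
    (hm : ∀ x, m ≤ f x) {c : E d} (hcm : f c - m ≤ Δ)
    (hc : ∀ u, -ε₂ * ‖u‖ ^ 2 ≤ ⟪u, hessian f c u⟫) {T T' : ℕ}
    (hT : 2 * (5 * L₁) * ((1 - 1 / Real.sqrt (5 * L₁ / (3 * ε₂))) ^ T *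
      (10 * L₁ * Δ / (3 * ε₂))) ≤ innerTol L₁ ε₁ ε₂ ^ 2)
    (hT' : 60 * ε₂ * Δ < ε₁ ^ 2 * T') (l : Log d) :
    Terminates (almostConvexAGD (regularized f L₁ L₂ ε₂ c) c (ε₁ / 2) (3 * ε₂) (5 * L₁)) l
      fun w l' => w = (acStep f L₁ L₂ ε₁ ε₂ T c)^[T'] c ∧ f w ≤ f c ∧
        (ε₁ < ‖gradient f w‖ →
          min (3 * ε₂ ^ 3 / L₂ ^ 2) (ε₁ * ε₂ / (2 * Real.sqrt 10 * L₂)) ≤ f c - f w) ∧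
        ∃ n : ℕ, n ≤ 1 + 60 * ε₂ / ε₁ ^ 2 * (f c - f w) ∧
          l'.ncgSteps = l.ncgSteps ∧ l'.hvps = l.hvps ∧
          l'.agdSteps ≤ l.agdSteps + n * T ∧ l'.grads ≤ l.grads + n * (2 * T + 2) + 1 := by
  set η := 9 / 10 * (ε₁ / 2) / (2 * (3 * ε₂)) with hη
  have hη2 : 3 * ε₂ * η ^ 2 = 27 / 1600 * (ε₁ ^ 2 / ε₂) := by
    rw [hη]; field_simp; norm_num
  have hη3 : ε₁ ^ 2 / (60 * ε₂) ≤ 3 * ε₂ * η ^ 2 := by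
    rw [hη2]
    have : ε₁ ^ 2 / (60 * ε₂) = 1 / 60 * (ε₁ ^ 2 / ε₂) := by field_simp
    rw [this]
    have : 0 ≤ ε₁ ^ 2 / ε₂ := by positivity
    linarith
  have hT2 : Δ < 3 * ε₂ * (T' * η ^ 2) := by
    have h1 : Δ < ε₁ ^ 2 / (60 * ε₂) * T' := by
      rw [div_mul_eq_mul_div, lt_div_iff₀ (by positivity)]
      linarith
    have h2 := mul_le_mul_of_nonneg_right hη3 (Nat.cast_nonneg (α := ℝ) T')
    linarith
  refine (almostConvexAGD_terminates hf hL₁ hL₂ hε₁ hε₂ hε₂L hm hcm hc hT hη hT2 l).mono ?_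
  rintro w l' ⟨hw, hgw, n, S, hS, hdec, hdist, hlow, hlog⟩
  have hreg := le_regularized (f := f) (L₂ := L₂) hL₁ ε₂ c w
  have hD : 3 * ε₂ * S ≤ f c - f w := by linarith
  have hSD : 0 ≤ 3 * ε₂ * S := by positivity
  refine ⟨hw, by linarith, fun hgrad => ?_, n, ?_, hlog⟩
  · have hρ : 0 < ε₂ / L₂ := div_pos hε₂ hL₂
    -- the regularizer is active at `w`, so `w` is outside the ball of radius `ε₂ / L₂`
    have hfar : ε₂ / L₂ ≤ ‖w - c‖ := by
      by_contra hcon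
      rw [not_le] at hcon
      have h0 : (w - c) - ballProj (ε₂ / L₂) (w - c) = 0 := by
        rw [← norm_eq_zero, norm_sub_ballProj hρ, max_eq_right (by linarith)]
      rw [regGrad, h0, smul_zero, add_zero] at hgw
      linarith
    have hSr : (ε₂ / L₂) ^ 2 ≤ n * S := (pow_le_pow_left₀ hρ.le hfar 2).trans hdist
    have hn0 : n ≠ 0 := by
      rintro rfl
      have : 0 < (ε₂ / L₂) ^ 2 := by positivity
      rw [Nat.cast_zero, zero_mul] at hSr
      linarith
    by_cases hn1 : n = 1
    · refine (min_le_left _ _).trans (le_trans ?_ hD)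
      rw [hn1, Nat.cast_one, one_mul] at hSr
      calc 3 * ε₂ ^ 3 / L₂ ^ 2 = 3 * ε₂ * (ε₂ / L₂) ^ 2 := by field_simp
        _ ≤ 3 * ε₂ * S := by gcongr
    · refine (min_le_right _ _).trans (le_trans ?_ hD)
      have hn2 : (2 : ℝ) ≤ n := by exact_mod_cast (by omega : 2 ≤ n)
      have hη0 : 0 < η := by rw [hη]; positivity
      -- the geometric mean of the two lower bounds for `S`
      have h1 : (ε₂ / L₂) ^ 2 * η ^ 2 ≤ 2 * S ^ 2 := by
        have h3 : n / 2 * η ^ 2 ≤ S :=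
          (mul_le_mul_of_nonneg_right (by linarith) (sq_nonneg η)).trans hlow
        have h4 := mul_le_mul_of_nonneg_left h3 hS
        nlinarith [mul_le_mul_of_nonneg_right hSr (sq_nonneg η)]
      have h10 : (0 : ℝ) < Real.sqrt 10 := Real.sqrt_pos.2 (by norm_num)
      have h10' : Real.sqrt 10 ^ 2 = 10 := Real.sq_sqrt (by norm_num)
      have hX : ε₁ * ε₂ / (2 * Real.sqrt 10 * L₂) =
          ε₂ / L₂ * (ε₁ / (2 * Real.sqrt 10)) := by field_simp
      rw [hX]
      refine (abs_le_of_sq_le_sq' ?_ hSD).2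
      have h2 : (ε₂ / L₂ * (ε₁ / (2 * Real.sqrt 10))) ^ 2 = (ε₂ / L₂) ^ 2 * (ε₁ ^ 2 / 40) := by
        rw [mul_pow (ε₂ / L₂), div_pow ε₁, mul_pow 2, h10']; ring
      rw [h2, mul_pow]
      have h5 : ε₁ ^ 2 / 40 ≤ (3 * ε₂) ^ 2 * η ^ 2 / 2 := by
        have : (3 * ε₂) ^ 2 * η ^ 2 = 81 / 1600 * ε₁ ^ 2 := by
          rw [hη]; field_simp; norm_num
        rw [this]
        nlinarith [sq_nonneg ε₁]
      have h6 : (ε₂ / L₂) ^ 2 * (ε₁ ^ 2 / 40) ≤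
          (ε₂ / L₂) ^ 2 * ((3 * ε₂) ^ 2 * η ^ 2 / 2) := by gcongr
      have h7 := mul_le_mul_of_nonneg_left h1 (sq_nonneg (3 * ε₂))
      linarith
  · have h1 : ((n : ℝ) - 1) * (ε₁ ^ 2 / (60 * ε₂)) ≤ f c - f w := by
      rcases le_or_gt (n : ℝ) 1 with h | h
      · have : ((n : ℝ) - 1) * (ε₁ ^ 2 / (60 * ε₂)) ≤ 0 :=
          mul_nonpos_of_nonpos_of_nonneg (by linarith) (by positivity)
        linarith
      · have h2 := mul_le_mul_of_nonneg_left hη3 (by linarith : 0 ≤ (n : ℝ) - 1)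
        have h3 := mul_le_mul_of_nonneg_left hlow (by positivity : 0 ≤ 3 * ε₂)
        linarith
    have h2 : 60 * ε₂ / ε₁ ^ 2 * (((n : ℝ) - 1) * (ε₁ ^ 2 / (60 * ε₂))) = n - 1 := by
      field_simp
    have h3 := mul_le_mul_of_nonneg_left h1 (by positivity : 0 ≤ 60 * ε₂ / ε₁ ^ 2)
    linarith

end RunAGD


/-! ### Runs of the negative curvature method -/

section RunNCG

variable {d : ℕ} {f : E d → ℝ} {L₁ L₂ : ℝ}

/-- The operator `L₁ I - ∇² f(x)` whose largest eigenvalue is approximated. -/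
noncomputable def shiftedHessian (f : E d → ℝ) (L₁ : ℝ) (x : E d) : E d →L[ℝ] E d :=
  L₁ • ContinuousLinearMap.id ℝ (E d) - hessian f x

lemma shiftedHessian_apply (x q : E d) : shiftedHessian f L₁ x q = L₁ • q - hessian f x q := by
  simp [shiftedHessian]

lemma lanczosRun_terminates (x : E d) (m : ℕ) (p q : E d) (β : ℝ) (l : Log d) :
    Terminates (lanczosRun f L₁ x m p q β) l fun t l' =>
      t = lanczosList (shiftedHessian f L₁ x) m (p, q, β) ∧
      l' = { l with hvps := l.hvps + lanczosLen (shiftedHessian f L₁ x) m (p, q, β) } := by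
  induction m generalizing p q β l with
  | zero =>
    rw [lanczosRun, terminates_pure]
    exact ⟨rfl, rfl⟩
  | succ m ih =>
    rw [lanczosRun]
    refine terminates_ite (fun hq => ?_) fun hq => ?_
    · rw [terminates_pure]
      simp [lanczosList, lanczosLen, hq]
    · simp only [terminates_bind, terminates_evalHvp]
      refine (ih _ _ _ _).mono ?_
      rintro t l' ⟨rfl, rfl⟩
      rw [terminates_pure, lanczosList_succ _ _ hq, lanczosLen, if_neg hq]
      simp only [lanczosTriple, lanczosNext, shiftedHessian_apply, true_and]
      rw [Log.mk.injEq]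
      exact ⟨rfl, rfl, rfl, by ring⟩

/-- The vector that an NCG step at `x` computes by the Lanczos method started at `b`, for the
tolerance `ε₂` and the failure probability `δ`. -/
noncomputable def ncgVec (f : E d → ℝ) (L₁ ε₂ δ : ℝ) (x b : E d) : E d :=
  ritzVector (lanczosList (shiftedHessian f L₁ x)
    (lanczosSteps d L₁ (max ε₂ ‖gradient f x‖ / 2) δ) (0, b, 0))

open Classical in
/-- The point to which an NCG step moves from `x`, if the Lanczos method returns `v`. -/
noncomputable def ncgNext (f : E d → ℝ) (L₁ L₂ : ℝ) (x v : E d) : E d :=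
  if ⟪v, hessian f x v⟫ < 0 ∧
      2 * |⟪v, hessian f x v⟫| ^ 3 / (3 * L₂ ^ 2) > ‖gradient f x‖ ^ 2 / (2 * L₁) then
    x - (2 * |⟪v, hessian f x v⟫| / L₂ * sgn ⟪v, gradient f x⟫) • v
  else x - (1 / L₁) • gradient f x

lemma ncg_terminates (ω : ℕ → E d) (x : E d) (ε₂ δ : ℝ) (l : Log d) :
    Terminates (ncg f L₁ L₂ ω x (max ε₂ ‖gradient f x‖ / 2) δ) l fun r l' =>
      r = (ncgNext f L₁ L₂ x (ncgVec f L₁ ε₂ δ x (ω l.ncgSteps.length)),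
        ncgVec f L₁ ε₂ δ x (ω l.ncgSteps.length)) ∧
      ∃ n ≤ lanczosSteps d L₁ (max ε₂ ‖gradient f x‖ / 2) δ,
        l' = { l with grads := l.grads + 1, hvps := l.hvps + n + 1 } := by
  simp only [ncg, lanczos, terminates_bind, terminates_get]
  refine (lanczosRun_terminates x _ _ _ _ _).mono ?_
  rintro t l' ⟨rfl, rfl⟩
  simp only [terminates_pure, terminates_evalHvp, terminates_evalGrad]
  set v := ncgVec f L₁ ε₂ δ x (ω l.ncgSteps.length) with hv
  have hv' : ritzVector (lanczosList (shiftedHessian f L₁ x)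
    (lanczosSteps d L₁ (max ε₂ ‖gradient f x‖ / 2) δ) (0, ω l.ncgSteps.length, 0)) = v := rfl
  rw [hv']
  refine terminates_ite (fun h => ?_) fun h => ?_
  · rw [terminates_pure]
    exact ⟨by rw [ncgNext, if_pos h], _, lanczosLen_le _ _ _, rfl⟩
  · rw [terminates_pure]
    exact ⟨by rw [ncgNext, if_neg h], _, lanczosLen_le _ _ _, rfl⟩

/-- The test for returning from NCG-A1. -/
def Accepts (f : E d → ℝ) (ε₁ ε₂ : ℝ) (x v : E d) : Prop :=
  ⟪v, hessian f x v⟫ > -ε₂ / 2 ∧ ‖gradient f x‖ ≤ ε₁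

/-- The Lanczos method started at `b` succeeds at `x`: the curvature along the computed vector
exceeds the smallest curvature by at most the prescribed accuracy. -/
def GoodStart (f : E d → ℝ) (L₁ ε₂ δ : ℝ) (x b : E d) : Prop :=
  ∀ u, (⟪ncgVec f L₁ ε₂ δ x b, hessian f x (ncgVec f L₁ ε₂ δ x b)⟫ -
    max ε₂ ‖gradient f x‖ / 2) * ‖u‖ ^ 2 ≤ ⟪u, hessian f x u⟫

lemma ncgVec_eq_zero_or (ε₂ δ : ℝ) (x b : E d) :
    ncgVec f L₁ ε₂ δ x b = 0 ∨ ‖ncgVec f L₁ ε₂ δ x b‖ = 1 := by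
  rw [ncgVec, ritzVector_lanczosList]
  set y := ritzSum (shiftedHessian f L₁ x) b _
  rcases eq_or_ne y 0 with h | h
  · left; rw [h, smul_zero]
  · right; rw [norm_smul, norm_inv, norm_norm, inv_mul_cancel₀ (norm_ne_zero_iff.2 h)]

/-- An NCG step from a point that is not accepted decreases the objective. -/
lemma ncgNext_le (hf : SmoothObjective f L₁ L₂) (hL₁ : 0 < L₁) (hL₂ : 0 < L₂) {ε₁ ε₂ η : ℝ}
    (hε₁ : 0 ≤ ε₁) (hε₂ : 0 < ε₂) (h1 : η ≤ ε₂ ^ 3 / (12 * L₂ ^ 2)) (h2 : η ≤ ε₁ ^ 2 / (2 * L₁))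
    {x v : E d} (hv : v = 0 ∨ ‖v‖ = 1) (hacc : ¬ Accepts f ε₁ ε₂ x v) :
    f (ncgNext f L₁ L₂ x v) ≤ f x - η := by
  have hgrad := gradient_step_le hL₁ hf.hasGradientAt hf.gradient_lipschitz x
  have hbig : ⟪v, hessian f x v⟫ ≤ -ε₂ / 2 →
      η ≤ 2 * |⟪v, hessian f x v⟫| ^ 3 / (3 * L₂ ^ 2) := by
    intro hc
    have h3 : ε₂ / 2 ≤ |⟪v, hessian f x v⟫| := by
      rw [abs_of_nonpos (by linarith)]; linarith
    refine h1.trans ?_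
    have h4 := pow_le_pow_left₀ (by positivity) h3 3
    calc ε₂ ^ 3 / (12 * L₂ ^ 2) = 2 * (ε₂ / 2) ^ 3 / (3 * L₂ ^ 2) := by field_simp; norm_num
      _ ≤ _ := by gcongr
  have hg : ¬ ‖gradient f x‖ ≤ ε₁ → η ≤ ‖gradient f x‖ ^ 2 / (2 * L₁) := by
    intro hg
    refine h2.trans ?_
    have := pow_le_pow_left₀ hε₁ (not_le.1 hg).le 2
    gcongr
  rw [Accepts, not_and_or, not_lt] at hacc
  rw [ncgNext]
  split_ifs with h
  · have hv1 : ‖v‖ = 1 := hv.resolve_left fun h0 => by simp [h0] at h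
    refine (hf.curvature_step_le hL₂ hv1 h.1).trans ?_
    rcases hacc with hacc | hacc
    · linarith [hbig hacc]
    · linarith [hg hacc, h.2]
  · refine hgrad.trans ?_
    rcases hacc with hacc | hacc
    · rw [not_and] at h
      have := h (by linarith)
      rw [not_lt] at this
      linarith [hbig hacc]
    · linarith [hg hacc]

lemma Accepts.hessian_ge {ε₁ ε₂ δ : ℝ} {x b : E d} (hε : ε₁ ≤ ε₂)
    (h : Accepts f ε₁ ε₂ x (ncgVec f L₁ ε₂ δ x b)) (hgood : GoodStart f L₁ ε₂ δ x b) (u : E d) :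
    -ε₂ * ‖u‖ ^ 2 ≤ ⟪u, hessian f x u⟫ := by
  refine le_trans (mul_le_mul_of_nonneg_right ?_ (sq_nonneg _)) (hgood u)
  have h1 := h.1
  rw [max_eq_left (h.2.trans hε)]
  linarith

/-- The bounds for the work done in an NCG step. -/
def StepRecord.IsCheap (f : E d → ℝ) (L₁ ε₂ δ B : ℝ) (s : StepRecord d) : Prop :=
  s.grads = 2 ∧ s.hvps ≤ lanczosSteps d L₁ (max ε₂ ‖gradient f s.point‖ / 2) δ + 2 ∧ f s.point ≤ B

/-- A run of NCG-A1 that starts at the `i`-th term of a sequence `X` follows this sequence, and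
returns the first accepted term, provided that the Lanczos method succeeds in all steps with
indices less than `N` and that the objective allows for less than `N` steps. In the conclusion,
`r` is the number of steps that do not return. -/
lemma ncgA1_terminates (hf : SmoothObjective f L₁ L₂) (hL₁ : 0 < L₁) (hL₂ : 0 < L₂)
    {ε₁ ε₂ η δ δ' Δ m : ℝ}
    (hε₁ : 0 ≤ ε₁) (hε₂ : 0 < ε₂) (hη : 0 < η) (h1 : η ≤ ε₂ ^ 3 / (12 * L₂ ^ 2))
    (h2 : η ≤ ε₁ ^ 2 / (2 * L₁))
    (hδ' : δ' = δ / (1 + max (12 * L₂ ^ 2 / ε₂ ^ 3) (2 * L₁ / ε₁ ^ 2) * Δ))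
    (hm : ∀ x, m ≤ f x) {ω X : ℕ → E d} {N H : ℕ}
    (hX : ∀ i, ¬ Accepts f ε₁ ε₂ (X i) (ncgVec f L₁ ε₂ δ' (X i) (ω i)) →
      X (i + 1) = ncgNext f L₁ L₂ (X i) (ncgVec f L₁ ε₂ δ' (X i) (ω i)))
    (hgood : ∀ i < N, GoodStart f L₁ ε₂ δ' (X i) (ω i))
    (hH : ∀ x, lanczosSteps d L₁ (max ε₂ ‖gradient f x‖ / 2) δ' + 2 ≤ H)
    {x : E d} {l : Log d} (hx : x = X l.ncgSteps.length)
    (hN : l.ncgSteps.length + (f x - m) / η < N) :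
    Terminates (ncgA1 f L₁ L₂ Δ ω x ε₁ ε₂ δ) l fun w l' => ∃ (r : ℕ) (recs : List (StepRecord d)),
      l'.ncgSteps = l.ncgSteps ++ recs ∧ recs.length = r + 1 ∧
      (∀ s ∈ recs, s.IsCheap f L₁ ε₂ δ' (f x)) ∧ f w ≤ f x - r * η ∧ (r = 0 → w = x) ∧
      w = X (l.ncgSteps.length + r) ∧
      Accepts f ε₁ ε₂ w (ncgVec f L₁ ε₂ δ' w (ω (l.ncgSteps.length + r))) ∧
      GoodStart f L₁ ε₂ δ' w (ω (l.ncgSteps.length + r)) ∧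
      l'.agdSteps = l.agdSteps ∧ l'.grads = l.grads + 2 * (r + 1) ∧
      l'.hvps ≤ l.hvps + (r + 1) * H := by
  refine terminates_loop (fun k y l' => ∃ (r : ℕ) (recs : List (StepRecord d)),
      l'.ncgSteps = l.ncgSteps ++ recs ∧ recs.length = r ∧
      (∀ s ∈ recs, s.IsCheap f L₁ ε₂ δ' (f x)) ∧ f y ≤ f x - r * η ∧ (r = 0 → y = x) ∧
      y = X (l.ncgSteps.length + r) ∧ l'.agdSteps = l.agdSteps ∧
      l'.grads = l.grads + 2 * r ∧ l'.hvps ≤ l.hvps + r * H ∧ f y - m ≤ k * η) ?_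
    ⌈(f x - m) / η⌉₊ x l ⟨0, [], by simp, rfl, by simp, by simp, fun _ => rfl, hx, rfl, rfl,
      by simp, by rw [← div_le_iff₀ hη]; exact Nat.le_ceil _⟩
  rintro k y l' ⟨r, recs, e1, e2, hrecs, hfy, hr0, hy, e3, e4, e5, hk⟩
  have hlen : l'.ncgSteps.length = l.ncgSteps.length + r := by rw [e1, List.length_append, e2]
  have hrN : l.ncgSteps.length + r < N := by
    have h3 : (r : ℝ) ≤ (f x - m) / η := by
      rw [le_div_iff₀ hη]; linarith [hm y]
    have : ((l.ncgSteps.length + r : ℕ) : ℝ) < N := by push_cast; linarith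
    exact_mod_cast this
  simp only [terminates_bind, terminates_get, terminates_evalGrad]
  rw [← hδ']
  refine (ncg_terminates ω y ε₂ δ' _).mono ?_
  rintro ⟨y', v⟩ l'' ⟨hyv, n, hn, rfl⟩
  rw [Prod.mk.injEq] at hyv
  obtain ⟨hy', hv⟩ := hyv
  rw [hlen] at hy' hv
  rw [← hv] at hy'
  simp only [terminates_evalHvp, terminates_modify]
  have hrec : ∀ s ∈ recs ++ [(⟨y, l'.grads + 1 + 1 - l'.grads, l'.hvps + n + 1 + 1 - l'.hvps⟩ :
      StepRecord d)], s.IsCheap f L₁ ε₂ δ' (f x) := by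
    intro s hs
    rcases List.mem_append.1 hs with hs | hs
    · exact hrecs s hs
    · rw [List.mem_singleton.1 hs]
      refine ⟨by simp only; omega, by simp only; omega, ?_⟩
      have : 0 ≤ r * η := by positivity
      simp only
      linarith
  have hHy := hH y
  have hhv : l'.hvps + n + 1 + 1 ≤ l.hvps + (r + 1) * H := by
    have : (r + 1) * H = r * H + H := by ring
    omega
  refine terminates_ite (fun hacc => ?_) fun hacc => ?_
  · rw [terminates_pure, Sum.elim_inl]
    have hacc' : Accepts f ε₁ ε₂ y (ncgVec f L₁ ε₂ δ' y (ω (l.ncgSteps.length + r))) := by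
      rw [← hv]; exact hacc
    refine ⟨r, _, ?_, ?_, hrec, hfy, hr0, hy, hacc', ?_, e3, ?_, hhv⟩
    · simp only; rw [e1, List.append_assoc]
    · rw [List.length_append, e2]; rfl
    · rw [hy]; exact hgood _ hrN
    · simp only; omega
  · rw [terminates_pure, Sum.elim_inr]
    have hdec := ncgNext_le hf hL₁ hL₂ hε₁ hε₂ h1 h2
      (hv ▸ ncgVec_eq_zero_or (f := f) (L₁ := L₁) ε₂ δ' y (ω (l.ncgSteps.length + r))) hacc
    rw [← hy'] at hdec
    have hk0 : k ≠ 0 := by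
      rintro rfl
      rw [Nat.cast_zero, zero_mul] at hk
      linarith [hm y']
    obtain ⟨k, rfl⟩ := Nat.exists_eq_succ_of_ne_zero hk0
    push_cast at hk
    refine ⟨k, rfl, r + 1, _, ?_, ?_, hrec, ?_, by simp, ?_, e3, ?_, hhv, ?_⟩
    · simp only; rw [e1, List.append_assoc]
    · rw [List.length_append, e2]; rfl
    · push_cast; linarith
    · rw [← add_assoc, hX _ (by rw [← hy, ← hv]; exact hacc), ← hy, ← hv, hy']
    · simp only; omega
    · linarith

open Classical in
/-- The map that takes the point of one NCG step and its starting vector to the point of the next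
one. If the point is accepted, then the next point is the result of Almost-Convex-AGD, with at
most `T'` passes of at most `T` gradient steps each. -/
noncomputable def nextPoint (f : E d → ℝ) (L₁ L₂ ε₁ ε₂ δ : ℝ) (T T' : ℕ) (x b : E d) : E d :=
  if Accepts f (ε₂ ^ (3 / 2 : ℝ)) ε₂ x (ncgVec f L₁ ε₂ δ x b) then
    (acStep f L₁ L₂ ε₁ ε₂ T x)^[T'] x
  else ncgNext f L₁ L₂ x (ncgVec f L₁ ε₂ δ x b)

/-- The point of the `i`-th NCG step, as a function of the starting vectors. -/
noncomputable def stepPoint (f : E d → ℝ) (L₁ L₂ ε₁ ε₂ δ : ℝ) (T T' : ℕ) (x₀ : E d)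
    (ω : ℕ → E d) : ℕ → E d
  | 0 => x₀
  | i + 1 => nextPoint f L₁ L₂ ε₁ ε₂ δ T T' (stepPoint f L₁ L₂ ε₁ ε₂ δ T T' x₀ ω i) (ω i)

/-- The bounds for a complete run of NCG-B1, on the event that the Lanczos method succeeds in the
first `N` NCG steps. Here `η` is the decrease of the objective in an NCG step that does not
return, and `p` is the decrease in an outer iteration. -/
theorem ncgB1_terminates (hf : SmoothObjective f L₁ L₂) (hL₁ : 0 < L₁) (hL₂ : 0 < L₂)
    {ε₁ ε₂ η p δ δ' Δ : ℝ} {x₀ : E d} (hΔ : ∀ x, f x₀ - f x ≤ Δ)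
    (hε₁ : 0 < ε₁) (hε₂ : 0 < ε₂) (hε₂1 : ε₂ ≤ 1) (hε₂L : ε₂ ≤ L₁ / 3)
    (hη : 0 < η) (h1 : η ≤ ε₂ ^ 3 / (12 * L₂ ^ 2)) (h2 : η ≤ ε₂ ^ 3 / (2 * L₁))
    (hp : 0 < p) (hpη : p ≤ η)
    (hp2 : p ≤ min (3 * ε₂ ^ 3 / L₂ ^ 2) (ε₁ * ε₂ / (2 * Real.sqrt 10 * L₂)))
    {K : ℕ} (hK : K = outerBound L₁ L₂ Δ ε₁ ε₂) (hpK : 1 + Δ / p ≤ K)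
    (hδ' : δ' = δ / K / (1 + max (12 * L₂ ^ 2 / ε₂ ^ 3)
      (2 * L₁ / (ε₂ ^ (3 / 2 : ℝ)) ^ 2) * Δ))
    {T T' : ℕ}
    (hT : 2 * (5 * L₁) * ((1 - 1 / Real.sqrt (5 * L₁ / (3 * ε₂))) ^ T *
      (10 * L₁ * Δ / (3 * ε₂))) ≤ innerTol L₁ ε₁ ε₂ ^ 2)
    (hT' : 60 * ε₂ * Δ < ε₁ ^ 2 * T') {ω : ℕ → E d} {N H : ℕ} (hN : K - 1 + Δ / η < N)
    (hgood : ∀ i < N,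
      GoodStart f L₁ ε₂ δ' (stepPoint f L₁ L₂ ε₁ ε₂ δ' T T' x₀ ω i) (ω i))
    (hH : ∀ x, lanczosSteps d L₁ (max ε₂ ‖gradient f x‖ / 2) δ' + 2 ≤ H) :
    Terminates (ncgB1 f L₁ L₂ Δ ω x₀ ε₁ ε₂ δ) (Log.empty d) fun z l =>
      ‖gradient f z‖ ≤ ε₁ ∧ (∀ u, -ε₂ * ‖u‖ ^ 2 ≤ ⟪u, hessian f z u⟫) ∧
      (l.ncgSteps.length : ℝ) ≤ K + Δ / η ∧
      (l.agdSteps : ℝ) ≤ T * (K + 60 * ε₂ / ε₁ ^ 2 * Δ) ∧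
      (l.grads : ℝ) ≤ 2 * l.ncgSteps.length + 2 * K + (2 * T + 2) * (K + 60 * ε₂ / ε₁ ^ 2 * Δ) ∧
      l.hvps ≤ l.ncgSteps.length * H ∧ ∀ s ∈ l.ncgSteps, s.IsCheap f L₁ ε₂ δ' (f x₀) := by
  set X := stepPoint f L₁ L₂ ε₁ ε₂ δ' T T' x₀ ω with hX
  have hsucc : ∀ i, X (i + 1) = nextPoint f L₁ L₂ ε₁ ε₂ δ' T T' (X i) (ω i) := fun i => rfl
  set θ := 60 * ε₂ / ε₁ ^ 2 with hθ
  have hθ0 : 0 ≤ θ := by positivity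
  have hm : ∀ x, f x₀ - Δ ≤ f x := fun x => by linarith [hΔ x]
  have hpow : (ε₂ ^ (3 / 2 : ℝ)) ^ 2 = ε₂ ^ 3 := by
    rw [← Real.rpow_natCast, ← Real.rpow_mul hε₂.le, ← Real.rpow_natCast]; norm_num
  have hpow1 : ε₂ ^ (3 / 2 : ℝ) ≤ ε₂ := by
    conv_rhs => rw [← Real.rpow_one ε₂]
    exact Real.rpow_le_rpow_of_exponent_ge hε₂ hε₂1 (by norm_num)
  have hpow0 : 0 ≤ ε₂ ^ (3 / 2 : ℝ) := by positivity
  have hΔ0 : 0 ≤ Δ := by have := hΔ x₀; linarith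
  have hK1 : 1 ≤ K := by
    have : (1 : ℝ) ≤ K := le_trans (by have : 0 ≤ Δ / p := by positivity
                                       linarith) hpK
    exact_mod_cast this
  refine terminates_loop (fun k x l => ∃ o R : ℕ, k + o + 1 = K ∧
      l.ncgSteps.length = o + R ∧ f x ≤ f x₀ - R * η ∧ f x ≤ f x₀ - (o - 1) * p ∧
      (ε₁ < ‖gradient f x‖ → f x ≤ f x₀ - o * p) ∧ x = X l.ncgSteps.length ∧
      (l.agdSteps : ℝ) ≤ T * (o + θ * (f x₀ - f x)) ∧
      (l.grads : ℝ) ≤ 2 * l.ncgSteps.length + 2 * o + (2 * T + 2) * (o + θ * (f x₀ - f x)) ∧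
      l.hvps ≤ l.ncgSteps.length * H ∧ ∀ s ∈ l.ncgSteps, s.IsCheap f L₁ ε₂ δ' (f x₀)) ?_
    (K - 1) x₀ (Log.empty d) ⟨0, 0, by omega, rfl, by simp, by simp; positivity, by simp, rfl,
      by simp [Log.empty], by simp [Log.empty], by simp [Log.empty], by simp [Log.empty]⟩
  rintro k x l ⟨o, R, hko, hlen, hR, ho, ho', hx, hagd, hgr, hhv, hrecs⟩
  have hoK : (o : ℝ) ≤ K - 1 := by
    have : ((o + 1 : ℕ) : ℝ) ≤ K := by exact_mod_cast (by omega : o + 1 ≤ K)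
    push_cast at this; linarith
  have hlenN : l.ncgSteps.length + (f x - (f x₀ - Δ)) / η < N := by
    have h3 : (f x - (f x₀ - Δ)) / η ≤ Δ / η - R := by
      rw [div_le_iff₀ hη, sub_mul, div_mul_cancel₀ _ hη.ne']; linarith
    rw [hlen]; push_cast; linarith
  rw [terminates_bind, ← hK]
  refine (ncgA1_terminates hf hL₁ hL₂ hpow0 hε₂ hη h1 (by rwa [hpow]) hδ' hm
    (fun i hi => by rw [hsucc, nextPoint, if_neg hi]) hgood hH hx hlenN).mono ?_
  rintro w l' ⟨r, recs, e1, e2, hrecs', hfw, hr0, hw, hacc, hgw, e3, e4, e5⟩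
  have hcurv := hacc.hessian_ge hpow1 hgw
  have hfx0 : f x ≤ f x₀ := by
    have : 0 ≤ R * η := by positivity
    linarith
  have hrη : 0 ≤ r * η := by positivity
  have hlen' : l'.ncgSteps.length = o + R + r + 1 := by
    rw [e1, List.length_append, e2, hlen]; ring
  have hlenR : (l'.ncgSteps.length : ℝ) = l.ncgSteps.length + r + 1 := by
    rw [hlen', hlen]; push_cast; ring
  have hrecs2 : ∀ s ∈ l'.ncgSteps, s.IsCheap f L₁ ε₂ δ' (f x₀) := by
    intro s hs
    rw [e1] at hs
    rcases List.mem_append.1 hs with hs | hs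
    · exact hrecs s hs
    · exact ⟨(hrecs' s hs).1, (hrecs' s hs).2.1, (hrecs' s hs).2.2.trans hfx0⟩
  have hhv2 : l'.hvps ≤ l'.ncgSteps.length * H := by
    have e : l'.ncgSteps.length = l.ncgSteps.length + (r + 1) := by rw [hlen', hlen]; ring
    rw [e, add_mul]; omega
  have hθmono : θ * (f x₀ - f x) ≤ θ * (f x₀ - f w) :=
    mul_le_mul_of_nonneg_left (by linarith) hθ0
  have hgr' : (l'.grads : ℝ) = l.grads + 2 * (r + 1) := by rw [e4]; push_cast; ring
  have hagd' : (l'.agdSteps : ℝ) ≤ T * (o + θ * (f x₀ - f w)) := by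
    rw [e3]
    exact hagd.trans (mul_le_mul_of_nonneg_left (by linarith) (Nat.cast_nonneg T))
  have hgr2 : (l'.grads : ℝ) ≤ 2 * l'.ncgSteps.length + 2 * o +
      (2 * T + 2) * (o + θ * (f x₀ - f w)) := by
    have : (2 * (T : ℝ) + 2) * (o + θ * (f x₀ - f x)) ≤
        (2 * T + 2) * (o + θ * (f x₀ - f w)) :=
      mul_le_mul_of_nonneg_left (by linarith) (by positivity)
    rw [hgr', hlenR]; linarith
  simp only [terminates_bind, terminates_evalGrad]
  refine terminates_ite (fun hdone => ?_) fun hdone => ?_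
  · rw [terminates_pure, Sum.elim_inl]
    have h3 : θ * (f x₀ - f w) ≤ θ * Δ := mul_le_mul_of_nonneg_left (hΔ w) hθ0
    refine ⟨hdone, hcurv, ?_, ?_, ?_, hhv2, hrecs2⟩
    · have h4 : ((R : ℝ) + r) ≤ Δ / η := by
        rw [le_div_iff₀ hη]; linarith [hΔ w]
      simp only
      rw [hlen']; push_cast; linarith
    · exact hagd'.trans (mul_le_mul_of_nonneg_left (by linarith) (Nat.cast_nonneg T))
    · simp only
      push_cast
      have h5 : (2 * (T : ℝ) + 2) * (o + θ * (f x₀ - f w)) ≤ (2 * T + 2) * (K - 1 + θ * Δ) :=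
        mul_le_mul_of_nonneg_left (by linarith) (by positivity)
      have h6 : (0 : ℝ) ≤ T := Nat.cast_nonneg T
      linarith
  · rw [not_le] at hdone
    -- the decrease achieved since the previous outer iteration
    have hfo : f w ≤ f x₀ - o * p := by
      rcases Nat.eq_zero_or_pos r with h | h
      · have := hr0 h
        rw [this] at hdone ⊢
        exact ho' hdone
      · have h3 : η ≤ r * η := by
          have : (1 : ℝ) ≤ r := by exact_mod_cast h
          exact le_mul_of_one_le_left hη.le this
        linarith
    -- `w` is not a minimizer, so another outer iteration is allowed
    have hk0 : k ≠ 0 := by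
      rintro rfl
      have h3 := norm_gradient_sq_le hL₁ hf.hasGradientAt hf.gradient_lipschitz hm w
      have h4 : 0 < ‖gradient f w‖ ^ 2 := by
        have := hε₁.trans hdone
        positivity
      have h5 : 0 < f w - (f x₀ - Δ) := by
        by_contra hcon
        have : 2 * L₁ * (f w - (f x₀ - Δ)) ≤ 0 :=
          mul_nonpos_of_nonneg_of_nonpos (by positivity) (not_lt.1 hcon)
        linarith
      have h6 : (o : ℝ) < Δ / p := by
        rw [lt_div_iff₀ hp]; linarith
      have h7 : ((0 + o + 1 : ℕ) : ℝ) = K := by exact_mod_cast hko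
      push_cast at h7
      linarith
    obtain ⟨k, rfl⟩ := Nat.exists_eq_succ_of_ne_zero hk0
    have hcm : f w - (f x₀ - Δ) ≤ Δ := by linarith
    rw [terminates_bind]
    refine (almostConvexAGD_progress hf hL₁ hL₂ hε₁ hε₂ hε₂L hm hcm hcurv hT hT' _).mono ?_
    rintro x' l'' ⟨hx', hfx', hprog, n, hn, g1, g2, g3, g4⟩
    rw [terminates_pure, Sum.elim_inr]
    simp only at g1 g2 g3 g4
    have hn' : (n : ℝ) ≤ 1 + θ * (f w - f x') := hn
    refine ⟨k, rfl, o + 1, R + r, by omega, ?_, ?_, ?_, ?_, ?_, ?_, ?_, ?_, ?_⟩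
    · rw [g1, hlen']; ring
    · push_cast; linarith
    · push_cast; linarith
    · intro hgx
      have := hp2.trans (hprog hgx)
      push_cast; linarith
    · have e : l'.ncgSteps.length = l.ncgSteps.length + r + 1 := by rw [hlen', hlen]
      rw [g1, e, hsucc, ← hw, nextPoint, if_pos hacc, hx']
    · have h3 : (l''.agdSteps : ℝ) ≤ l'.agdSteps + n * T := by exact_mod_cast g3
      have h4 : (n : ℝ) * T ≤ (1 + θ * (f w - f x')) * T :=
        mul_le_mul_of_nonneg_right hn' (Nat.cast_nonneg T)
      push_cast
      linarith
    · have h3 : (l''.grads : ℝ) ≤ l'.grads + 1 + n * (2 * T + 2) + 1 := by exact_mod_cast g4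
      have h4 : (n : ℝ) * (2 * T + 2) ≤ (1 + θ * (f w - f x')) * (2 * T + 2) :=
        mul_le_mul_of_nonneg_right hn' (by positivity)
      rw [g1]
      push_cast
      linarith
    · rw [g1, g2]; exact hhv2
    · rw [g1]; exact hrecs2

end RunNCG


/-! ### Failure probability of the Lanczos method -/

section Failure

variable {d : ℕ} {f : E d → ℝ} {L₁ L₂ : ℝ}

lemma SmoothObjective.shiftedHessian_symm (hf : SmoothObjective f L₁ L₂) (x u v : E d) :
    ⟪shiftedHessian f L₁ x u, v⟫ = ⟪u, shiftedHessian f L₁ x v⟫ := by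
  rw [shiftedHessian_apply, shiftedHessian_apply, inner_sub_left, inner_sub_right,
    inner_smul_left, inner_smul_right, hf.hessian_symm]
  simp

lemma inner_shiftedHessian (x u : E d) :
    ⟪u, shiftedHessian f L₁ x u⟫ = L₁ * ‖u‖ ^ 2 - ⟪u, hessian f x u⟫ := by
  rw [shiftedHessian_apply, inner_sub_right, inner_smul_right, real_inner_self_eq_norm_sq]

lemma SmoothObjective.abs_inner_hessian_le (hf : SmoothObjective f L₁ L₂) (hL₁ : 0 ≤ L₁)
    (x u : E d) : |⟪u, hessian f x u⟫| ≤ L₁ * ‖u‖ ^ 2 := by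
  refine (abs_real_inner_le_norm _ _).trans ?_
  have h1 := (hessian f x).le_of_opNorm_le (hf.norm_hessian_le hL₁ x) u
  calc ‖u‖ * ‖hessian f x u‖ ≤ ‖u‖ * (L₁ * ‖u‖) := by gcongr
    _ = L₁ * ‖u‖ ^ 2 := by ring

/-- The number of Lanczos steps is chosen such that the exponential in the
Kuczyński–Woźniakowski bound is at most `δ / (4d)`. -/
lemma exp_lanczosSteps_le (hd : 1 ≤ d) (hL₁ : 0 < L₁) {ε δ : ℝ} (hε : 0 < ε) (hδ : 0 < δ)
    (hδ1 : δ ≤ 1) :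
    Real.exp (-((2 * (lanczosSteps d L₁ ε δ : ℝ) - 1) * Real.sqrt (ε / (2 * L₁)))) ≤
      δ / (4 * d) := by
  have hd0 : (1 : ℝ) ≤ d := by exact_mod_cast hd
  set ℓ := Real.log (4 * d / δ) with hℓ
  have hℓ0 : 0 ≤ ℓ := Real.log_nonneg (by rw [le_div_iff₀ hδ]; linarith)
  have hexp : Real.exp (-ℓ) = δ / (4 * d) := by
    rw [Real.exp_neg, hℓ, Real.exp_log (by positivity), inv_div]
  rw [← hexp, Real.exp_le_exp, neg_le_neg_iff]
  have hm : 1 + Real.sqrt L₁ / Real.sqrt ε * ℓ ≤ lanczosSteps d L₁ ε δ := by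
    rw [lanczosSteps]; push_cast
    linarith [Nat.le_ceil (Real.sqrt L₁ / Real.sqrt ε * ℓ)]
  have hs1 : 0 < Real.sqrt L₁ := Real.sqrt_pos.2 hL₁
  have hs2 : 0 < Real.sqrt ε := Real.sqrt_pos.2 hε
  have hs3 : 0 < Real.sqrt 2 := Real.sqrt_pos.2 two_pos
  have h2 : Real.sqrt 2 ≤ 2 := by
    rw [Real.sqrt_le_iff]; norm_num
  have hsq : Real.sqrt (ε / (2 * L₁)) = Real.sqrt ε / (Real.sqrt 2 * Real.sqrt L₁) := by
    rw [Real.sqrt_div hε.le, Real.sqrt_mul two_pos.le]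
  rw [hsq]
  calc ℓ ≤ 2 / Real.sqrt 2 * ℓ := by
        refine le_mul_of_one_le_left hℓ0 ?_
        rwa [one_le_div hs3]
    _ = 2 * (Real.sqrt L₁ / Real.sqrt ε * ℓ) * (Real.sqrt ε / (Real.sqrt 2 * Real.sqrt L₁)) := by
        field_simp
    _ ≤ _ := by
        refine mul_le_mul_of_nonneg_right ?_ (by positivity)
        linarith

/-- The Lanczos method fails with probability at most `δ` for a uniformly distributed starting
vector. -/
theorem uniformSphere_not_goodStart_le (hd : 1 ≤ d) (hf : SmoothObjective f L₁ L₂)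
    (hL₁ : 0 < L₁) {ε₂ δ : ℝ} (hε₂ : 0 < ε₂) (hδ : 0 < δ) (hδ1 : δ ≤ 1) (x : E d) :
    uniformSphere d {b | ¬ GoodStart f L₁ ε₂ δ x b} ≤ ENNReal.ofReal δ := by
  set ε := max ε₂ ‖gradient f x‖ / 2 with hε
  have hε0 : 0 < ε := half_pos (lt_max_of_lt_left hε₂)
  set m := lanczosSteps d L₁ ε δ with hm
  have hm0 : 0 < m := by rw [hm, lanczosSteps]; omega
  have habs := hf.abs_inner_hessian_le hL₁.le x
  obtain ⟨u, hu, h⟩ := exists_lanczos_good_or_inner_le (Λ := 2 * L₁) hd (hf.shiftedHessian_symm x)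
    (fun u => by rw [inner_shiftedHessian]; linarith [le_of_abs_le (habs u)])
    (fun u => by rw [inner_shiftedHessian]; linarith [neg_le_of_abs_le (habs u)]) hε0 hm0
  set t := 2 * Real.exp (-((2 * (m : ℝ) - 1) * Real.sqrt (ε / (2 * L₁)))) with ht
  have ht0 : 0 < t := by positivity
  have hd0 : (1 : ℝ) ≤ d := by exact_mod_cast hd
  have htδ : 2 * d * t ≤ δ := by
    have h1 := exp_lanczosSteps_le hd hL₁ hε0 hδ hδ1
    calc 2 * d * t = 4 * d * Real.exp (-((2 * (m : ℝ) - 1) * Real.sqrt (ε / (2 * L₁)))) := by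
          rw [ht]; ring
      _ ≤ 4 * d * (δ / (4 * d)) := by gcongr
      _ = δ := by field_simp
  have hsub : {b | ¬ GoodStart f L₁ ε₂ δ x b} ⊆ {b | ‖b‖ ≠ 1} ∪ {b | |⟪u, b⟫| ≤ t} := by
    intro b hb
    by_cases hb1 : ‖b‖ = 1
    · right
      set v := ncgVec f L₁ ε₂ δ x b with hv
      refine (h b v hb1 hv).resolve_left fun hgood => hb fun y => ?_
      have h1 := hgood y
      have hv1 := (ritzVector_spec (hf.shiftedHessian_symm x) hb1 hm0 hv).1
      rw [inner_shiftedHessian, inner_shiftedHessian, hv1] at h1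
      rw [← hv, ← hε]
      linarith
    · left; exact hb1
  calc uniformSphere d {b | ¬ GoodStart f L₁ ε₂ δ x b}
      ≤ uniformSphere d ({b | ‖b‖ ≠ 1} ∪ {b | |⟪u, b⟫| ≤ t}) := measure_mono hsub
    _ ≤ uniformSphere d {b | ‖b‖ ≠ 1} + uniformSphere d {b | |⟪u, b⟫| ≤ t} :=
        measure_union_le _ _
    _ ≤ 0 + ENNReal.ofReal (2 * d * t) :=
        add_le_add uniformSphere_norm_ne_one.le (uniformSphere_abs_inner_le hd hu ht0)
    _ ≤ ENNReal.ofReal δ := by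
        rw [zero_add]; exact ENNReal.ofReal_le_ofReal htδ

end Failure

/-! ### Measurability of the iterates -/

section Measurability

variable {Ω : Type*} [MeasurableSpace Ω] {d : ℕ} {f : E d → ℝ} {L₁ L₂ : ℝ}

lemma measurable_apply_nat {β : Type*} [MeasurableSpace β] {F : ℕ → Ω → β} {n : Ω → ℕ}
    (hF : ∀ k, Measurable (F k)) (hn : Measurable n) : Measurable fun ω => F (n ω) ω :=
  (measurable_from_prod_countable_left (f := fun p : Ω × ℕ => F p.2 p.1) hF).comp
    (measurable_id.prodMk hn)

/-- The sublevel sets of the largest eigenvalue are cut out by the inequalities for the quadratic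
form at countably many vectors. -/
lemma measurable_lambdaMax {n : ℕ} {T : Ω → Matrix (Fin n) (Fin n) ℝ}
    (hT : ∀ i j, Measurable fun ω => T ω i j) (hsymm : ∀ ω, (T ω).IsSymm) :
    Measurable fun ω => lambdaMax (T ω) := by
  rcases Nat.eq_zero_or_pos n with rfl | hn
  · have : (fun ω => lambdaMax (T ω)) = fun _ => lambdaMax (0 : Matrix (Fin 0) (Fin 0) ℝ) := by
      funext ω
      rw [Subsingleton.elim (T ω) 0]
    rw [this]; exact measurable_const
  · refine measurable_of_Iic fun r => ?_
    have : (fun ω => lambdaMax (T ω)) ⁻¹' Set.Iic r =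
        ⋂ k : ℕ, {ω | TopologicalSpace.denseSeq (Fin n → ℝ) k ⬝ᵥ
          (T ω).mulVec (TopologicalSpace.denseSeq (Fin n → ℝ) k) ≤
          r * (TopologicalSpace.denseSeq (Fin n → ℝ) k ⬝ᵥ
            TopologicalSpace.denseSeq (Fin n → ℝ) k)} := by
      ext ω
      obtain ⟨⟨s, hs0, hs⟩, hmax⟩ := lambdaMax_spec hn (hsymm ω)
      have hpos : ∀ s : Fin n → ℝ, 0 ≤ s ⬝ᵥ s := fun s =>
        Finset.sum_nonneg fun i _ => mul_self_nonneg _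
      simp only [Set.mem_preimage, Set.mem_Iic, Set.mem_iInter, Set.mem_ofPred_eq]
      constructor
      · intro h k
        exact (hmax _).trans (mul_le_mul_of_nonneg_right h (hpos _))
      · intro h
        have hall : ∀ s : Fin n → ℝ, s ⬝ᵥ (T ω).mulVec s ≤ r * (s ⬝ᵥ s) := by
          have hc : IsClosed {s : Fin n → ℝ | s ⬝ᵥ (T ω).mulVec s ≤ r * (s ⬝ᵥ s)} :=
            isClosed_le (by fun_prop) (by fun_prop)
          intro s
          exact hc.closure_subset_iff.2 (Set.range_subset_iff.2 h)
            (TopologicalSpace.denseRange_denseSeq (Fin n → ℝ) s)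
        have h1 := hall s
        rw [hs, dotProduct_smul, smul_eq_mul] at h1
        refine le_of_mul_le_mul_right h1 ((hpos s).lt_of_ne fun h0 => hs0 ?_)
        exact dotProduct_self_eq_zero.1 h0.symm
    rw [this]
    refine MeasurableSet.iInter fun k => measurableSet_le ?_ measurable_const
    simp only [dotProduct, Matrix.mulVec]
    exact Finset.measurable_sum _ fun i _ => (Finset.measurable_sum _ fun j _ =>
      (hT i j).mul_const _).const_mul _

lemma measurable_eigCoeff {a β : Ω → ℕ → ℝ} {θ : Ω → ℝ} (ha : ∀ i, Measurable fun ω => a ω i)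
    (hβ : ∀ i, Measurable fun ω => β ω i) (hθ : Measurable θ) (i : ℕ) :
    Measurable fun ω => eigCoeff (a ω) (β ω) (θ ω) i := by
  induction i using Nat.strong_induction_on with
  | _ i ih =>
  match i with
  | 0 => simp only [eigCoeff]; exact measurable_const
  | 1 => simp only [eigCoeff]; exact (hθ.sub (ha 0)).div (hβ 1)
  | i + 2 =>
    simp only [eigCoeff]
    exact (((hθ.sub (ha _)).mul (ih (i + 1) (by omega))).sub
      ((hβ _).mul (ih i (by omega)))).div (hβ _)

lemma measurable_const_smul {g : Ω → E d} (hg : Measurable g) (c : ℝ) :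
    Measurable fun ω => c • g ω := hg.const_smul c

lemma SmoothObjective.measurable_hessian_apply (hf : SmoothObjective f L₁ L₂) {x q : Ω → E d}
    (hx : Measurable x) (hq : Measurable q) : Measurable fun ω => hessian f (x ω) (q ω) := by
  have : Continuous fun p : E d × E d => hessian f p.1 p.2 :=
    (hf.continuous_hessian.comp continuous_fst).clm_apply continuous_snd
  exact this.measurable.comp (hx.prodMk hq)

lemma SmoothObjective.measurable_gradient (hf : SmoothObjective f L₁ L₂) :
    Measurable (gradient f) := hf.continuous_gradient.measurable

lemma SmoothObjective.measurable_shiftedHessian_apply (hf : SmoothObjective f L₁ L₂)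
    {x q : Ω → E d} (hx : Measurable x) (hq : Measurable q) :
    Measurable fun ω => shiftedHessian f L₁ (x ω) (q ω) := by
  simp only [shiftedHessian_apply]
  exact (hq.const_smul L₁).sub (hf.measurable_hessian_apply hx hq)

lemma SmoothObjective.measurable_lanczosNext (hf : SmoothObjective f L₁ L₂) {x : Ω → E d}
    {s : Ω → E d × E d × ℝ} (hx : Measurable x) (hs : Measurable s) :
    Measurable fun ω => lanczosNext (shiftedHessian f L₁ (x ω)) (s ω) := by
  have h1 : Measurable fun ω => (s ω).2.1 := hs.snd.fst
  have hA := hf.measurable_shiftedHessian_apply hx h1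
  have ha : Measurable fun ω => ⟪(s ω).2.1, shiftedHessian f L₁ (x ω) (s ω).2.1⟫ :=
    h1.inner hA
  have hβ : Measurable fun ω => (s ω).2.2 • (s ω).1 := Measurable.smul hs.snd.snd hs.fst
  have hq : Measurable fun ω =>
      ⟪(s ω).2.1, shiftedHessian f L₁ (x ω) (s ω).2.1⟫ • (s ω).2.1 := Measurable.smul ha h1
  generalize hw' : (fun ω => shiftedHessian f L₁ (x ω) (s ω).2.1 -
      ⟪(s ω).2.1, shiftedHessian f L₁ (x ω) (s ω).2.1⟫ • (s ω).2.1 - (s ω).2.2 • (s ω).1) = w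
  have hw : Measurable w := hw' ▸ (hA.sub hq).sub hβ
  have heq : (fun ω => lanczosNext (shiftedHessian f L₁ (x ω)) (s ω)) =
      fun ω => ((s ω).2.1, ‖w ω‖⁻¹ • w ω, ‖w ω‖) := by
    subst hw'; rfl
  rw [heq]
  exact h1.prodMk ((Measurable.smul hw.norm.inv hw).prodMk hw.norm)

lemma SmoothObjective.measurable_lanczosSeq (hf : SmoothObjective f L₁ L₂) {x b : Ω → E d}
    (hx : Measurable x) (hb : Measurable b) (i : ℕ) :
    Measurable fun ω => lanczosSeq (shiftedHessian f L₁ (x ω)) (b ω) i := by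
  induction i with
  | zero => exact measurable_const.prodMk (hb.prodMk measurable_const)
  | succ i ih =>
    simp only [lanczosSeq_succ]
    exact hf.measurable_lanczosNext hx ih

lemma SmoothObjective.measurable_lanczosLen (hf : SmoothObjective f L₁ L₂) {x : Ω → E d}
    {s : Ω → E d × E d × ℝ} (hx : Measurable x) (hs : Measurable s) (m : ℕ) :
    Measurable fun ω => lanczosLen (shiftedHessian f L₁ (x ω)) m (s ω) := by
  induction m generalizing s with
  | zero => simp only [lanczosLen]; exact measurable_const
  | succ m ih =>
    simp only [lanczosLen]
    exact Measurable.ite (measurableSet_eq_fun hs.snd.fst measurable_const) measurable_const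
      ((ih (hf.measurable_lanczosNext hx hs)).add_const 1)

lemma SmoothObjective.measurable_ritzSum (hf : SmoothObjective f L₁ L₂) {x b : Ω → E d}
    (hx : Measurable x) (hb : Measurable b) (n : ℕ) :
    Measurable fun ω => ritzSum (shiftedHessian f L₁ (x ω)) (b ω) n := by
  have hq : ∀ i, Measurable fun ω => (lanczosSeq (shiftedHessian f L₁ (x ω)) (b ω) i).2.1 :=
    fun i => (hf.measurable_lanczosSeq hx hb i).snd.fst
  have hβ : ∀ i, Measurable fun ω => (lanczosSeq (shiftedHessian f L₁ (x ω)) (b ω) i).2.2 :=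
    fun i => (hf.measurable_lanczosSeq hx hb i).snd.snd
  have ha : ∀ i, Measurable fun ω => ⟪(lanczosSeq (shiftedHessian f L₁ (x ω)) (b ω) i).2.1,
      shiftedHessian f L₁ (x ω) (lanczosSeq (shiftedHessian f L₁ (x ω)) (b ω) i).2.1⟫ :=
    fun i => (hq i).inner (hf.measurable_shiftedHessian_apply hx (hq i))
  simp only [ritzSum]
  refine Finset.measurable_sum _ fun i _ => Measurable.smul (measurable_eigCoeff ha hβ ?_ i) (hq i)
  refine measurable_lambdaMax (fun i j => ?_) fun ω => tridiag_isSymm _ _ _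
  simp only [tridiag, Matrix.of_apply]
  split_ifs
  · exact ha _
  · exact hβ _
  · exact hβ _
  · exact measurable_const

lemma measurable_lanczosSteps {ε : Ω → ℝ} (hε : Measurable ε) (δ : ℝ) :
    Measurable fun ω => lanczosSteps d L₁ (ε ω) δ := by
  simp only [lanczosSteps]
  exact (Nat.measurable_ceil.comp ((hε.sqrt.const_div _).mul_const _)).const_add 1

lemma SmoothObjective.measurable_ncgVec (hf : SmoothObjective f L₁ L₂) (ε₂ δ : ℝ)
    {x b : Ω → E d} (hx : Measurable x) (hb : Measurable b) :
    Measurable fun ω => ncgVec f L₁ ε₂ δ (x ω) (b ω) := by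
  simp only [ncgVec, ritzVector_lanczosList]
  have hsteps : Measurable fun ω => lanczosSteps d L₁ (max ε₂ ‖gradient f (x ω)‖ / 2) δ :=
    measurable_lanczosSteps
      ((measurable_const.max (hf.measurable_gradient.comp hx).norm).div_const 2) δ
  have hs : Measurable fun ω => ((0, b ω, 0) : E d × E d × ℝ) :=
    measurable_const.prodMk (hb.prodMk measurable_const)
  have hlen : Measurable fun ω => lanczosLen (shiftedHessian f L₁ (x ω))
      (lanczosSteps d L₁ (max ε₂ ‖gradient f (x ω)‖ / 2) δ) (0, b ω, 0) :=
    measurable_apply_nat (F := fun m ω => lanczosLen (shiftedHessian f L₁ (x ω)) m (0, b ω, 0))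
      (fun m => hf.measurable_lanczosLen hx hs m) hsteps
  have hy := measurable_apply_nat
    (F := fun n ω => ritzSum (shiftedHessian f L₁ (x ω)) (b ω) n)
    (fun n => hf.measurable_ritzSum hx hb n) hlen
  exact hy.norm.inv.smul hy

lemma measurable_sgn : Measurable sgn := by
  unfold sgn
  exact Measurable.ite measurableSet_Iio measurable_const measurable_const

lemma SmoothObjective.measurable_ncgNext (hf : SmoothObjective f L₁ L₂) {x v : Ω → E d}
    (hx : Measurable x) (hv : Measurable v) :
    Measurable fun ω => ncgNext f L₁ L₂ (x ω) (v ω) := by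
  have hc : Measurable fun ω => ⟪v ω, hessian f (x ω) (v ω)⟫ :=
    hv.inner (hf.measurable_hessian_apply hx hv)
  have hg : Measurable fun ω => gradient f (x ω) := hf.measurable_gradient.comp hx
  have habs : Measurable fun ω => |⟪v ω, hessian f (x ω) (v ω)⟫| := hc.abs
  simp only [ncgNext]
  refine Measurable.ite ?_ ?_ (hx.sub (measurable_const_smul hg _))
  · exact (measurableSet_lt hc measurable_const).inter (measurableSet_lt
      ((hg.norm.pow_const 2).div_const _) (((habs.pow_const 3).const_mul 2).div_const _))
  · exact hx.sub ((((habs.const_mul 2).div_const L₂).mul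
      (measurable_sgn.comp (hv.inner hg))).smul hv)

lemma SmoothObjective.measurable_regGrad (hf : SmoothObjective f L₁ L₂) {ρ : ℝ} (hρ : 0 < ρ)
    {c x : Ω → E d} (hc : Measurable c) (hx : Measurable x) :
    Measurable fun ω => regGrad f L₁ ρ (c ω) (x ω) := by
  simp only [regGrad]
  have h : Measurable fun ω => x ω - c ω := hx.sub hc
  have h2 : Measurable fun ω => x ω - c ω - ballProj ρ (x ω - c ω) :=
    h.sub ((continuous_ballProj hρ).measurable.comp h)
  exact (hf.measurable_gradient.comp hx).add (measurable_const_smul h2 _)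

lemma measurable_agdStep {G : Ω → E d → E d} (hG : ∀ x : Ω → E d, Measurable x →
    Measurable fun ω => G ω (x ω)) (ε L c : ℝ) {p : Ω → E d × E d} (hp : Measurable p) :
    Measurable fun ω => agdStep (G ω) ε L c (p ω) := by
  simp only [agdStep]
  refine Measurable.ite (measurableSet_le (hG _ hp.fst).norm measurable_const) hp ?_
  have h : Measurable fun ω => (p ω).2 - (1 / L) • G ω (p ω).2 :=
    hp.snd.sub (measurable_const_smul (hG _ hp.snd) _)
  exact h.prodMk ((measurable_const_smul h _).sub (measurable_const_smul hp.fst _))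

lemma SmoothObjective.measurable_acStep (hf : SmoothObjective f L₁ L₂) {ε₁ ε₂ : ℝ}
    (hρ : 0 < ε₂ / L₂) (T : ℕ) {c z : Ω → E d} (hc : Measurable c) (hz : Measurable z) :
    Measurable fun ω => acStep f L₁ L₂ ε₁ ε₂ T (c ω) (z ω) := by
  simp only [acStep]
  refine Measurable.ite (measurableSet_le (hf.measurable_regGrad hρ hc hz).norm
    measurable_const) hz ?_
  suffices h : Measurable fun ω =>
      (agdStep (proxGrad f L₁ (ε₂ / L₂) (3 * ε₂) (c ω) (z ω)) (innerTol L₁ ε₁ ε₂) (5 * L₁)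
        (momentum (5 * L₁) (3 * ε₂)))^[T] (z ω, z ω) from h.fst
  induction T with
  | zero => exact hz.prodMk hz
  | succ T ih =>
    simp only [Function.iterate_succ_apply']
    refine measurable_agdStep (G := fun ω => proxGrad f L₁ (ε₂ / L₂) (3 * ε₂) (c ω) (z ω))
      (fun x hx => ?_) _ _ _ ih
    simp only [proxGrad]
    exact (hf.measurable_regGrad hρ hc hx).add (measurable_const_smul (hx.sub hz) _)

lemma SmoothObjective.measurable_nextPoint (hf : SmoothObjective f L₁ L₂) {ε₁ ε₂ : ℝ}
    (hρ : 0 < ε₂ / L₂) (δ : ℝ) (T T' : ℕ) {x b : Ω → E d} (hx : Measurable x)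
    (hb : Measurable b) :
    Measurable fun ω => nextPoint f L₁ L₂ ε₁ ε₂ δ T T' (x ω) (b ω) := by
  have hv := hf.measurable_ncgVec ε₂ δ hx hb
  have hc := hv.inner (𝕜 := ℝ) (hf.measurable_hessian_apply hx hv)
  simp only [nextPoint]
  refine Measurable.ite ?_ ?_ (hf.measurable_ncgNext hx hv)
  · exact (measurableSet_lt measurable_const hc).inter
      (measurableSet_le (hf.measurable_gradient.comp hx).norm measurable_const)
  · induction T' with
    | zero => exact hx
    | succ T' ih =>
      simp only [Function.iterate_succ_apply']
      exact hf.measurable_acStep hρ T hx ih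

lemma SmoothObjective.measurableSet_goodStart (hf : SmoothObjective f L₁ L₂) (ε₂ δ : ℝ) :
    MeasurableSet {p : E d × E d | GoodStart f L₁ ε₂ δ p.1 p.2} := by
  have hv := hf.measurable_ncgVec ε₂ δ (measurable_fst (α := E d) (β := E d)) measurable_snd
  have hc := hv.inner (𝕜 := ℝ) (hf.measurable_hessian_apply measurable_fst hv)
  have hε : Measurable fun p : E d × E d => max ε₂ ‖gradient f p.1‖ / 2 :=
    (measurable_const.max (hf.measurable_gradient.comp measurable_fst).norm).div_const 2
  have : {p : E d × E d | GoodStart f L₁ ε₂ δ p.1 p.2} = ⋂ k : ℕ, {p : E d × E d |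
      (⟪ncgVec f L₁ ε₂ δ p.1 p.2, hessian f p.1 (ncgVec f L₁ ε₂ δ p.1 p.2)⟫ -
        max ε₂ ‖gradient f p.1‖ / 2) * ‖TopologicalSpace.denseSeq (E d) k‖ ^ 2 ≤
      ⟪TopologicalSpace.denseSeq (E d) k, hessian f p.1 (TopologicalSpace.denseSeq (E d) k)⟫} := by
    ext p
    simp only [Set.mem_iInter, Set.mem_ofPred_eq]
    refine ⟨fun h k => h _, fun h u => ?_⟩
    have hcl : IsClosed {u : E d |
        (⟪ncgVec f L₁ ε₂ δ p.1 p.2, hessian f p.1 (ncgVec f L₁ ε₂ δ p.1 p.2)⟫ -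
          max ε₂ ‖gradient f p.1‖ / 2) * ‖u‖ ^ 2 ≤ ⟪u, hessian f p.1 u⟫} :=
      isClosed_le (by fun_prop) (by fun_prop)
    exact hcl.closure_subset_iff.2 (Set.range_subset_iff.2 h)
      (TopologicalSpace.denseRange_denseSeq (E d) u)
  rw [this]
  exact MeasurableSet.iInter fun k => measurableSet_le ((hc.sub hε).mul_const _)
    (measurable_const.inner (𝕜 := ℝ) (hf.measurable_hessian_apply measurable_fst measurable_const))

/-- The point of the `i`-th NCG step depends measurably on the first `i` starting vectors. -/
lemma SmoothObjective.measurable_stepPoint (hf : SmoothObjective f L₁ L₂) {ε₁ ε₂ : ℝ}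
    (hρ : 0 < ε₂ / L₂) (δ : ℝ) (T T' : ℕ) (x₀ : E d) {b : ℕ → Ω → E d} (i : ℕ)
    (hb : ∀ j < i, Measurable (b j)) :
    Measurable fun ω => stepPoint f L₁ L₂ ε₁ ε₂ δ T T' x₀ (fun j => b j ω) i := by
  induction i with
  | zero => exact measurable_const
  | succ i ih =>
    exact hf.measurable_nextPoint hρ δ T T' (ih fun j hj => hb j (by omega)) (hb i (by omega))

/-- With independent starting vectors, the probability that the Lanczos method fails in one of the
first `N` NCG steps is at most `N δ`: the point of a step depends on the preceding starting
vectors only. -/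
theorem measure_exists_not_goodStart_le (hd : 1 ≤ d) (hf : SmoothObjective f L₁ L₂)
    (hL₁ : 0 < L₁) (hL₂ : 0 < L₂) {ε₁ ε₂ δ : ℝ} (hε₂ : 0 < ε₂) (hδ : 0 < δ) (hδ1 : δ ≤ 1)
    (T T' : ℕ) (x₀ : E d) (P : Measure Ω) [IsProbabilityMeasure P] {b : ℕ → Ω → E d}
    (hb : ∀ i, Measurable (b i)) (hmap : ∀ i, P.map (b i) = uniformSphere d)
    (hind : iIndepFun b P) (N : ℕ) :
    P {ω | ∃ i < N, ¬ GoodStart f L₁ ε₂ δ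
      (stepPoint f L₁ L₂ ε₁ ε₂ δ T T' x₀ (fun j => b j ω) i) (b i ω)} ≤
      N * ENNReal.ofReal δ := by
  set X : ℕ → Ω → E d := fun i ω => stepPoint f L₁ L₂ ε₁ ε₂ δ T T' x₀ (fun j => b j ω) i with hX
  have hρ : 0 < ε₂ / L₂ := div_pos hε₂ hL₂
  let ms : ℕ → MeasurableSpace Ω := fun i =>
    ⨆ j ∈ Set.Iio i, MeasurableSpace.comap (b j) inferInstance
  have hms : ∀ i j, j < i → MeasurableSpace.comap (b j) inferInstance ≤ ms i := fun i j hij =>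
    le_iSup₂_of_le (f := fun j (_ : j ∈ Set.Iio i) => MeasurableSpace.comap (b j) inferInstance)
      j hij le_rfl
  have hbm : ∀ i j, j < i → Measurable[ms i] (b j) := fun i j hij =>
    (comap_measurable (b j)).mono (hms i j hij) le_rfl
  have hle : ∀ j, MeasurableSpace.comap (b j) inferInstance ≤ (inferInstance : MeasurableSpace Ω) :=
    fun j => (hb j).comap_le
  have hmsle : ∀ i, ms i ≤ (inferInstance : MeasurableSpace Ω) := fun i =>
    iSup₂_le fun j _ => hle j
  have hXm : ∀ i, Measurable[ms i] (X i) := fun i =>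
    @SmoothObjective.measurable_stepPoint Ω (ms i) d f L₁ L₂ hf ε₁ ε₂ hρ δ T T' x₀ b i (hbm i)
  have hXmeas : ∀ i, Measurable (X i) := fun i => (hXm i).mono (hmsle i) le_rfl
  have hfail : ∀ i, P {ω | ¬ GoodStart f L₁ ε₂ δ (X i ω) (b i ω)} ≤ ENNReal.ofReal δ := by
    intro i
    have hindep : IndepFun (X i) (b i) P := by
      rw [IndepFun_iff_Indep]
      have h1 := indep_iSup_of_disjoint hle ((iIndepFun_iff_iIndep _ _ _).1 hind)
        (S := Set.Iio i) (T := {i}) (by simp)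
      have h2 : Indep (ms i) (MeasurableSpace.comap (b i) inferInstance) P := by
        simp only [Set.mem_singleton_iff, iSup_iSup_eq_left] at h1
        exact h1
      exact indep_of_indep_of_le_left h2 (hXm i).comap_le
    have hprod := hindep.map_prod_eq_prod_map_map (hXmeas i).aemeasurable (hb i).aemeasurable
    have hS : MeasurableSet {p : E d × E d | ¬ GoodStart f L₁ ε₂ δ p.1 p.2} :=
      (hf.measurableSet_goodStart ε₂ δ).compl
    have : IsProbabilityMeasure (P.map (X i)) :=
      Measure.isProbabilityMeasure_map (hXmeas i).aemeasurable
    have : IsProbabilityMeasure (P.map (b i)) :=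
      Measure.isProbabilityMeasure_map (hb i).aemeasurable
    calc P {ω | ¬ GoodStart f L₁ ε₂ δ (X i ω) (b i ω)}
        = P.map (fun ω => (X i ω, b i ω)) {p | ¬ GoodStart f L₁ ε₂ δ p.1 p.2} := by
          rw [Measure.map_apply ((hXmeas i).prodMk (hb i)) hS]; rfl
      _ = ∫⁻ x, P.map (b i) {y | ¬ GoodStart f L₁ ε₂ δ x y} ∂(P.map (X i)) := by
          rw [hprod, Measure.prod_apply hS]; rfl
      _ ≤ ∫⁻ _, ENNReal.ofReal δ ∂(P.map (X i)) := by
          refine lintegral_mono fun x => ?_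
          rw [hmap i]
          exact uniformSphere_not_goodStart_le hd hf hL₁ hε₂ hδ hδ1 x
      _ = ENNReal.ofReal δ := by simp
  have hunion : {ω | ∃ i < N, ¬ GoodStart f L₁ ε₂ δ (X i ω) (b i ω)} =
      ⋃ i ∈ Finset.range N, {ω | ¬ GoodStart f L₁ ε₂ δ (X i ω) (b i ω)} := by
    ext ω; simp
  rw [hunion]
  refine (measure_biUnion_finset_le _ _).trans ((Finset.sum_le_sum fun i _ => hfail i).trans ?_)
  simp

end Measurability


/-! ### Bounds on the parameters of a run -/

section Parameters

/-- A polynomial bound in `τ` becomes a multiple of `log τ` after taking logarithms. -/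
lemma log_le_mul_log {c τ y : ℝ} {k : ℕ} (hc : 1 ≤ c) (hτ : 0 < τ) (hlog : 1 ≤ Real.log τ)
    (hy : 0 < y) (h : y ≤ c * τ ^ k) : Real.log y ≤ (Real.log c + k) * Real.log τ := by
  have h1 : Real.log y ≤ Real.log c + k * Real.log τ := by
    rw [← Real.log_pow, ← Real.log_mul (by positivity) (by positivity)]
    exact Real.log_le_log hy h
  have h2 : Real.log c ≤ Real.log c * Real.log τ :=
    le_mul_of_one_le_right (Real.log_nonneg hc) hlog
  linarith

/-- The number of Lanczos steps, up to an absolute constant. The failure probability of a single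
step is `δ / (K (1 + a))`; because `1 + a ≤ K` and `2 ≤ K`, its logarithm is at most four times
that of `dK / δ`. -/
lemma lanczosSteps_le {d : ℕ} (hd : 1 ≤ d) {L₁ g δ a : ℝ} {K : ℕ} (hg : 0 < g) (hδ : 0 < δ)
    (hδ1 : δ ≤ 1) (hK : 2 ≤ K) (ha : 0 ≤ a) (haK : 1 + a ≤ K) :
    (lanczosSteps d L₁ (g / 2) (δ / K / (1 + a)) : ℝ) ≤
      2 + 8 * (Real.sqrt L₁ / Real.sqrt g * Real.log (d / (δ / K))) := by
  have hd' : (1 : ℝ) ≤ d := by exact_mod_cast hd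
  have hK' : (2 : ℝ) ≤ K := by exact_mod_cast hK
  set y : ℝ := d / (δ / K) with hy
  have hdδ : 1 ≤ d / δ := by rw [le_div_iff₀ hδ]; linarith
  have hyK : y = d / δ * K := by rw [hy]; field_simp
  have hKy : K ≤ y := by rw [hyK]; exact le_mul_of_one_le_left (by positivity) hdδ
  have hy0 : 0 < y := by linarith
  have hlog : Real.log (4 * d / (δ / K / (1 + a))) ≤ 4 * Real.log y := by
    have h1 : 4 * d / (δ / K / (1 + a)) = 4 * y * (1 + a) := by rw [hy]; field_simp
    have h2 : 4 * y * (1 + a) ≤ y ^ 4 := by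
      calc 4 * y * (1 + a) ≤ 4 * y * y := by gcongr; linarith
        _ = 2 ^ 2 * y ^ 2 := by ring
        _ ≤ y ^ 2 * y ^ 2 := by gcongr; linarith
        _ = y ^ 4 := by ring
    have h3 := Real.log_le_log (by positivity) h2
    rw [Real.log_pow] at h3
    rw [h1]; exact_mod_cast h3
  have hlog0 : 0 ≤ Real.log (4 * d / (δ / K / (1 + a))) := by
    refine Real.log_nonneg ?_
    rw [one_le_div (by positivity)]
    have h1 : δ / K ≤ 1 := by rw [div_le_one (by positivity)]; linarith
    have h2 : δ / K / (1 + a) ≤ δ / K := div_le_self (by positivity) (by linarith)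
    linarith
  have hsq : Real.sqrt L₁ / Real.sqrt (g / 2) ≤ 2 * (Real.sqrt L₁ / Real.sqrt g) := by
    have h2 : Real.sqrt 2 ≤ 2 := by rw [Real.sqrt_le_iff]; norm_num
    rw [Real.sqrt_div hg.le, div_div_eq_mul_div, mul_comm, mul_div_assoc]
    gcongr
  rw [lanczosSteps]
  push_cast
  have hceil := (Nat.ceil_lt_add_one (a := Real.sqrt L₁ / Real.sqrt (g / 2) *
    Real.log (4 * d / (δ / K / (1 + a)))) (by positivity)).le
  have hprod : Real.sqrt L₁ / Real.sqrt (g / 2) * Real.log (4 * d / (δ / K / (1 + a))) ≤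
      2 * (Real.sqrt L₁ / Real.sqrt g) * (4 * Real.log y) := by gcongr
  linarith

lemma lanczosSteps_anti {d : ℕ} (hd : 1 ≤ d) {L₁ ε g δ : ℝ} (hε : 0 < ε) (hεg : ε ≤ g)
    (hδ : 0 < δ) (hδ1 : δ ≤ 1) : lanczosSteps d L₁ g δ ≤ lanczosSteps d L₁ ε δ := by
  have hd' : (1 : ℝ) ≤ d := by exact_mod_cast hd
  have hlog0 : 0 ≤ Real.log (4 * d / δ) :=
    Real.log_nonneg (by rw [one_le_div hδ]; linarith)
  have := Real.sqrt_pos.2 hε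
  unfold lanczosSteps
  gcongr

/-- The number `T` of gradient steps after which the accelerated gradient method has reached the
inner tolerance is `O(ε₂ ^ (-1/2) log τ)`. -/
lemma exists_agd_steps {L₁ Δ : ℝ} (hL₁ : 0 < L₁) (hΔ : 0 < Δ) : ∃ c > 0, ∀ ε₁ ε₂ τ : ℝ,
    0 < ε₁ → 0 < ε₂ → ε₂ ≤ 1 → ε₂ ≤ L₁ / 3 → 0 < τ → 1 ≤ Real.log τ → 1 / ε₁ ≤ τ →
    1 / ε₂ ≤ τ → ∃ T : ℕ,
      2 * (5 * L₁) * ((1 - 1 / Real.sqrt (5 * L₁ / (3 * ε₂))) ^ T *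
        (10 * L₁ * Δ / (3 * ε₂))) ≤ innerTol L₁ ε₁ ε₂ ^ 2 ∧
      (T : ℝ) ≤ c * (Real.log τ / Real.sqrt ε₂) := by
  set c₀ := 20000 * L₁ ^ 2 * Δ / 9 * (5 * L₁ + 6) with hc₀
  have hc₀0 : 0 < c₀ := by positivity
  have hlc : 0 ≤ Real.log (1 + c₀) := Real.log_nonneg (by linarith)
  refine ⟨1 + Real.sqrt (5 * L₁ / 3) * (Real.log (1 + c₀) + (4 : ℕ)), by positivity, ?_⟩
  intro ε₁ ε₂ τ hε₁ hε₂ hε₂1 hε₂L hτ hlog hτ1 hτ2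
  set κ := 5 * L₁ / (3 * ε₂) with hκ
  have hκ1 : 1 ≤ κ := by rw [hκ, one_le_div (by positivity)]; linarith
  have hsκ : 1 ≤ Real.sqrt κ := Real.one_le_sqrt.2 hκ1
  have htol : innerTol L₁ ε₁ ε₂ ^ 2 = (ε₁ / 2) ^ 2 * (3 * ε₂ / (50 * (5 * L₁ + 2 * (3 * ε₂)))) := by
    rw [innerTol, mul_pow, Real.sq_sqrt (by positivity)]
  have htol0 : 0 < innerTol L₁ ε₁ ε₂ ^ 2 := by rw [htol]; positivity
  set y := 2 * (5 * L₁) * (10 * L₁ * Δ / (3 * ε₂)) / innerTol L₁ ε₁ ε₂ ^ 2 with hy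
  have hy0 : 0 < y := by positivity
  have hyle : 1 + y ≤ (1 + c₀) * τ ^ 4 := by
    have h1 : y = 20000 * L₁ ^ 2 * Δ / 9 * (5 * L₁ + 6 * ε₂) * ((1 / ε₁) ^ 2 * (1 / ε₂) ^ 2) := by
      rw [hy, htol]; field_simp; ring
    have hτ1' : 1 ≤ τ := by
      by_contra h
      have := Real.log_nonpos hτ.le (not_le.1 h).le
      linarith
    have h2 : y ≤ c₀ * (τ ^ 2 * τ ^ 2) := by
      rw [h1, hc₀]; gcongr; linarith
    have h3 : 1 ≤ τ ^ 4 := one_le_pow₀ hτ1'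
    calc 1 + y ≤ τ ^ 4 + c₀ * (τ ^ 2 * τ ^ 2) := add_le_add h3 h2
      _ = (1 + c₀) * τ ^ 4 := by ring
  have hly := log_le_mul_log (by linarith) hτ hlog (by linarith) hyle
  have hly0 : 0 ≤ Real.log (1 + y) := Real.log_nonneg (by linarith)
  refine ⟨⌈Real.sqrt κ * Real.log (1 + y)⌉₊, ?_, ?_⟩
  · set T := ⌈Real.sqrt κ * Real.log (1 + y)⌉₊ with hT
    have hT1 : Real.sqrt κ * Real.log (1 + y) ≤ T := Nat.le_ceil _
    have hpow : (1 - 1 / Real.sqrt κ) ^ T ≤ 1 / y := by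
      have h0 : 0 ≤ 1 - 1 / Real.sqrt κ := by
        have : 1 / Real.sqrt κ ≤ 1 := by rw [div_le_one (by linarith)]; exact hsκ
        linarith
      calc (1 - 1 / Real.sqrt κ) ^ T ≤ Real.exp (-(1 / Real.sqrt κ)) ^ T := by
            gcongr; exact Real.one_sub_le_exp_neg _
        _ = Real.exp (-(T / Real.sqrt κ)) := by rw [← Real.exp_nat_mul]; congr 1; ring
        _ ≤ Real.exp (-Real.log (1 + y)) := by
            rw [Real.exp_le_exp, neg_le_neg_iff, le_div_iff₀ (by linarith), mul_comm]
            exact hT1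
        _ = 1 / (1 + y) := by rw [Real.exp_neg, Real.exp_log (by linarith), one_div]
        _ ≤ 1 / y := by gcongr; linarith
    calc 2 * (5 * L₁) * ((1 - 1 / Real.sqrt κ) ^ T * (10 * L₁ * Δ / (3 * ε₂)))
        ≤ 2 * (5 * L₁) * (1 / y * (10 * L₁ * Δ / (3 * ε₂))) := by gcongr
      _ = innerTol L₁ ε₁ ε₂ ^ 2 := by rw [hy]; field_simp
  · have hs0 : 0 < Real.sqrt ε₂ := Real.sqrt_pos.2 hε₂
    have hs1 : Real.sqrt ε₂ ≤ 1 := Real.sqrt_le_one.2 hε₂1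
    have hκs : Real.sqrt κ = Real.sqrt (5 * L₁ / 3) / Real.sqrt ε₂ := by
      rw [← Real.sqrt_div (by positivity), hκ, div_div]
    have h1 : 1 ≤ Real.log τ / Real.sqrt ε₂ := by rw [one_le_div hs0]; linarith
    calc (⌈Real.sqrt κ * Real.log (1 + y)⌉₊ : ℝ) ≤ Real.sqrt κ * Real.log (1 + y) + 1 :=
          (Nat.ceil_lt_add_one (by positivity)).le
      _ ≤ Real.sqrt κ * ((Real.log (1 + c₀) + (4 : ℕ)) * Real.log τ) +
          Real.log τ / Real.sqrt ε₂ := by gcongr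
      _ = _ := by rw [hκs]; ring

/-- The number of outer iterations and the number of NCG steps are `O(1 / ε₂³ + 1 / (ε₁ ε₂))`. -/
lemma outerBound_le {L₁ L₂ Δ ε₁ ε₂ : ℝ} (hL₂ : 0 < L₂) (hΔ : 0 < Δ) (hε₁ : 0 < ε₁)
    (hε₂ : 0 < ε₂) (hε₂1 : ε₂ ≤ 1) :
    (outerBound L₁ L₂ Δ ε₁ ε₂ : ℝ) + max (12 * L₂ ^ 2) (2 * L₁) / ε₂ ^ 3 * Δ ≤
      (2 + 2 * (max (12 * L₂ ^ 2) (2 * L₁) * Δ) + 2 * Real.sqrt 10 * L₂ * Δ) *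
        (1 / ε₂ ^ 3 + 1 / (ε₁ * ε₂)) := by
  set M := max (12 * L₂ ^ 2) (2 * L₁) with hM
  have hM0 : 0 < M := lt_max_of_lt_left (by positivity)
  have h1 : (outerBound L₁ L₂ Δ ε₁ ε₂ : ℝ) ≤
      1 + Δ * (M / ε₂ ^ 3 + 2 * Real.sqrt 10 * L₂ / (ε₁ * ε₂)) + 1 :=
    (Nat.ceil_lt_add_one (by positivity)).le
  have hu : 1 ≤ 1 / ε₂ ^ 3 := by
    rw [one_le_div (by positivity)]; exact pow_le_one₀ hε₂.le hε₂1
  have hv : 0 < 1 / (ε₁ * ε₂) := by positivity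
  have e1 : M / ε₂ ^ 3 = M * (1 / ε₂ ^ 3) := by ring
  have e2 : 2 * Real.sqrt 10 * L₂ / (ε₁ * ε₂) = 2 * Real.sqrt 10 * L₂ * (1 / (ε₁ * ε₂)) := by ring
  rw [e1, e2] at h1
  rw [e1]
  set u := 1 / ε₂ ^ 3
  set v := 1 / (ε₁ * ε₂)
  have h3 : 0 ≤ 2 * (M * Δ) * v := by positivity
  have h4 : 0 ≤ 2 * Real.sqrt 10 * L₂ * Δ * u := by positivity
  nlinarith

/-- The number of outer iterations is polynomial in `τ`, so that it only contributes to the constant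
in front of `log τ`. -/
lemma exists_log_outerBound_le {L₁ L₂ Δ : ℝ} (hL₂ : 0 < L₂) (hΔ : 0 < Δ) : ∃ c > 0,
    ∀ (d : ℕ) (ε₁ ε₂ δ τ : ℝ), 1 ≤ d → 0 < ε₁ → 0 < ε₂ → ε₂ ≤ 1 → 0 < δ → 0 < τ →
      1 ≤ Real.log τ → 1 / ε₁ ≤ τ → 1 / ε₂ ≤ τ → 1 / δ ≤ τ → d ≤ τ →
      1 ≤ outerBound L₁ L₂ Δ ε₁ ε₂ →
      Real.log (d / (δ / outerBound L₁ L₂ Δ ε₁ ε₂)) ≤ c * Real.log τ := by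
  set M := max (12 * L₂ ^ 2) (2 * L₁) with hM
  have hM0 : 0 < M := lt_max_of_lt_left (by positivity)
  set c₀ := 2 + 2 * (M * Δ) + 2 * Real.sqrt 10 * L₂ * Δ with hc₀
  have hp : 0 ≤ 2 * (M * Δ) := by positivity
  have hq : 0 ≤ 2 * Real.sqrt 10 * L₂ * Δ := by positivity
  have hl : 0 ≤ Real.log (2 * c₀) := Real.log_nonneg (by linarith)
  refine ⟨Real.log (2 * c₀) + (5 : ℕ), by positivity, ?_⟩
  intro d ε₁ ε₂ δ τ hd hε₁ hε₂ hε₂1 hδ hτ hlog h1 h2 h3 h4 hK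
  have hd' : (1 : ℝ) ≤ d := by exact_mod_cast hd
  have hK' : (1 : ℝ) ≤ outerBound L₁ L₂ Δ ε₁ ε₂ := by exact_mod_cast hK
  refine log_le_mul_log (by linarith) hτ hlog (by positivity) ?_
  have hle := outerBound_le (L₁ := L₁) hL₂ hΔ hε₁ hε₂ hε₂1
  rw [← hM] at hle
  have hτ1 : 1 ≤ τ := by linarith
  have hR : 1 / ε₂ ^ 3 + 1 / (ε₁ * ε₂) ≤ 2 * τ ^ 3 := by
    calc 1 / ε₂ ^ 3 + 1 / (ε₁ * ε₂) = (1 / ε₂) ^ 3 + 1 / ε₁ * (1 / ε₂) := by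
          rw [one_div_pow, one_div_mul_one_div]
      _ ≤ τ ^ 3 + τ * τ := by gcongr
      _ ≤ τ ^ 3 + τ * τ * τ := by gcongr; exact le_mul_of_one_le_right (by positivity) hτ1
      _ = 2 * τ ^ 3 := by ring
  have hKle : (outerBound L₁ L₂ Δ ε₁ ε₂ : ℝ) ≤ c₀ * (2 * τ ^ 3) := by
    have : 0 ≤ M / ε₂ ^ 3 * Δ := by positivity
    calc (outerBound L₁ L₂ Δ ε₁ ε₂ : ℝ) ≤ c₀ * (1 / ε₂ ^ 3 + 1 / (ε₁ * ε₂)) := by linarith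
      _ ≤ _ := by gcongr
  calc (d : ℝ) / (δ / outerBound L₁ L₂ Δ ε₁ ε₂)
      = d * (1 / δ) * outerBound L₁ L₂ Δ ε₁ ε₂ := by field_simp
    _ ≤ τ * τ * (c₀ * (2 * τ ^ 3)) := by gcongr
    _ = 2 * c₀ * τ ^ 5 := by ring

/-- A lower bound, in terms of `L₁` and `Δ` only, for the leading term in the cost of an NCG
step: it exists because gradients are bounded on the sublevel set of the starting point. -/
lemma SmoothObjective.ncg_cost_ge {d : ℕ} {f : E d → ℝ} {L₁ L₂ Δ ε₂ y : ℝ}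
    (hf : SmoothObjective f L₁ L₂) (hL₁ : 0 < L₁) {x₀ x : E d} (hΔ : ∀ x, f x₀ - f x ≤ Δ)
    (hx : f x ≤ f x₀) (hε₂1 : ε₂ ≤ 1) (hε₂ : 0 < ε₂) (hy : 2 ≤ y) :
    Real.sqrt L₁ / Real.sqrt (max 1 (Real.sqrt (2 * L₁ * Δ))) * Real.log 2 ≤
      Real.sqrt L₁ / Real.sqrt (max ε₂ ‖gradient f x‖) * Real.log y := by
  have hgrad : ‖gradient f x‖ ^ 2 ≤ 2 * L₁ * Δ := by
    have h := norm_gradient_sq_le (m := f x₀ - Δ) hL₁ hf.hasGradientAt hf.gradient_lipschitz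
      (fun z => by linarith [hΔ z]) x
    refine h.trans ?_
    gcongr
    linarith
  have h1 : ‖gradient f x‖ ≤ Real.sqrt (2 * L₁ * Δ) := Real.le_sqrt_of_sq_le hgrad
  have h2 : 0 < max ε₂ ‖gradient f x‖ := lt_max_of_lt_left hε₂
  have h3 := Real.sqrt_pos.2 h2
  have := Real.log_nonneg (one_le_two (α := ℝ))
  gcongr

end Parameters


/-! ### The probability of a good run -/

section Run

variable {d : ℕ} {f : E d → ℝ} {L₁ L₂ Δ ε₁ ε₂ δ a : ℝ}

/-- Outside an event of probability at most `δ`, NCG-B1 satisfies the bounds of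
`ncgB1_terminates`. Each step may fail with probability `δ / (K (1 + a))`, and at most
`K + a ≤ K (1 + a)` steps are made. -/
theorem SmoothObjective.measure_not_run_le (hf : SmoothObjective f L₁ L₂) (hd : 1 ≤ d)
    (hL₁ : 0 < L₁) (hL₂ : 0 < L₂) (hΔ0 : 0 < Δ) {x₀ : E d} (hΔ : ∀ x, f x₀ - f x ≤ Δ)
    (hε₁ : 0 < ε₁) (hε₂ : 0 < ε₂) (hε₂1 : ε₂ ≤ 1) (hε₂L : ε₂ ≤ L₁ / 3) (hδ : 0 < δ)
    (hδ1 : δ < 1) {K : ℕ} (hK : K = outerBound L₁ L₂ Δ ε₁ ε₂) (hK2 : 2 ≤ K)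
    (ha : a = max (12 * L₂ ^ 2) (2 * L₁) / ε₂ ^ 3 * Δ) {T : ℕ}
    (hT : 2 * (5 * L₁) * ((1 - 1 / Real.sqrt (5 * L₁ / (3 * ε₂))) ^ T *
      (10 * L₁ * Δ / (3 * ε₂))) ≤ innerTol L₁ ε₁ ε₂ ^ 2)
    {Ω : Type*} [MeasurableSpace Ω] (P : Measure Ω) [IsProbabilityMeasure P]
    {b : ℕ → Ω → E d} (hb : ∀ i, Measurable (b i)) (hmap : ∀ i, P.map (b i) = uniformSphere d)
    (hind : iIndepFun b P) :
    P {ω | ¬ Terminates (ncgB1 f L₁ L₂ Δ (fun i => b i ω) x₀ ε₁ ε₂ δ) (Log.empty d) fun z l =>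
      ‖gradient f z‖ ≤ ε₁ ∧ (∀ u, -ε₂ * ‖u‖ ^ 2 ≤ ⟪u, hessian f z u⟫) ∧
      (l.ncgSteps.length : ℝ) ≤ K + a ∧
      (l.agdSteps : ℝ) ≤ T * (K + 60 * ε₂ / ε₁ ^ 2 * Δ) ∧
      (l.grads : ℝ) ≤ 2 * l.ncgSteps.length + 2 * K + (2 * T + 2) * (K + 60 * ε₂ / ε₁ ^ 2 * Δ) ∧
      l.hvps ≤ l.ncgSteps.length * (lanczosSteps d L₁ (ε₂ / 2) (δ / K / (1 + a)) + 2) ∧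
      ∀ s ∈ l.ncgSteps, s.IsCheap f L₁ ε₂ (δ / K / (1 + a)) (f x₀)} ≤ ENNReal.ofReal δ := by
  set M := max (12 * L₂ ^ 2) (2 * L₁) with hM
  have hM0 : 0 < M := lt_max_of_lt_left (by positivity)
  set q := 2 * Real.sqrt 10 * L₂ / (ε₁ * ε₂) with hq
  have hq0 : 0 < q := by positivity
  have hQ0 : 0 < M / ε₂ ^ 3 + q := by positivity
  have hKQ : 1 + Δ * (M / ε₂ ^ 3 + q) ≤ K := hK ▸ Nat.le_ceil _
  have hK1 : (1 : ℝ) ≤ K := by exact_mod_cast one_le_two.trans hK2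
  have hKpos : (0 : ℝ) < K := by linarith
  set η := ε₂ ^ 3 / M with hη
  have hη0 : 0 < η := by positivity
  have ha0 : 0 ≤ a := by rw [ha]; positivity
  have haη : Δ / η = a := by rw [hη, ha]; field_simp
  set δ' := δ / K / (1 + a) with hδ'
  have hδ'0 : 0 < δ' := by positivity
  have hδ'1 : δ' ≤ 1 := by
    rw [hδ', div_div, div_le_one (by positivity)]
    nlinarith
  have hpow : (ε₂ ^ (3 / 2 : ℝ)) ^ 2 = ε₂ ^ 3 := by
    rw [← Real.rpow_natCast, ← Real.rpow_mul hε₂.le, ← Real.rpow_natCast]; norm_num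
  have hδ'eq : δ' = δ / K / (1 + max (12 * L₂ ^ 2 / ε₂ ^ 3)
      (2 * L₁ / (ε₂ ^ (3 / 2 : ℝ)) ^ 2) * Δ) := by
    rw [hpow, hδ', ha, hM, max_div_div_right (by positivity)]
  set N := ⌊(K : ℝ) + a⌋₊ with hN
  have hN1 : (K : ℝ) - 1 + Δ / η < N := by
    rw [haη]; have := Nat.lt_floor_add_one ((K : ℝ) + a); linarith
  have hN2 : (N : ℝ) ≤ K + a := Nat.floor_le (by positivity)
  have hNδ : (N : ℝ) * δ' ≤ δ := by
    have h1 : (K : ℝ) + a ≤ K * (1 + a) := by nlinarith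
    calc (N : ℝ) * δ' ≤ K * (1 + a) * δ' := by gcongr; exact hN2.trans h1
      _ = δ := by rw [hδ']; field_simp
  set T' := ⌊60 * ε₂ * Δ / ε₁ ^ 2⌋₊ + 1 with hT'
  have hT'lt : 60 * ε₂ * Δ < ε₁ ^ 2 * T' := by
    have h1 := Nat.lt_floor_add_one (60 * ε₂ * Δ / ε₁ ^ 2)
    rw [div_lt_iff₀ (by positivity)] at h1
    rw [hT', mul_comm (ε₁ ^ 2)]; push_cast; exact h1
  have hHle : ∀ x, lanczosSteps d L₁ (max ε₂ ‖gradient f x‖ / 2) δ' + 2 ≤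
      lanczosSteps d L₁ (ε₂ / 2) δ' + 2 := by
    intro x
    refine Nat.add_le_add_right (lanczosSteps_anti hd (by positivity) ?_ hδ'0 hδ'1) 2
    linarith [le_max_left ε₂ ‖gradient f x‖]
  have hMη : M / ε₂ ^ 3 = η⁻¹ := by rw [hη, inv_div]
  have hp1 : (M / ε₂ ^ 3 + q)⁻¹ ≤ η := by
    rw [inv_le_comm₀ hQ0 hη0, ← hMη]
    exact le_add_of_nonneg_right hq0.le
  have h12 : η ≤ ε₂ ^ 3 / (12 * L₂ ^ 2) := by rw [hη]; gcongr; exact le_max_left _ _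
  have h2L : η ≤ ε₂ ^ 3 / (2 * L₁) := by rw [hη]; gcongr; exact le_max_right _ _
  have hp2 : (M / ε₂ ^ 3 + q)⁻¹ ≤
      min (3 * ε₂ ^ 3 / L₂ ^ 2) (ε₁ * ε₂ / (2 * Real.sqrt 10 * L₂)) := by
    refine le_min ((hp1.trans h12).trans ?_) ?_
    · have h1 : 0 < ε₂ ^ 3 := by positivity
      have h2 : 0 < L₂ ^ 2 := by positivity
      exact div_le_div₀ (by positivity) (by linarith) h2 (by linarith)
    · rw [← inv_div _ (ε₁ * ε₂), ← hq]
      exact inv_anti₀ hq0 (le_add_of_nonneg_left (by positivity))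
  refine le_trans (measure_mono ?_) ((measure_exists_not_goodStart_le hd hf hL₁ hL₂ (ε₁ := ε₁)
    hε₂ hδ'0 hδ'1 T T' x₀ P hb hmap hind N).trans ?_)
  · intro ω hω
    by_contra hbad
    refine hω ?_
    have hgood : ∀ i < N, GoodStart f L₁ ε₂ δ'
        (stepPoint f L₁ L₂ ε₁ ε₂ δ' T T' x₀ (fun j => b j ω) i) (b i ω) := by
      intro i hi
      by_contra h
      exact hbad ⟨i, hi, h⟩
    have hrun := ncgB1_terminates hf hL₁ hL₂ hΔ hε₁ hε₂ hε₂1 hε₂L hη0 h12 h2L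
      (inv_pos.2 hQ0) hp1 hp2 hK (by rw [div_inv_eq_mul]; exact hKQ) hδ'eq hT hT'lt hN1 hgood hHle
    rw [haη] at hrun
    exact hrun
  · rw [← ENNReal.ofReal_natCast, ← ENNReal.ofReal_mul (by positivity)]
    exact ENNReal.ofReal_le_ofReal hNδ

end Run

/-! ### Adding up the costs -/

section Cost

variable {L₁ Δ ε₁ ε₂ : ℝ}

lemma rpow_natCast_div_two (hε₂ : 0 ≤ ε₂) (n : ℕ) :
    ε₂ ^ ((n : ℝ) / 2) = Real.sqrt ε₂ ^ n := by
  rw [Real.sqrt_eq_rpow, ← Real.rpow_natCast, ← Real.rpow_mul hε₂]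
  congr 1; ring

/-- With `R = 1 / ε₂³ + 1 / (ε₁ ε₂)` and `s = √ε₂`, the number of runs of the accelerated gradient
method is `O(R + s² / ε₁²)`. It is divided by `s` because the length of a run is proportional to
`1 / s`. -/
lemma agdRuns_div_le {s cR K : ℝ} (hs : 0 < s) (hε₁ : 0 < ε₁)
    (hK : K ≤ cR * (1 / (s ^ 2) ^ 3 + 1 / (ε₁ * s ^ 2))) :
    (K + 60 * s ^ 2 / ε₁ ^ 2 * Δ) / s ≤
      cR * (1 / s ^ 7 + 1 / (ε₁ * s ^ 3)) + 60 * Δ * (s / ε₁ ^ 2) := by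
  rw [add_div]
  refine add_le_add ?_ (le_of_eq (by field_simp))
  rw [div_le_iff₀ hs]
  refine hK.trans (le_of_eq ?_)
  field_simp

lemma agdSteps_le {s cR cT ℓ A B W T : ℝ} {n : ℕ} (hcR : 0 ≤ cR) (hcT : 0 ≤ cT)
    (hΔ : 0 ≤ Δ) (hℓ : 0 ≤ ℓ) (hA : 0 ≤ A) (hB : 0 ≤ B) (hW0 : 0 ≤ W)
    (hW : W / s ≤ cR * A + 60 * Δ * B) (hT : T ≤ cT * (ℓ / s)) (hn : n ≤ T * W) :
    (n : ℝ) ≤ cT * (cR + 60 * Δ) * (A + B) * ℓ := by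
  have h1 : 0 ≤ cR * B := by positivity
  have h2 : 0 ≤ 60 * Δ * A := by positivity
  calc (n : ℝ) ≤ T * W := hn
    _ ≤ cT * (ℓ / s) * W := by gcongr
    _ = cT * ℓ * (W / s) := by ring
    _ ≤ cT * ℓ * (cR * A + 60 * Δ * B) := by gcongr
    _ ≤ cT * ℓ * ((cR + 60 * Δ) * (A + B)) := by gcongr; linarith
    _ = cT * (cR + 60 * Δ) * (A + B) * ℓ := by ring

lemma Log.time_le {d : ℕ} {l : Log d} {s cR cT cH ℓ A B W T H K Tg Th : ℝ} (hs : 0 < s)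
    (hs1 : s ≤ 1) (hcR : 0 ≤ cR) (hcT : 0 ≤ cT) (hcH : 0 ≤ cH) (hΔ : 0 ≤ Δ) (hℓ : 1 ≤ ℓ)
    (hA : 0 ≤ A) (hB : 0 ≤ B) (hW0 : 0 ≤ W) (hTg : 0 ≤ Tg) (hTgh : Tg ≤ Th) (hH0 : 0 ≤ H)
    (hW : W / s ≤ cR * A + 60 * Δ * B) (hT : T ≤ cT * (ℓ / s)) (hH : H ≤ cH * (ℓ / s))
    (hlen : (l.ncgSteps.length : ℝ) ≤ cR * (A * s)) (hK : K ≤ cR * (A * s))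
    (hgrads : (l.grads : ℝ) ≤ 2 * l.ncgSteps.length + 2 * K + (2 * T + 2) * W)
    (hhvps : (l.hvps : ℝ) ≤ l.ncgSteps.length * H) :
    l.time Tg Th ≤ (4 * cR + (2 * cT + 2) * (cR + 60 * Δ) + cR * cH) *
      (A * Th + B * Tg) * ℓ := by
  have hTh : 0 ≤ Th := hTg.trans hTgh
  have hℓ0 : 0 ≤ ℓ := by linarith
  have hR : cR * (A * s) ≤ cR * (A * ℓ) := by gcongr; linarith
  have hTW : (2 * T + 2) * W ≤ (2 * cT + 2) * ℓ * (W / s) := by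
    have h3 : 1 ≤ ℓ / s := by rw [one_le_div hs]; linarith
    calc (2 * T + 2) * W ≤ (2 * (cT * (ℓ / s)) + 2 * (ℓ / s)) * W := by gcongr; linarith
      _ = _ := by ring
  have hgr : (l.grads : ℝ) ≤ 4 * cR * A * ℓ + (2 * cT + 2) * ℓ * (W / s) := by linarith
  -- only the second part of the gradient steps has to be charged at the price of gradients
  have hKW : Tg * (W / s) ≤ cR * A * Th + 60 * Δ * B * Tg := by
    calc Tg * (W / s) ≤ Tg * (cR * A + 60 * Δ * B) := by gcongr
      _ = cR * A * Tg + 60 * Δ * B * Tg := by ring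
      _ ≤ _ := by gcongr
  have hhv : (l.hvps : ℝ) ≤ cR * cH * A * ℓ := by
    calc (l.hvps : ℝ) ≤ l.ncgSteps.length * H := hhvps
      _ ≤ cR * (A * s) * (cH * (ℓ / s)) := by gcongr
      _ = _ := by field_simp
  have h1 : 0 ≤ (2 * cT + 2) * (60 * Δ) * (A * Th * ℓ) := by positivity
  have h2 : 0 ≤ (2 * cT + 2) * cR * (B * Tg * ℓ) := by positivity
  have h3 : 0 ≤ cR * cH * (B * Tg * ℓ) := by positivity
  have h4 : 0 ≤ cR * (B * Tg * ℓ) := by positivity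
  calc l.time Tg Th = Tg * l.grads + Th * l.hvps := rfl
    _ ≤ Tg * (4 * cR * A * ℓ + (2 * cT + 2) * ℓ * (W / s)) + Th * (cR * cH * A * ℓ) := by
        gcongr
    _ = 4 * cR * A * ℓ * Tg + (2 * cT + 2) * ℓ * (Tg * (W / s)) + cR * cH * A * ℓ * Th := by
        ring
    _ ≤ 4 * cR * A * ℓ * Th + (2 * cT + 2) * ℓ * (cR * A * Th + 60 * Δ * B * Tg) +
        cR * cH * A * ℓ * Th := by gcongr
    _ ≤ (4 * cR + (2 * cT + 2) * (cR + 60 * Δ) + cR * cH) * (A * Th + B * Tg) * ℓ := by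
        linarith

lemma StepRecord.IsCheap.time_le {d : ℕ} {f : E d → ℝ} {t : StepRecord d} {x δ' b Tg Th : ℝ}
    (ht : t.IsCheap f L₁ ε₂ δ' b) (hTgh : Tg ≤ Th) (hTh : 0 ≤ Th)
    (hx : (lanczosSteps d L₁ (max ε₂ ‖gradient f t.point‖ / 2) δ' : ℝ) ≤ 2 + 8 * x) :
    t.time Tg Th ≤ 8 * (Th * (1 + x)) := by
  obtain ⟨hg, hh, -⟩ := ht
  have h2 : (t.hvps : ℝ) ≤ lanczosSteps d L₁ (max ε₂ ‖gradient f t.point‖ / 2) δ' + 2 := by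
    exact_mod_cast hh
  calc t.time Tg Th = Tg * 2 + Th * t.hvps := by rw [StepRecord.time, hg]; norm_num
    _ ≤ Th * 2 + Th * (4 + 8 * x) := by gcongr; linarith
    _ ≤ 8 * (Th * (1 + x)) := by linarith

/-- A leading term that is bounded from below absorbs the constant term. -/
lemma one_add_le {x m Th C : ℝ} (hm : 0 < m) (hx : m ≤ x) (hTh : 0 ≤ Th)
    (hC : 8 * (1 / m + 1) ≤ C) : 8 * (Th * (1 + x)) ≤ C * (Th * x) := by
  have hx0 : 0 ≤ x := hm.le.trans hx
  have h1 : 1 ≤ 1 / m * x := by rw [one_div_mul_eq_div, one_le_div hm]; exact hx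
  calc 8 * (Th * (1 + x)) ≤ 8 * (Th * (1 / m * x + x)) := by gcongr
    _ = 8 * (1 / m + 1) * (Th * x) := by ring
    _ ≤ C * (Th * x) := by gcongr

end Cost

end NCG

theorem theorem3 :
    -- `C₀` is an absolute constant
    ∃ C₀ : ℝ, 0 < C₀ ∧
    ∀ L₁ L₂ Δ : ℝ, 0 < L₁ → 0 < L₂ → 0 < Δ →
    -- `C` depends on `L₁`, `L₂`, `Δ` only
    ∃ C : ℝ, 0 < C ∧
    ∀ (d : ℕ) (f : NCG.E d → ℝ) (x₀ : NCG.E d), 1 ≤ d →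
      NCG.SmoothObjective f L₁ L₂ → (∀ x, f x₀ - f x ≤ Δ) →
    ∀ ε₁ ε₂ δ : ℝ, 0 < ε₁ → 0 < ε₂ → ε₂ ≤ 1 → ε₂ ≤ L₁ / 3 → 0 < δ → δ < 1 →
    -- costs of a gradient evaluation and of a Hessian-vector product
    ∀ Tg Th : ℝ, 0 ≤ Tg → Tg ≤ Th →
    -- independent uniformly distributed starting vectors for the Lanczos method
    ∀ {Ω : Type*} [MeasurableSpace Ω] (P : Measure Ω) [IsProbabilityMeasure P]
      (b : ℕ → Ω → NCG.E d), (∀ i, Measurable (b i)) →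
      (∀ i, P.map (b i) = NCG.uniformSphere d) → iIndepFun b P →
    -- outside an event of probability at most `δ`
    P {ω | ¬ ∃ (z : NCG.E d) (l : NCG.Log d),
      -- NCG-B1 terminates and returns `z` with the log `l`
      (z, l) ∈ NCG.ncgB1 f L₁ L₂ Δ (fun i => b i ω) x₀ ε₁ ε₂ δ (NCG.Log.empty d) ∧
      ‖gradient f z‖ ≤ ε₁ ∧
      NCG.lambdaMin (NCG.hessian f z) ≥ -ε₂ ∧
      -- number of NCG steps
      (l.ncgSteps.length : ℝ) ≤ C * (1 / ε₂ ^ 3 + 1 / (ε₁ * ε₂)) ∧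
      -- number of accelerated gradient steps
      (l.agdSteps : ℝ) ≤ C * (1 / ε₂ ^ (7 / 2 : ℝ) + 1 / (ε₁ * ε₂ ^ (3 / 2 : ℝ))
          + ε₂ ^ (1 / 2 : ℝ) / ε₁ ^ 2)
        * Real.log (1 + 1 / ε₁ + 1 / ε₂ + 1 / δ + d + L₁ + L₂ + Δ) ∧
      -- time of each NCG step
      (∀ s ∈ l.ncgSteps,
        s.time Tg Th ≤ C * (Th * (Real.sqrt L₁ / (max ε₂ ‖gradient f s.point‖) ^ (1 / 2 : ℝ)
          * Real.log (d / (δ / NCG.outerBound L₁ L₂ Δ ε₁ ε₂)))) ∧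
        s.time Tg Th ≤ C₀ * (Th * (1 + Real.sqrt L₁ / (max ε₂ ‖gradient f s.point‖) ^ (1 / 2 : ℝ)
          * Real.log (d / (δ / NCG.outerBound L₁ L₂ Δ ε₁ ε₂))))) ∧
      -- total time
      l.time Tg Th ≤ C * ((1 / (ε₁ * ε₂ ^ (3 / 2 : ℝ)) + 1 / ε₂ ^ (7 / 2 : ℝ)) * Th
          + ε₂ ^ (1 / 2 : ℝ) / ε₁ ^ 2 * Tg)
        * Real.log (1 + 1 / ε₁ + 1 / ε₂ + 1 / δ + d + L₁ + L₂ + Δ)}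
      ≤ ENNReal.ofReal δ := by
  refine ⟨8, by norm_num, ?_⟩
  intro L₁ L₂ Δ hL₁ hL₂ hΔ0
  obtain ⟨cT, hcT, hexT⟩ := NCG.exists_agd_steps hL₁ hΔ0
  obtain ⟨cK, hcK, hlogK⟩ := NCG.exists_log_outerBound_le (L₁ := L₁) hL₂ hΔ0
  set M := max (12 * L₂ ^ 2) (2 * L₁) with hM
  have hM0 : 0 < M := lt_max_of_lt_left (by positivity)
  set cR := 2 + 2 * (M * Δ) + 2 * Real.sqrt 10 * L₂ * Δ with hcR
  have hcR0 : 0 < cR := by positivity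
  -- a lower bound for the leading term in the cost of an NCG step
  set xm := Real.sqrt L₁ / Real.sqrt (max 1 (Real.sqrt (2 * L₁ * Δ))) * Real.log 2 with hxm
  have hxm0 : 0 < xm := by
    have h1 : 0 < max 1 (Real.sqrt (2 * L₁ * Δ)) := lt_max_of_lt_left one_pos
    have h2 := Real.log_pos one_lt_two
    positivity
  set cH := 4 + 8 * Real.sqrt L₁ * cK with hcH
  have hcH0 : 0 < cH := by positivity
  set C₂ := cT * (cR + 60 * Δ) with hC₂
  have hC₂0 : 0 < C₂ := by positivity
  set C₃ := 8 * (1 / xm + 1) with hC₃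
  have hC₃0 : 0 < C₃ := by positivity
  set C₄ := 4 * cR + (2 * cT + 2) * (cR + 60 * Δ) + cR * cH with hC₄
  have hC₄0 : 0 < C₄ := by positivity
  refine ⟨cR + C₂ + C₃ + C₄, by positivity, ?_⟩
  intro d f x₀ hd hf hΔ ε₁ ε₂ δ hε₁ hε₂ hε₂1 hε₂L hδ hδ1 Tg Th hTg hTgh Ω _ P _ b hb hmap hind
  set τ := 1 + 1 / ε₁ + 1 / ε₂ + 1 / δ + d + L₁ + L₂ + Δ with hτ
  have hd' : (1 : ℝ) ≤ d := by exact_mod_cast hd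
  have hi₁ : 0 < 1 / ε₁ := by positivity
  have hi₂ : 0 < 1 / ε₂ := by positivity
  have hi₃ : 1 ≤ 1 / δ := by rw [one_le_div hδ]; exact hδ1.le
  have hτ3 : 3 ≤ τ := by linarith
  have hlog : 1 ≤ Real.log τ := by
    rw [Real.le_log_iff_exp_le (by linarith)]
    exact Real.exp_one_lt_three.le.trans hτ3
  obtain ⟨T, hT, hTle⟩ := hexT ε₁ ε₂ τ hε₁ hε₂ hε₂1 hε₂L (by linarith) hlog (by linarith)
    (by linarith)
  set K := NCG.outerBound L₁ L₂ Δ ε₁ ε₂ with hK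
  -- `a` bounds the number of NCG steps that do not return
  set a := M / ε₂ ^ 3 * Δ with ha
  have hq0 : 0 < Δ * (2 * Real.sqrt 10 * L₂ / (ε₁ * ε₂)) := by positivity
  have ha0 : 0 < a := by positivity
  have haK : 1 + a + Δ * (2 * Real.sqrt 10 * L₂ / (ε₁ * ε₂)) ≤ K := by
    refine le_trans (le_of_eq ?_) (Nat.le_ceil _)
    rw [ha]; ring
  have hK2 : 2 ≤ K := by
    have h1 : (1 : ℝ) < K := by linarith
    exact_mod_cast h1
  refine le_trans (measure_mono ?_) (hf.measure_not_run_le hd hL₁ hL₂ hΔ0 hΔ hε₁ hε₂ hε₂1 hε₂L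
    hδ hδ1 hK hK2 ha hT P hb hmap hind)
  refine fun ω hω hrun => hω ?_
  obtain ⟨z, l, hzl, hgz, hcurv, hlen, hagd, hgrads, hhvps, hsteps⟩ := hrun
  -- with `s = √ε₂` all real powers become natural powers
  set s := Real.sqrt ε₂ with hs
  have hs0 : 0 < s := Real.sqrt_pos.2 hε₂
  have hs1 : s ≤ 1 := Real.sqrt_le_one.2 hε₂1
  have hs2 : s ^ 2 = ε₂ := Real.sq_sqrt hε₂.le
  have e1 : ε₂ ^ (1 / 2 : ℝ) = s := by simpa using NCG.rpow_natCast_div_two hε₂.le 1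
  have e3 : ε₂ ^ (3 / 2 : ℝ) = s ^ 3 := by simpa using NCG.rpow_natCast_div_two hε₂.le 3
  have e7 : ε₂ ^ (7 / 2 : ℝ) = s ^ 7 := by simpa using NCG.rpow_natCast_div_two hε₂.le 7
  set ℓ := Real.log τ with hℓ
  have hℓ0 : 0 < ℓ := by linarith
  set R := 1 / ε₂ ^ 3 + 1 / (ε₁ * ε₂) with hR
  set A := 1 / s ^ 7 + 1 / (ε₁ * s ^ 3) with hA
  set B := s / ε₁ ^ 2 with hB
  have hR0 : 0 < R := by positivity
  have hA0 : 0 < A := by positivity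
  have hB0 : 0 < B := by positivity
  have hAR : R = A * s := by rw [hA, hR, ← hs2]; field_simp
  have hKa : (K : ℝ) + a ≤ cR * R := NCG.outerBound_le hL₂ hΔ0 hε₁ hε₂ hε₂1
  have hKR : (K : ℝ) ≤ cR * R := by linarith
  have hlenR : (l.ncgSteps.length : ℝ) ≤ cR * R := by linarith
  set W := (K : ℝ) + 60 * ε₂ / ε₁ ^ 2 * Δ with hW
  have hWs : W / s ≤ cR * A + 60 * Δ * B := by
    rw [hW, ← hs2]
    exact NCG.agdRuns_div_le hs0 hε₁ (by rw [hs2]; exact hKR)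
  have hW0 : 0 ≤ W := by positivity
  have hlogR : Real.log (d / (δ / K)) ≤ cK * ℓ :=
    hlogK d ε₁ ε₂ δ τ hd hε₁ hε₂ hε₂1 hδ (by linarith) hlog (by linarith) (by linarith)
      (by linarith) (by linarith) (by omega)
  have hHb : ((NCG.lanczosSteps d L₁ (ε₂ / 2) (δ / K / (1 + a)) + 2 : ℕ) : ℝ) ≤
      cH * (ℓ / s) := by
    have h1 := NCG.lanczosSteps_le (L₁ := L₁) hd hε₂ hδ hδ1.le hK2 ha0.le (by linarith)
    have h2 : Real.sqrt L₁ / s * Real.log (d / (δ / K)) ≤ Real.sqrt L₁ / s * (cK * ℓ) := by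
      gcongr
    have h3 : 1 ≤ ℓ / s := by rw [one_le_div hs0]; linarith
    push_cast
    calc (NCG.lanczosSteps d L₁ (ε₂ / 2) (δ / K / (1 + a)) : ℝ) + 2
        ≤ 4 * (ℓ / s) + 8 * (Real.sqrt L₁ / s * (cK * ℓ)) := by linarith
      _ = cH * (ℓ / s) := by rw [hcH]; ring
  refine ⟨z, l, hzl, hgz, NCG.le_lambdaMin hd (hf.hessian_symm z) hcurv, ?_, ?_, ?_, ?_⟩
  · refine hlenR.trans (mul_le_mul_of_nonneg_right ?_ hR0.le)
    linarith
  · rw [e7, e3, e1]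
    refine (NCG.agdSteps_le hcR0.le hcT.le hΔ0.le hℓ0.le hA0.le hB0.le hW0 hWs hTle
      hagd).trans ?_
    exact mul_le_mul_of_nonneg_right (mul_le_mul_of_nonneg_right (by linarith) (by positivity))
      hℓ0.le
  · intro t ht
    rw [← Real.sqrt_eq_rpow]
    have hg0 : 0 < max ε₂ ‖gradient f t.point‖ := lt_max_of_lt_left hε₂
    have hy : 2 ≤ (d : ℝ) / (δ / K) := by
      rw [div_div_eq_mul_div, le_div_iff₀ hδ]
      have h1 : (1 : ℝ) * 2 ≤ d * K :=
        mul_le_mul hd' (by exact_mod_cast hK2) two_pos.le (by positivity)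
      linarith
    have htime := (hsteps t ht).time_le hTgh (hTg.trans hTgh)
      (NCG.lanczosSteps_le (L₁ := L₁) hd hg0 hδ hδ1.le hK2 ha0.le (by linarith))
    have hxge := hf.ncg_cost_ge hL₁ hΔ (hsteps t ht).2.2 hε₂1 hε₂ hy
    exact ⟨htime.trans (NCG.one_add_le hxm0 hxge (hTg.trans hTgh) (by linarith)), htime⟩
  · rw [e7, e3, e1]
    refine (NCG.Log.time_le hs0 hs1 hcR0.le hcT.le hcH0.le hΔ0.le hlog hA0.le hB0.le hW0 hTg hTgh
      (Nat.cast_nonneg _) hWs hTle hHb (hAR ▸ hlenR) (hAR ▸ hKR) hgrads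
      (by exact_mod_cast hhvps)).trans ?_
    have hTh : 0 ≤ Th := hTg.trans hTgh
    rw [hA, add_comm (1 / s ^ 7)]
    exact mul_le_mul_of_nonneg_right (mul_le_mul_of_nonneg_right (by linarith) (by positivity))
      hℓ0.le
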